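/- Let $n,m\ge 1$ be integers, let $\alpha>0$, and let $\widetilde\mu_n=(2\pi)^{-n/2}\mu_n$, where $\mu_n$ is the Lebesgue measure on $\mathbb R^n$; on $\mathbb R^{2n}=\mathbb R^n\times\mathbb R^n$ put $\widetilde\mu_{2n}=\widetilde\mu_n\times\widetilde\mu_n$. Write $\langle z,w\rangle=\sum_{r=1}^n z_r\overline{w_r}$. A smooth function $f\colon\mathbb C^n\to\mathbb C$ is called $m$-analytic if $\overline D^k f=0$ (iterated Wirtinger derivatives $\partial/\partial\overline z_r$) for every multi-index $k\in\mathbb N_0^n$ with $|k|=m$. Let $\mathcal F_{\alpha,m}$ be the space of all $m$-analytic functions that are square integrable with respect to $\frac{\alpha^n}{\pi^n}e^{-\alpha|z|^2}\,d\mu_{2n}(z)$, with the norm of this $L^2$ space. Put $$(Uf)(x,y)=2^{n/2}e^{-\frac12|x|^2-\frac12|y|^2-i\langle x,y\rangle}f\Bigl(\tfrac{x+iy}{\sqrt\alpha}\Bigr)\qquad(x,y\in\mathbb R^n),$$ and let $\mathcal H_m=U(\mathcal F_{\alpha,m})\subset L^2(\mathbb R^{2n},\widetilde\mu_{2n})$.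 For $a\in\mathbb R^n$ define the horizontal Weyl operators $(\rho_{\mathcal F_{\alpha,m}}(a)f)(z)=f(z-a)e^{\alpha\langle z,a\rangle-\frac\alpha2|a|^2}$ on $\mathcal F_{\alpha,m}$ and the horizontal translations $(\rho_{\mathcal H_m}(a)g)(x,y)=g(x-a,y)$ on $\mathcal H_m$. For a family $\rho$ of bounded operators on a Hilbert space, $\mathcal C(\rho)$ denotes its commutant, the set of all bounded operators that commute with every $\rho(a)$. Let $d$ be the number of multi-indices $k\in\mathbb N_0^n$ with $|k|\le m-1$, and let $\phi(1),\dots,\phi(d)$ be these multi-indices in the lexicographic order. Let $\psi_j(t)=(2^j j!\sqrt\pi)^{-1/2}e^{-t^2/2}H_j(t)$ be the Hermite functions ($H_j$ the physicist's Hermite polynomials) and $$q_{k,\xi}(v)=2^{n/2}\pi^{n/4}\prod_{r=1}^n\psi_{k_r}\Bigl(\frac{\xi_r+2v_r}{\sqrt2}\Bigr).$$ Let $F\otimes I$ be the Fourier--Plancherel transform on $L^2(\mathbb R^{2n},\widetilde\mu_{2n})$ in the first variable $x\in\mathbb R^n$, with the kernel $(2\pi)^{-n/2}e^{-i\langle x,\xi\rangle}$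 with respect to $\mu_n$. Define $R_{\mathcal H_m}\colon\mathcal H_m\to L^2(\mathbb R^n,\widetilde\mu_n)^d$ by $$(R_{\mathcal H_m}g)(\xi)_j=\int_{\mathbb R^n}\bigl((F\otimes I)g\bigr)(\xi,v)\,\overline{q_{\phi(j),\xi}(v)}\,d\widetilde\mu_n(v)\qquad(1\le j\le d),$$ and $R_{\mathcal F_{\alpha,m}}=R_{\mathcal H_m}U$. For $\sigma\in L^\infty(\mathbb R^n)^{d\times d}$ (with the pointwise operations, the pointwise adjoint, and the essential supremum of the operator norm) let $(M_\sigma f)(\xi)=\sigma(\xi)f(\xi)$ on $L^2(\mathbb R^n,\widetilde\mu_n)^d$. Then $d=\binom{n+m-1}{n}$; the spaces $\mathcal H_m$ and $\mathcal F_{\alpha,m}$ are Hilbert spaces; $\mathcal C(\rho_{\mathcal H_m})$ and $\mathcal C(\rho_{\mathcal F_{\alpha,m}})$ are von Neumann algebras; and the maps $$\Lambda_{\mathcal H_m}(\sigma)=R_{\mathcal H_m}^*M_\sigma R_{\mathcal H_m},\qquad \Lambda_{\mathcal F_{\alpha,m}}(\sigma)=R_{\mathcal F_{\alpha,m}}^*M_\sigma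 R_{\mathcal F_{\alpha,m}}$$ are well-defined isometric $*$-isomorphisms of $L^\infty(\mathbb R^n)^{d\times d}$ onto $\mathcal C(\rho_{\mathcal H_m})$ and onto $\mathcal C(\rho_{\mathcal F_{\alpha,m}})$, respectively. In particular, both von Neumann algebras are isometrically $*$-isomorphic to $L^\infty(\mathbb R^n)^{d\times d}$. -/

import Mathlib

open MeasureTheory
open scoped ENNReal NNReal Matrix.Norms.L2Operator

namespace PolyFock
noncomputable section

/-! ### Weighted composition operators between `L²` spaces -/

section WeightedComp
variable {X Y E : Type*} [MeasurableSpace X] [MeasurableSpace Y] {μ : Measure X} {ν : Measure Y}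
  [NormedAddCommGroup E] [NormedSpace ℂ E]

/-- Change of variables `∫ |w|² (F ∘ φ) dμ = ∫ F dν` for all measurable `F ≥ 0`. -/
structure IsWeightedChange (φ : X → Y) (w : X → ℂ) (μ : Measure X) (ν : Measure Y) : Prop where
  measurable_map : Measurable φ
  measurable_weight : Measurable w
  lintegral_eq : ∀ F : Y → ℝ≥0∞, Measurable F →
    ∫⁻ x, ‖w x‖ₑ ^ 2 * F (φ x) ∂μ = ∫⁻ y, F y ∂ν

variable {φ : X → Y} {w : X → ℂ}

theorem IsWeightedChange.ae_smul_eq (h : IsWeightedChange φ w μ ν) {f g : Y → E}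
    (hfg : f =ᵐ[ν] g) : (fun x => w x • f (φ x)) =ᵐ[μ] fun x => w x • g (φ x) := by
  obtain ⟨s, hs, hsm, hs0⟩ := exists_measurable_superset_of_null (ae_iff.1 hfg)
  have h1 := h.lintegral_eq (s.indicator 1) (measurable_one.indicator hsm)
  rw [lintegral_indicator_one hsm, hs0] at h1
  replace h1 := (lintegral_eq_zero_iff ((h.measurable_weight.enorm.pow_const 2).mul
    ((measurable_one.indicator hsm).comp h.measurable_map))).1 h1
  filter_upwards [h1] with x hx
  by_cases hw : w x = 0
  · simp [hw]
  · have : φ x ∉ s := by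
      intro hmem
      simp [hmem, hw] at hx
    have : f (φ x) = g (φ x) := by
      by_contra hne
      exact this (hs hne)
    rw [this]

theorem IsWeightedChange.eLpNorm_eq (h : IsWeightedChange φ w μ ν) {f : Y → E}
    (hf : AEStronglyMeasurable f ν) :
    eLpNorm (fun x => w x • f (φ x)) 2 μ = eLpNorm f 2 ν := by
  rw [eLpNorm_congr_ae (h.ae_smul_eq hf.ae_eq_mk), eLpNorm_congr_ae hf.ae_eq_mk]
  simp only [eLpNorm_eq_lintegral_rpow_enorm_toReal (two_ne_zero) (ENNReal.ofNat_ne_top)]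
  congr 1
  simp only [ENNReal.toReal_ofNat, ENNReal.rpow_ofNat, enorm_smul, mul_pow]
  exact h.lintegral_eq _ (hf.stronglyMeasurable_mk.enorm.pow_const 2)

theorem IsWeightedChange.memLp (h : IsWeightedChange φ w μ ν) {f : Y → E}
    (hf : MemLp f 2 ν) : MemLp (fun x => w x • f (φ x)) 2 μ := by
  refine ⟨?_, ?_⟩
  · refine AEStronglyMeasurable.congr ?_ (h.ae_smul_eq hf.1.ae_eq_mk).symm
    exact (h.measurable_weight.stronglyMeasurable.smul
      (hf.1.stronglyMeasurable_mk.comp_measurable h.measurable_map)).aestronglyMeasurable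
  · rw [h.eLpNorm_eq hf.1]; exact hf.2

/-- The isometry `f ↦ w · (f ∘ φ)` from `L²(ν)` to `L²(μ)`. -/
def weightedComp (h : IsWeightedChange φ w μ ν) : Lp E 2 ν →ₗᵢ[ℂ] Lp E 2 μ where
  toFun f := (h.memLp (Lp.memLp f)).toLp (fun x => w x • f (φ x))
  map_add' f g := by
    rw [← MemLp.toLp_add]
    refine MemLp.toLp_congr _ _ ((h.ae_smul_eq (Lp.coeFn_add f g)).trans ?_)
    exact .of_forall fun x => by simp
  map_smul' c f := by
    rw [RingHom.id_apply, ← MemLp.toLp_const_smul]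
    refine MemLp.toLp_congr _ _ ((h.ae_smul_eq (Lp.coeFn_smul c f)).trans ?_)
    exact .of_forall fun x => by simp only [Pi.smul_apply]; rw [smul_comm]
  norm_map' f := by
    change ‖(h.memLp (Lp.memLp f)).toLp _‖ = ‖f‖
    rw [Lp.norm_toLp, h.eLpNorm_eq (Lp.aestronglyMeasurable f), Lp.norm_def]

theorem coeFn_weightedComp (h : IsWeightedChange φ w μ ν) (f : Lp E 2 ν) :
    weightedComp h f =ᵐ[μ] fun x => w x • f (φ x) :=
  MemLp.coeFn_toLp (h.memLp (Lp.memLp f))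

end WeightedComp

/-! ### Slicing: the identification `L²(X × Y) = L²(X; L²(Y))` -/

section Slice
variable {X Y : Type*} [MeasurableSpace X] [MeasurableSpace Y] {μ : Measure X} {ν : Measure Y}

open Classical in
/-- The class in `L²(ν)` of a function; zero if the function is not square integrable. -/
def classL2 (ν : Measure Y) (f : Y → ℂ) : Lp ℂ 2 ν := if h : MemLp f 2 ν then h.toLp f else 0

theorem classL2_of_memLp {f : Y → ℂ} (h : MemLp f 2 ν) : classL2 ν f = h.toLp f := dif_pos h

theorem classL2_congr {f g : Y → ℂ} (h : f =ᵐ[ν] g) : classL2 ν f = classL2 ν g := by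
  by_cases hf : MemLp f 2 ν
  · rw [classL2_of_memLp hf, classL2_of_memLp (hf.ae_eq h)]
    exact MemLp.toLp_congr _ _ h
  · have hg : ¬ MemLp g 2 ν := fun hg => hf (hg.ae_eq h.symm)
    rw [classL2, classL2, dif_neg hf, dif_neg hg]

variable [SigmaFinite μ] [SigmaFinite ν]

theorem memLp_slice {f : X × Y → ℂ} (hf : MemLp f 2 (μ.prod ν)) :
    ∀ᵐ x ∂μ, MemLp (fun y => f (x, y)) 2 ν := by
  have h1 := hf.1.prodMk_left
  have h2 : Integrable (fun p => ‖f p‖ ^ 2) (μ.prod ν) := hf.norm.integrable_sq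
  filter_upwards [h1, h2.prod_right_ae] with x hx hx2
  exact (memLp_two_iff_integrable_sq_norm hx).2 hx2

theorem stronglyMeasurable_slice [MeasurableSpace.CountablyGenerated Y] {f : X × Y → ℂ}
    (hf : StronglyMeasurable f) :
    StronglyMeasurable fun x => classL2 ν fun y => f (x, y) := by
  have : Fact ((2 : ℝ≥0∞) ≠ ∞) := ⟨ENNReal.ofNat_ne_top⟩
  have : SecondCountableTopology (Lp ℂ 2 ν) := inferInstance
  let _ : MeasurableSpace (Lp ℂ 2 ν) := borel _
  have : BorelSpace (Lp ℂ 2 ν) := ⟨rfl⟩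
  have hslice : ∀ x, AEStronglyMeasurable (fun y => f (x, y)) ν := fun x =>
    (hf.comp_measurable measurable_prodMk_left).aestronglyMeasurable
  have key : ∀ g : Y → ℂ, StronglyMeasurable g →
      Measurable fun x => eLpNorm (fun y => f (x, y) - g y) 2 ν := by
    intro g hg
    simp only [eLpNorm_eq_lintegral_rpow_enorm_toReal (two_ne_zero) (ENNReal.ofNat_ne_top)]
    refine Measurable.pow_const ?_ _
    refine Measurable.lintegral_prod_right' (f := fun p : X × Y =>
      ‖f p - g p.2‖ₑ ^ ((2 : ℝ≥0∞).toReal)) ?_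
    exact (hf.sub (hg.comp_measurable measurable_snd)).enorm.pow_const _
  have hD : MeasurableSet {x | MemLp (fun y => f (x, y)) 2 ν} := by
    have h0 := key 0 stronglyMeasurable_zero
    simp only [Pi.zero_apply, sub_zero] at h0
    have : {x | MemLp (fun y => f (x, y)) 2 ν} = {x | eLpNorm (fun y => f (x, y)) 2 ν < ∞} := by
      ext x; exact ⟨fun h => h.2, fun h => ⟨hslice x, h⟩⟩
    rw [this]
    exact measurableSet_lt h0 measurable_const
  have hball : ∀ (g : Lp ℂ 2 ν) (r : ℝ≥0∞),
      MeasurableSet ((fun x => classL2 ν fun y => f (x, y)) ⁻¹' Metric.eball g r) := by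
    intro g r
    have : (fun x => classL2 ν fun y => f (x, y)) ⁻¹' Metric.eball g r =
        ({x | MemLp (fun y => f (x, y)) 2 ν} ∩
          {x | eLpNorm (fun y => f (x, y) - g y) 2 ν < r}) ∪
        ({x | MemLp (fun y => f (x, y)) 2 ν}ᶜ ∩ {x | edist 0 g < r}) := by
      ext x
      by_cases hx : MemLp (fun y => f (x, y)) 2 ν
      · simp only [Set.mem_preimage, Metric.mem_eball, classL2_of_memLp hx, Set.mem_union,
          Set.mem_inter_iff, Set.mem_ofPred_eq, hx, true_and, Set.mem_compl_iff, not_true, false_and,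
          or_false]
        rw [Lp.edist_def, eLpNorm_congr_ae (hx.coeFn_toLp.sub (Filter.EventuallyEq.refl _ g))]
        rfl
      · simp [classL2, hx]
    rw [this]
    exact (hD.inter (measurableSet_lt (key g (Lp.stronglyMeasurable g)) measurable_const)).union
      (hD.compl.inter (.const _))
  refine Measurable.stronglyMeasurable (measurable_of_isOpen fun s hs => ?_)
  choose r hr hrs using fun g : s => EMetric.isOpen_iff.1 hs g g.2
  obtain ⟨T, hT, hTs⟩ := TopologicalSpace.isOpen_iUnion_countable
    (fun g : s => Metric.eball (g : Lp ℂ 2 ν) (r g)) fun g => Metric.isOpen_eball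
  have hs' : s = ⋃ g ∈ T, Metric.eball (g : Lp ℂ 2 ν) (r g) := by
    rw [hTs]
    refine Set.Subset.antisymm (fun g hg => Set.mem_iUnion.2 ⟨⟨g, hg⟩, ?_⟩)
      (Set.iUnion_subset hrs)
    exact Metric.mem_eball_self (hr ⟨g, hg⟩)
  rw [hs', Set.preimage_iUnion₂]
  exact MeasurableSet.biUnion hT fun g _ => hball _ _

theorem eLpNorm_slice {f : X × Y → ℂ} (hf : MemLp f 2 (μ.prod ν)) :
    eLpNorm (fun x => classL2 ν fun y => f (x, y)) 2 μ = eLpNorm f 2 (μ.prod ν) := by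
  simp only [eLpNorm_eq_lintegral_rpow_enorm_toReal (two_ne_zero) (ENNReal.ofNat_ne_top)]
  congr 1
  rw [lintegral_prod _ (hf.1.enorm.pow_const _)]
  refine lintegral_congr_ae ?_
  filter_upwards [memLp_slice hf] with x hx
  rw [classL2_of_memLp hx, Lp.enorm_def, eLpNorm_congr_ae hx.coeFn_toLp,
    eLpNorm_eq_lintegral_rpow_enorm_toReal (two_ne_zero) (ENNReal.ofNat_ne_top),
    ← ENNReal.rpow_mul]
  simp

variable [MeasurableSpace.CountablyGenerated Y]

theorem memLp_classL2_slice (f : Lp ℂ 2 (μ.prod ν)) :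
    MemLp (fun x => classL2 ν fun y => f (x, y)) 2 μ := by
  refine ⟨(stronglyMeasurable_slice (Lp.stronglyMeasurable f)).aestronglyMeasurable, ?_⟩
  rw [eLpNorm_slice (Lp.memLp f)]
  exact Lp.eLpNorm_lt_top f

/-- Slicing `f ↦ (x ↦ f(x, ·))`, the isometry `L²(X × Y) → L²(X; L²(Y))`. -/
def slice (μ : Measure X) (ν : Measure Y) [SigmaFinite μ] [SigmaFinite ν] :
    Lp ℂ 2 (μ.prod ν) →ₗᵢ[ℂ] Lp (Lp ℂ 2 ν) 2 μ where
  toFun f := (memLp_classL2_slice f).toLp _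
  map_add' f g := by
    rw [← MemLp.toLp_add]
    refine MemLp.toLp_congr _ _ ?_
    filter_upwards [Measure.ae_ae_of_ae_prod (Lp.coeFn_add f g), memLp_slice (Lp.memLp f),
      memLp_slice (Lp.memLp g)] with x hx hf hg
    rw [classL2_congr hx, Pi.add_apply, classL2_of_memLp hf, classL2_of_memLp hg,
      ← MemLp.toLp_add, classL2_of_memLp (f := fun y => (⇑f + ⇑g) (x, y)) (hf.add hg)]
    rfl
  map_smul' c f := by
    rw [RingHom.id_apply, ← MemLp.toLp_const_smul]
    refine MemLp.toLp_congr _ _ ?_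
    filter_upwards [Measure.ae_ae_of_ae_prod (Lp.coeFn_smul c f), memLp_slice (Lp.memLp f)]
      with x hx hf
    rw [classL2_congr hx, Pi.smul_apply, classL2_of_memLp hf, ← MemLp.toLp_const_smul,
      classL2_of_memLp (f := fun y => (c • ⇑f) (x, y)) (hf.const_smul c)]
    rfl
  norm_map' f := by
    change ‖(memLp_classL2_slice f).toLp _‖ = ‖f‖
    rw [Lp.norm_toLp, eLpNorm_slice (Lp.memLp f), Lp.norm_def]

end Slice

/-! ### Polyanalytic functions -/

/-- `ℝⁿ`. -/
abbrev RealSpace (n : ℕ) := EuclideanSpace ℝ (Fin n)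

/-- `ℂⁿ`. -/
abbrev ComplexSpace (n : ℕ) := EuclideanSpace ℂ (Fin n)

/-- The point `x + i y` of `ℂⁿ`. -/
def complexPoint {n : ℕ} (x y : RealSpace n) : ComplexSpace n :=
  WithLp.toLp 2 fun r => (x r : ℂ) + Complex.I * (y r : ℂ)

/-- The Wirtinger derivative `∂/∂z̄_r = (∂/∂x_r + i ∂/∂y_r)/2`. -/
def dbar {n : ℕ} (r : Fin n) (f : ComplexSpace n → ℂ) : ComplexSpace n → ℂ := fun z =>
  (1 / 2 : ℂ) * (fderiv ℝ f z (EuclideanSpace.single r 1) +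
    Complex.I * fderiv ℝ f z (EuclideanSpace.single r Complex.I))

/-- `D̄ᵏ = (∂/∂z̄_1)^{k_1} ⋯ (∂/∂z̄_n)^{k_n}`. -/
def dbarPow {n : ℕ} (k : Fin n → ℕ) (f : ComplexSpace n → ℂ) : ComplexSpace n → ℂ :=
  (List.finRange n).foldr (fun r g => (dbar r)^[k r] g) f

/-- A smooth function on `ℂⁿ` is (homogeneously) `m`-analytic if `D̄ᵏ f = 0` whenever `|k| = m`. -/
def IsPolyanalytic {n : ℕ} (m : ℕ) (f : ComplexSpace n → ℂ) : Prop :=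
  ContDiff ℝ (⊤ : ℕ∞) f ∧ ∀ k : Fin n → ℕ, ∑ r, k r = m → dbarPow k f = 0

theorem contDiff_dbar {n : ℕ} (r : Fin n) {f : ComplexSpace n → ℂ}
    (hf : ContDiff ℝ (⊤ : ℕ∞) f) : ContDiff ℝ (⊤ : ℕ∞) (dbar r f) := by
  have h : ContDiff ℝ (⊤ : ℕ∞) (fderiv ℝ f) := hf.fderiv_right (by simp)
  exact contDiff_const.mul ((h.clm_apply contDiff_const).add
    (contDiff_const.mul (h.clm_apply contDiff_const)))

/-- If a map commutes with every `∂/∂z̄_r` on smooth functions, it commutes with `D̄ᵏ`. -/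
theorem dbarPow_comm {n : ℕ} (L : (ComplexSpace n → ℂ) → ComplexSpace n → ℂ)
    (hL : ∀ r f, ContDiff ℝ (⊤ : ℕ∞) f → dbar r (L f) = L (dbar r f)) (k : Fin n → ℕ)
    {f : ComplexSpace n → ℂ} (hf : ContDiff ℝ (⊤ : ℕ∞) f) :
    dbarPow k (L f) = L (dbarPow k f) := by
  have iter : ∀ (r : Fin n) (j : ℕ) (g : ComplexSpace n → ℂ), ContDiff ℝ (⊤ : ℕ∞) g →
      (dbar r)^[j] (L g) = L ((dbar r)^[j] g) ∧ ContDiff ℝ (⊤ : ℕ∞) ((dbar r)^[j] g) := by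
    intro r j
    induction j with
    | zero => intro g hg; exact ⟨rfl, hg⟩
    | succ j ih =>
      intro g hg
      simp only [Function.iterate_succ, Function.comp_apply]
      rw [hL r g hg]
      exact ih _ (contDiff_dbar r hg)
  have main : ∀ l : List (Fin n),
      l.foldr (fun r g => (dbar r)^[k r] g) (L f) =
        L (l.foldr (fun r g => (dbar r)^[k r] g) f) ∧
      ContDiff ℝ (⊤ : ℕ∞) (l.foldr (fun r g => (dbar r)^[k r] g) f) := by
    intro l
    induction l with
    | nil => exact ⟨rfl, hf⟩
    | cons r l ih =>
      simp only [List.foldr_cons]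
      rw [ih.1]
      exact iter r (k r) _ ih.2
  exact (main _).1

theorem dbarPow_add {n : ℕ} (k : Fin n → ℕ) {f g : ComplexSpace n → ℂ}
    (hf : ContDiff ℝ (⊤ : ℕ∞) f) (hg : ContDiff ℝ (⊤ : ℕ∞) g) :
    dbarPow k (f + g) = dbarPow k f + dbarPow k g := by
  have one : ∀ r (f g : ComplexSpace n → ℂ), ContDiff ℝ (⊤ : ℕ∞) f → ContDiff ℝ (⊤ : ℕ∞) g →
      dbar r (f + g) = dbar r f + dbar r g := by
    intro r f g hf hg
    funext z
    simp only [dbar, Pi.add_apply]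
    rw [fderiv_add (hf.differentiable (by simp) z) (hg.differentiable (by simp) z)]
    simp only [add_apply]
    ring
  have iter : ∀ (r : Fin n) (j : ℕ) (f g : ComplexSpace n → ℂ), ContDiff ℝ (⊤ : ℕ∞) f →
      ContDiff ℝ (⊤ : ℕ∞) g → (dbar r)^[j] (f + g) = (dbar r)^[j] f + (dbar r)^[j] g ∧
        ContDiff ℝ (⊤ : ℕ∞) ((dbar r)^[j] f) ∧ ContDiff ℝ (⊤ : ℕ∞) ((dbar r)^[j] g) := by
    intro r j
    induction j with
    | zero => intro f g hf hg; exact ⟨rfl, hf, hg⟩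
    | succ j ih =>
      intro f g hf hg
      simp only [Function.iterate_succ, Function.comp_apply]
      rw [one r f g hf hg]
      exact ih _ _ (contDiff_dbar r hf) (contDiff_dbar r hg)
  have main : ∀ l : List (Fin n),
      l.foldr (fun r g => (dbar r)^[k r] g) (f + g) =
        l.foldr (fun r g => (dbar r)^[k r] g) f + l.foldr (fun r g => (dbar r)^[k r] g) g ∧
      ContDiff ℝ (⊤ : ℕ∞) (l.foldr (fun r g => (dbar r)^[k r] g) f) ∧
      ContDiff ℝ (⊤ : ℕ∞) (l.foldr (fun r g => (dbar r)^[k r] g) g) := by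
    intro l
    induction l with
    | nil => exact ⟨rfl, hf, hg⟩
    | cons r l ih =>
      simp only [List.foldr_cons]
      rw [ih.1]
      exact iter r (k r) _ _ ih.2.1 ih.2.2
  exact (main _).1

theorem IsPolyanalytic.add {n m : ℕ} {f g : ComplexSpace n → ℂ} (hf : IsPolyanalytic m f)
    (hg : IsPolyanalytic m g) : IsPolyanalytic m (f + g) :=
  ⟨hf.1.add hg.1, fun k hk => by rw [dbarPow_add k hf.1 hg.1, hf.2 k hk, hg.2 k hk, add_zero]⟩

/-- `m`-analyticity is preserved by a translation followed by multiplication with an entire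
function. -/
theorem IsPolyanalytic.mul_comp_sub {n m : ℕ} {f : ComplexSpace n → ℂ} (hf : IsPolyanalytic m f)
    {h : ComplexSpace n → ℂ} (hh : ContDiff ℂ (⊤ : ℕ∞) h) (a : ComplexSpace n) :
    IsPolyanalytic m fun z => h z * f (z - a) := by
  have hhR : ContDiff ℝ (⊤ : ℕ∞) h := hh.restrict_scalars ℝ
  refine ⟨hhR.mul (hf.1.comp (contDiff_id.sub contDiff_const)), fun k hk => ?_⟩
  rw [dbarPow_comm (fun g z => h z * g (z - a)) ?_ k hf.1, hf.2 k hk]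
  · funext z; simp
  · intro r g hg
    funext z
    have h1 : HasFDerivAt h ((fderiv ℂ h z).restrictScalars ℝ) z :=
      (hh.differentiable (by simp) z).hasFDerivAt.restrictScalars ℝ
    have h2 : HasFDerivAt (fun z => g (z - a)) (fderiv ℝ g (z - a)) z :=
      (hg.differentiable (by simp) (z - a)).hasFDerivAt.comp z ((hasFDerivAt_id z).sub_const a)
    have h3 : (EuclideanSpace.single r Complex.I : ComplexSpace n) =
        Complex.I • EuclideanSpace.single r 1 := by
      ext i; simp
    simp only [dbar]
    have h4 : HasFDerivAt (fun z => h z * g (z - a)) _ z := h1.mul h2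
    rw [h4.fderiv]
    simp only [add_apply, smul_apply,
      ContinuousLinearMap.coe_restrictScalars', smul_eq_mul]
    have h5 : fderiv ℂ h z (EuclideanSpace.single r Complex.I) =
        Complex.I * fderiv ℂ h z (EuclideanSpace.single r 1) := by
      rw [h3, map_smul, smul_eq_mul]
    rw [h5]
    linear_combination (1 / 2 * g (z - a) * fderiv ℂ h z (EuclideanSpace.single r 1)) *
      Complex.I_mul_I

theorem IsPolyanalytic.const_smul {n m : ℕ} {f : ComplexSpace n → ℂ} (hf : IsPolyanalytic m f)
    (c : ℂ) : IsPolyanalytic m (c • f) := by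
  have := hf.mul_comp_sub (h := fun _ => c) contDiff_const 0
  simpa [Pi.smul_def] using this

theorem isPolyanalytic_zero {n m : ℕ} : IsPolyanalytic m (0 : ComplexSpace n → ℂ) := by
  have h : ContDiff ℝ (⊤ : ℕ∞) (0 : ComplexSpace n → ℂ) := contDiff_const
  refine ⟨h, fun k _ => ?_⟩
  rw [dbarPow_comm (f := 0) (fun _ => 0) _ k h]
  intro r f _
  funext z
  simp [dbar]

/-! ### The polyanalytic Fock space and its flattened version -/

/-- The measure `μ̃_n = (2π)^{-n/2} μ_n` on `ℝⁿ`. On `ℝ²ⁿ = ℝⁿ × ℝⁿ` the measure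
`μ̃_{2n} = (2π)^{-n} μ_{2n}` is the product of two copies of it. -/
def lebesgueT (n : ℕ) : Measure (RealSpace n) :=
  Real.toNNReal ((2 * Real.pi) ^ (-(n : ℝ) / 2)) • volume

instance (n : ℕ) : SigmaFinite (lebesgueT n) := by unfold lebesgueT; infer_instance

instance (n : ℕ) : (lebesgueT n).IsAddRightInvariant := by unfold lebesgueT; infer_instance

/-- The Gaussian measure `(α^n/π^n) e^{-α|z|²} dμ_{2n}(z)` on `ℂⁿ`. -/
def gaussian (n : ℕ) (α : ℝ) : Measure (ComplexSpace n) :=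
  volume.withDensity fun z => ENNReal.ofReal (α ^ n / Real.pi ^ n * Real.exp (-α * ‖z‖ ^ 2))

theorem lintegral_gaussian (n : ℕ) (α : ℝ) (F : ComplexSpace n → ℝ≥0∞) (hF : Measurable F) :
    ∫⁻ z, F z ∂gaussian n α =
      ∫⁻ z, ENNReal.ofReal (α ^ n / Real.pi ^ n * Real.exp (-α * ‖z‖ ^ 2)) * F z := by
  rw [gaussian, lintegral_withDensity_eq_lintegral_mul _ (by fun_prop) hF]
  rfl

/-- The `m`-analytic Bargmann–Segal–Fock space: the elements of `L²` of the Gaussian measure that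
are (represented by) `m`-analytic functions. -/
def fock (n m : ℕ) (α : ℝ) : Submodule ℂ (Lp ℂ 2 (gaussian n α)) where
  carrier := {f | ∃ g : ComplexSpace n → ℂ, IsPolyanalytic m g ∧ f =ᵐ[gaussian n α] g}
  zero_mem' := ⟨0, isPolyanalytic_zero, Lp.coeFn_zero _ _ _⟩
  add_mem' := by
    rintro f₁ f₂ ⟨g₁, hg₁, h₁⟩ ⟨g₂, hg₂, h₂⟩
    exact ⟨g₁ + g₂, hg₁.add hg₂, (Lp.coeFn_add f₁ f₂).trans (h₁.add h₂)⟩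
  smul_mem' := by
    rintro c f ⟨g, hg, h⟩
    exact ⟨c • g, hg.const_smul c, (Lp.coeFn_smul c f).trans (h.const_smul c)⟩

/-- The factor `e^{α⟨z,a⟩ - α|a|²/2}`; Mathlib's `inner ℂ a z` is `⟨z,a⟩ = ∑ z_r conj(a_r)`. -/
def weylWeight {n : ℕ} (α : ℝ) (a z : ComplexSpace n) : ℂ :=
  Complex.exp (α * inner ℂ a z - α / 2 * (‖a‖ : ℂ) ^ 2)

theorem isWeightedChange_weyl {n : ℕ} (α : ℝ) (a : ComplexSpace n) :
    IsWeightedChange (fun z => z - a) (weylWeight α a) (gaussian n α) (gaussian n α) where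
  measurable_map := by fun_prop
  measurable_weight := by unfold weylWeight; fun_prop
  lintegral_eq F hF := by
    rw [lintegral_gaussian n α F hF, lintegral_gaussian n α _
      (by unfold weylWeight; fun_prop),
      ← lintegral_sub_right_eq_self (fun z => ENNReal.ofReal _ * F z) a]
    refine lintegral_congr fun z => ?_
    rw [← mul_assoc]
    congr 1
    have hn : ‖weylWeight α a z‖ₑ ^ 2 =
        ENNReal.ofReal (Real.exp (2 * (α * RCLike.re (inner ℂ a z) - α / 2 * ‖a‖ ^ 2))) := by
      rw [← ofReal_norm, ← ENNReal.ofReal_pow (norm_nonneg _), weylWeight,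
        Complex.norm_exp, ← Real.exp_nat_mul]
      congr 3
      simp [← Complex.ofReal_pow]
    rw [hn, mul_comm, ← ENNReal.ofReal_mul (Real.exp_pos _).le, mul_left_comm, ← Real.exp_add]
    congr 3
    rw [@norm_sub_sq ℂ, inner_re_symm]
    ring

/-- The Weyl operator `(W_a f)(z) = f(z - a) e^{α⟨z,a⟩ - α|a|²/2}` on `L²` of the Gaussian
measure. -/
def weyl {n : ℕ} (α : ℝ) (a : ComplexSpace n) :
    Lp ℂ 2 (gaussian n α) →ₗᵢ[ℂ] Lp ℂ 2 (gaussian n α) :=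
  weightedComp (isWeightedChange_weyl α a)

theorem weyl_mem_fock {n m : ℕ} {α : ℝ} (a : ComplexSpace n) (f : Lp ℂ 2 (gaussian n α))
    (hf : f ∈ fock n m α) : weyl α a f ∈ fock n m α := by
  obtain ⟨g, hg, h⟩ := hf
  refine ⟨fun z => weylWeight α a z * g (z - a), hg.mul_comp_sub ?_ a, ?_⟩
  · unfold weylWeight
    exact ((contDiff_const.mul ((innerSL ℂ a).contDiff)).sub contDiff_const).cexp
  · exact (coeFn_weightedComp _ f).trans ((isWeightedChange_weyl α a).ae_smul_eq h)

/-- The horizontal Weyl operator on the `m`-analytic Fock space, for `a ∈ ℝⁿ ⊂ ℂⁿ`. -/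
def rhoF (n m : ℕ) (α : ℝ) (a : RealSpace n) : fock n m α →L[ℂ] fock n m α :=
  (weyl α (complexPoint a 0)).toContinuousLinearMap.restrict fun f hf => weyl_mem_fock _ f hf

/-- The factor `2^{n/2} e^{-|x|²/2 - |y|²/2 - i⟨x,y⟩}`. -/
def flatWeight {n : ℕ} (p : RealSpace n × RealSpace n) : ℂ :=
  ((2 : ℝ) ^ ((n : ℝ) / 2) : ℝ) * Complex.exp (-(1 / 2) * (‖p.1‖ : ℂ) ^ 2 - 1 / 2 * (‖p.2‖ : ℂ) ^ 2
    - Complex.I * (inner ℝ p.1 p.2 : ℝ))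

/-- The point `(x + i y)/√α`. -/
def flatPoint {n : ℕ} (α : ℝ) (p : RealSpace n × RealSpace n) : ComplexSpace n :=
  (√α)⁻¹ • complexPoint p.1 p.2

/-- `(x, y) ↦ x + i y` as a linear isometry. -/
def complexPointₗᵢ (n : ℕ) : WithLp 2 (RealSpace n × RealSpace n) ≃ₗᵢ[ℝ] ComplexSpace n where
  toFun p := complexPoint p.fst p.snd
  invFun z := WithLp.toLp 2 (WithLp.toLp 2 fun r => (z r).re, WithLp.toLp 2 fun r => (z r).im)
  left_inv p := by
    apply WithLp.ofLp_injective
    ext r <;> simp [complexPoint]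
  right_inv z := by
    ext r
    simp [complexPoint, mul_comm Complex.I, Complex.re_add_im]
  map_add' p q := by ext r; simp [complexPoint]; ring
  map_smul' c p := by ext r; simp [complexPoint]; ring
  norm_map' p := by
    rw [← sq_eq_sq₀ (norm_nonneg _) (norm_nonneg _), WithLp.prod_norm_sq_eq_of_L2]
    simp only [EuclideanSpace.norm_sq_eq, ← Finset.sum_add_distrib]
    refine Finset.sum_congr rfl fun r _ => ?_
    rw [← Complex.normSq_eq_norm_sq, Complex.normSq_apply]
    simp [complexPoint, sq]

theorem measurePreserving_complexPoint (n : ℕ) :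
    MeasurePreserving (fun p : RealSpace n × RealSpace n => complexPoint p.1 p.2)
      volume volume :=
  (complexPointₗᵢ n).measurePreserving.comp (WithLp.volume_preserving_toLp _ _)

theorem norm_complexPoint_sq {n : ℕ} (x y : RealSpace n) :
    ‖complexPoint x y‖ ^ 2 = ‖x‖ ^ 2 + ‖y‖ ^ 2 := by
  have := (complexPointₗᵢ n).norm_map (WithLp.toLp 2 (x, y))
  change ‖complexPoint x y‖ = _ at this
  rw [this, WithLp.prod_norm_sq_eq_of_L2]
  rfl

theorem isWeightedChange_flat {n : ℕ} {α : ℝ} (hα : 0 < α) :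
    IsWeightedChange (flatPoint α) flatWeight ((lebesgueT n).prod (lebesgueT n))
      (gaussian n α) where
  measurable_map := by
    have := (measurePreserving_complexPoint n).measurable
    unfold flatPoint
    fun_prop
  measurable_weight := by unfold flatWeight; fun_prop
  lintegral_eq F hF := by
    have hw : ∀ p : RealSpace n × RealSpace n, ‖flatWeight p‖ₑ ^ 2 =
        ENNReal.ofReal (2 ^ n * Real.exp (-‖complexPoint p.1 p.2‖ ^ 2)) := by
      intro p
      have h2 : ((2 : ℝ) ^ ((n : ℝ) / 2)) ^ 2 = 2 ^ n := by
        rw [← Real.rpow_mul_natCast (by norm_num)]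
        simp
      rw [← ofReal_norm, ← ENNReal.ofReal_pow (norm_nonneg _), flatWeight, norm_mul,
        Complex.norm_real, Complex.norm_exp, mul_pow, ← Real.exp_nat_mul, Real.norm_eq_abs, sq_abs,
        h2, norm_complexPoint_sq]
      congr 3
      simp [← Complex.ofReal_pow]
      ring
    set G : ComplexSpace n → ℝ≥0∞ := fun z =>
      ENNReal.ofReal (2 ^ n * Real.exp (-‖z‖ ^ 2)) * F ((√α)⁻¹ • z) with hG
    have hGm : Measurable G := by fun_prop
    have hs : √α ≠ 0 := (Real.sqrt_pos.2 hα).ne'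
    have hfin : Module.finrank ℝ (ComplexSpace n) = 2 * n := by
      rw [← (complexPointₗᵢ n).toLinearEquiv.finrank_eq,
        (WithLp.linearEquiv 2 ℝ (RealSpace n × RealSpace n)).finrank_eq]
      simp [two_mul]
    have hscale : ∫⁻ z, G (√α • z) = ENNReal.ofReal ((α ^ n)⁻¹) * ∫⁻ z, G z := by
      have h := Measure.map_addHaar_smul (volume : Measure (ComplexSpace n)) hs
      rw [← lintegral_map (μ := volume) (f := G) (g := fun z : ComplexSpace n => √α • z) hGm
        (by fun_prop), h, lintegral_smul_measure, hfin, pow_mul, Real.sq_sqrt hα.le, abs_of_pos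
        (by positivity), smul_eq_mul]
    have hvol : ∫⁻ z, G z = ENNReal.ofReal (α ^ n) * ∫⁻ z, G (√α • z) := by
      rw [hscale, ← mul_assoc, ← ENNReal.ofReal_mul (by positivity),
        mul_inv_cancel₀ (by positivity), ENNReal.ofReal_one, one_mul]
    have hc : (0 : ℝ) ≤ (2 * Real.pi) ^ (-(n : ℝ) / 2) := by positivity
    have hcc : (2 * Real.pi) ^ (-(n : ℝ) / 2) * (2 * Real.pi) ^ (-(n : ℝ) / 2) =
        ((2 * Real.pi) ^ n)⁻¹ := by
      rw [← Real.rpow_add (by positivity), ← Real.rpow_natCast, ← Real.rpow_neg (by positivity)]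
      congr 1
      ring
    have hint : ∀ p : RealSpace n × RealSpace n,
        ‖flatWeight p‖ₑ ^ 2 * F (flatPoint α p) = G (complexPoint p.1 p.2) := fun p => by
      rw [hw, hG, flatPoint]
    simp only [hint]
    rw [lebesgueT, Measure.prod_smul_left, Measure.prod_smul_right]
    simp only [lintegral_smul_measure]
    rw [← Measure.volume_eq_prod, (measurePreserving_complexPoint n).lintegral_comp hGm, hvol,
      lintegral_gaussian n α F hF, ← lintegral_const_mul _ (by fun_prop)]
    simp only [ENNReal.smul_def, smul_eq_mul]
    rw [← mul_assoc, ← lintegral_const_mul _ (by fun_prop)]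
    refine lintegral_congr fun z => ?_
    rw [hG]
    simp only [smul_smul, inv_mul_cancel₀ hs, one_smul, ← mul_assoc]
    congr 1
    change ENNReal.ofReal _ * ENNReal.ofReal _ * _ * _ = _
    rw [← ENNReal.ofReal_mul hc, ← ENNReal.ofReal_mul (by positivity),
      ← ENNReal.ofReal_mul (by positivity), hcc, norm_smul, Real.norm_eq_abs,
      abs_of_pos (Real.sqrt_pos.2 hα), mul_pow √α, Real.sq_sqrt hα.le, mul_pow, neg_mul]
    congr 1
    field_simp

/-- The operator `(U f)(x, y) = 2^{n/2} e^{-|x|²/2 - |y|²/2 - i⟨x,y⟩} f((x + i y)/√α)`. -/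
def flatten (n : ℕ) {α : ℝ} (hα : 0 < α) :
    Lp ℂ 2 (gaussian n α) →ₗᵢ[ℂ] Lp ℂ 2 ((lebesgueT n).prod (lebesgueT n)) :=
  weightedComp (isWeightedChange_flat hα)

/-- The flattened space `H_m`, the image of the `m`-analytic Fock space under `U`. -/
def flatFock (n m : ℕ) {α : ℝ} (hα : 0 < α) :
    Submodule ℂ (Lp ℂ 2 ((lebesgueT n).prod (lebesgueT n))) :=
  (fock n m α).map (flatten n hα).toLinearMap

/-- `U` as an operator from the `m`-analytic Fock space to `H_m`. -/
def flattenFock (n m : ℕ) {α : ℝ} (hα : 0 < α) : fock n m α →L[ℂ] flatFock n m hα :=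
  (flatten n hα).toContinuousLinearMap.restrict fun _ hf => Submodule.mem_map_of_mem hf

theorem measurePreserving_horizontal {n : ℕ} (a : RealSpace n) :
    MeasurePreserving (fun p : RealSpace n × RealSpace n => (p.1 - a, p.2))
      ((lebesgueT n).prod (lebesgueT n)) ((lebesgueT n).prod (lebesgueT n)) :=
  (measurePreserving_sub_right (lebesgueT n) a).prod (MeasurePreserving.id _)

/-- The horizontal translation `(x, y) ↦ f(x - a, y)` on `L²(ℝ²ⁿ, μ̃_{2n})`. -/
def translation {n : ℕ} (a : RealSpace n) :
    Lp ℂ 2 ((lebesgueT n).prod (lebesgueT n)) →ₗᵢ[ℂ]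
      Lp ℂ 2 ((lebesgueT n).prod (lebesgueT n)) :=
  Lp.compMeasurePreservingₗᵢ ℂ _ (measurePreserving_horizontal a)

theorem translation_flatten {n : ℕ} {α : ℝ} (hα : 0 < α) (a : RealSpace n)
    (f : Lp ℂ 2 (gaussian n α)) :
    translation a (flatten n hα f) =
      flatten n hα (weyl α (complexPoint ((√α)⁻¹ • a) 0) f) := by
  have hs : √α ≠ 0 := (Real.sqrt_pos.2 hα).ne'
  have hsC : ((√α : ℝ) : ℂ) ≠ 0 := by exact_mod_cast hs
  have hα' : (α : ℂ) = ((√α : ℝ) : ℂ) ^ 2 := by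
    rw [← Complex.ofReal_pow, Real.sq_sqrt hα.le]
  refine Lp.ext ?_
  have h1 : translation a (flatten n hα f) =ᵐ[(lebesgueT n).prod (lebesgueT n)]
      fun p => flatWeight (p.1 - a, p.2) • f (flatPoint α (p.1 - a, p.2)) :=
    (Lp.coeFn_compMeasurePreserving _ (measurePreserving_horizontal a)).trans
      ((measurePreserving_horizontal a).quasiMeasurePreserving.ae_eq_comp
        (coeFn_weightedComp (isWeightedChange_flat hα) f))
  have h2 := (coeFn_weightedComp (isWeightedChange_flat hα)
    (weyl α (complexPoint ((√α)⁻¹ • a) 0) f)).trans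
      ((isWeightedChange_flat hα).ae_smul_eq (coeFn_weightedComp (isWeightedChange_weyl α _) f))
  refine h1.trans (Filter.EventuallyEq.trans (.of_forall fun p => ?_) h2.symm)
  have hp : flatPoint α (p.1 - a, p.2) = flatPoint α p - complexPoint ((√α)⁻¹ • a) 0 := by
    ext r
    simp [flatPoint, complexPoint]
    ring
  simp only [smul_smul]
  rw [hp]
  congr 1
  have hin : (inner ℂ (complexPoint ((√α)⁻¹ • a) 0) (flatPoint α p) : ℂ) =
      (α : ℂ)⁻¹ * ((inner ℝ a p.1 : ℝ) + Complex.I * (inner ℝ a p.2 : ℝ)) := by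
    simp only [PiLp.inner_apply, complexPoint, flatPoint]
    push_cast
    rw [Finset.mul_sum, ← Finset.sum_add_distrib, Finset.mul_sum]
    refine Finset.sum_congr rfl fun r _ => ?_
    simp
    rw [hα']
    field_simp
  have hna : ((‖complexPoint ((√α)⁻¹ • a) 0‖ : ℝ) : ℂ) ^ 2 = (α : ℂ)⁻¹ * (‖a‖ : ℂ) ^ 2 := by
    rw [← Complex.ofReal_pow, norm_complexPoint_sq, norm_smul]
    simp
    rw [mul_pow, inv_pow, abs_of_pos (Real.sqrt_pos.2 hα), ← Complex.ofReal_pow √α, Real.sq_sqrt hα.le]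
  have hαC : (α : ℂ) ≠ 0 := by exact_mod_cast hα.ne'
  rw [flatWeight, flatWeight, weylWeight, mul_assoc, ← Complex.exp_add, hin, hna]
  congr 2
  have hsq : ((‖p.1 - a‖ : ℝ) : ℂ) ^ 2 =
      (‖p.1‖ : ℂ) ^ 2 - 2 * (inner ℝ a p.1 : ℝ) + (‖a‖ : ℂ) ^ 2 := by
    rw [← Complex.ofReal_pow, norm_sub_sq_real, real_inner_comm]
    push_cast
    ring
  have hi : ((inner ℝ (p.1 - a) p.2 : ℝ) : ℂ) = (inner ℝ p.1 p.2 : ℝ) - (inner ℝ a p.2 : ℝ) := by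
    rw [inner_sub_left]; push_cast; ring
  simp only [hsq, hi]
  field_simp
  ring

theorem translation_mem_flatFock {n m : ℕ} {α : ℝ} (hα : 0 < α) (a : RealSpace n)
    (g : Lp ℂ 2 ((lebesgueT n).prod (lebesgueT n))) (hg : g ∈ flatFock n m hα) :
    translation a g ∈ flatFock n m hα := by
  obtain ⟨f, hf, rfl⟩ := hg
  exact ⟨_, weyl_mem_fock (complexPoint ((√α)⁻¹ • a) 0) f hf, (translation_flatten hα a f).symm⟩

/-- The horizontal translation on `H_m`. -/
def rhoH (n m : ℕ) {α : ℝ} (hα : 0 < α) (a : RealSpace n) :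
    flatFock n m hα →L[ℂ] flatFock n m hα :=
  (translation a).toContinuousLinearMap.restrict fun g hg => translation_mem_flatFock hα a g hg

/-! ### The horizontal Fourier transform and the operators `R` -/

theorem isWeightedChange_id (n : ℕ) :
    IsWeightedChange (fun x : RealSpace n => x)
      (fun _ => (((2 * Real.pi) ^ (-(n : ℝ) / 4) : ℝ) : ℂ)) volume (lebesgueT n) where
  measurable_map := measurable_id
  measurable_weight := measurable_const
  lintegral_eq F hF := by
    rw [lintegral_const_mul _ hF, lebesgueT, lintegral_smul_measure, ENNReal.smul_def, smul_eq_mul]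
    congr 1
    rw [← ofReal_norm, ← ENNReal.ofReal_pow (norm_nonneg _), Complex.norm_real, Real.norm_eq_abs,
      sq_abs, ← Real.rpow_mul_natCast (by positivity)]
    change _ = ENNReal.ofReal _
    congr 2
    push_cast
    ring

theorem isWeightedChange_dilation (n : ℕ) :
    IsWeightedChange (fun ξ : RealSpace n => (2 * Real.pi)⁻¹ • ξ)
      (fun _ => (((2 * Real.pi) ^ (-(n : ℝ) / 4) : ℝ) : ℂ)) (lebesgueT n) volume where
  measurable_map := by fun_prop
  measurable_weight := measurable_const
  lintegral_eq F hF := by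
    have h := Measure.map_addHaar_smul (volume : Measure (RealSpace n))
      (r := (2 * Real.pi)⁻¹) (by positivity)
    have h' := lintegral_map (μ := volume) (f := F)
      (g := fun z : RealSpace n => (2 * Real.pi)⁻¹ • z) hF (by fun_prop)
    rw [lintegral_const_mul _ (by fun_prop), lebesgueT, lintegral_smul_measure, ENNReal.smul_def,
      smul_eq_mul, ← h', h, lintegral_smul_measure, smul_eq_mul, ← mul_assoc, ← mul_assoc]
    convert one_mul _
    rw [← ofReal_norm, ← ENNReal.ofReal_pow (norm_nonneg _), Complex.norm_real, Real.norm_eq_abs,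
      sq_abs, ← Real.rpow_mul_natCast (by positivity)]
    change ENNReal.ofReal _ * ENNReal.ofReal _ * _ = _
    rw [← ENNReal.ofReal_mul (by positivity), ← ENNReal.ofReal_mul (by positivity),
      ← Real.rpow_add (by positivity), abs_of_pos (by positivity), finrank_euclideanSpace_fin,
      inv_pow, inv_inv, ← Real.rpow_natCast (2 * Real.pi) n, ← Real.rpow_add (by positivity)]
    convert ENNReal.ofReal_one
    convert Real.rpow_zero _
    push_cast
    ring

/-- The Fourier–Plancherel transform
`(F f)(ξ) = (2π)^{-n/2} ∫ f(x) e^{-i⟨x,ξ⟩} dx = (2π)^{-n/2} (𝓕 f)(ξ/(2π))`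
on `L²(ℝⁿ, μ̃_n; E)`, where `𝓕` is Mathlib's transform with the kernel `e^{-2πi⟨x,ξ⟩}`. The factor
`(2π)^{-n/2}` is split between the passages from `μ̃_n` to `μ_n` and back. With `E = L²(ℝⁿ, μ̃_n)`,
this is `F ⊗ I` on `L²(ℝⁿ, μ̃_n) ⊗ L²(ℝⁿ, μ̃_n)`. -/
def fourierT (n : ℕ) (E : Type*) [NormedAddCommGroup E] [InnerProductSpace ℂ E]
    [CompleteSpace E] : Lp E 2 (lebesgueT n) →ₗᵢ[ℂ] Lp E 2 (lebesgueT n) :=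
  (weightedComp (isWeightedChange_dilation n)).comp
    ((Lp.fourierTransformₗᵢ (RealSpace n) E).toLinearIsometry.comp
      (weightedComp (isWeightedChange_id n)))

/-- The Hermite function `ψ_k(t) = (2^k k! √π)^{-1/2} e^{-t²/2} H_k(t)`; the physicist's Hermite
polynomial `H_k(t) = 2^{k/2} He_k(√2 t)` is expressed through Mathlib's `hermite k = He_k`. -/
def hermiteFun (k : ℕ) (t : ℝ) : ℝ :=
  (2 ^ k * (k.factorial : ℝ) * √Real.pi) ^ (-(1 / 2) : ℝ) * Real.exp (-(1 / 2) * t ^ 2) *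
    (2 ^ ((k : ℝ) / 2) * Polynomial.aeval (√2 * t) (Polynomial.hermite k))

/-- `q_{k,ξ}(v) = 2^{n/2} π^{n/4} ∏_r ψ_{k_r}((ξ_r + 2 v_r)/√2)`. -/
def qFun {n : ℕ} (k : Fin n → ℕ) (ξ v : RealSpace n) : ℂ :=
  ((2 ^ ((n : ℝ) / 2) * Real.pi ^ ((n : ℝ) / 4) *
    ∏ r, hermiteFun (k r) ((ξ r + 2 * v r) / √2) : ℝ) : ℂ)

theorem continuous_hermiteFun (k : ℕ) : Continuous (hermiteFun k) := by
  unfold hermiteFun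
  have : Continuous fun t : ℝ => Polynomial.aeval (√2 * t) (Polynomial.hermite k) :=
    (Polynomial.continuous_aeval _).comp (by fun_prop)
  fun_prop

theorem integrable_hermiteFun_sq (k : ℕ) :
    Integrable fun t : ℝ => hermiteFun k (2 * t / √2) ^ 2 := by
  have key : ∀ p : Polynomial ℝ, Integrable fun t : ℝ => p.eval t * Real.exp (-2 * t ^ 2) := by
    intro p
    induction p using Polynomial.induction_on' with
    | add p q hp hq =>
      simp only [Polynomial.eval_add, add_mul]
      exact hp.add hq
    | monomial j c =>
      have h := (integrable_rpow_mul_exp_neg_mul_sq (b := 2) (by norm_num) (s := j)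
        (by have : (0 : ℝ) ≤ j := j.cast_nonneg; linarith)).const_mul c
      simpa [Polynomial.eval_monomial, mul_assoc] using h
  have h2 : √2 * √2 = (2 : ℝ) := Real.mul_self_sqrt (by norm_num)
  have h20 : √2 ≠ (0 : ℝ) := by positivity
  have h := (key ((((Polynomial.hermite k).map (Int.castRingHom ℝ)).comp
    (Polynomial.C 2 * Polynomial.X)) ^ 2)).const_mul
    (((2 ^ k * (k.factorial : ℝ) * √Real.pi) ^ (-(1 / 2) : ℝ) * 2 ^ ((k : ℝ) / 2)) ^ 2)
  refine h.congr (.of_forall fun t => ?_)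
  have e1 : √2 * (2 * t / √2) = 2 * t := by field_simp
  have e2 : (2 * t / √2) ^ 2 = 2 * t ^ 2 := by
    rw [div_pow, Real.sq_sqrt (by norm_num)]; ring
  have e3 : Real.exp (-2 * t ^ 2) = Real.exp (-(1 / 2) * (2 * t ^ 2)) ^ 2 := by
    rw [← Real.exp_nat_mul]; congr 1; push_cast; ring
  simp only [hermiteFun, e1, e2, e3, Polynomial.eval_pow, Polynomial.eval_comp,
    Polynomial.eval_mul, Polynomial.eval_C, Polynomial.eval_X, Polynomial.eval_map,
    Polynomial.aeval_def, algebraMap_int_eq]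
  ring

theorem qFun_eq {n : ℕ} (k : Fin n → ℕ) (ξ v : RealSpace n) :
    qFun k ξ v = qFun k 0 (v + (2 : ℝ)⁻¹ • ξ) := by
  unfold qFun
  congr 2
  refine Finset.prod_congr rfl fun r _ => ?_
  congr 1
  simp
  ring

theorem continuous_qFun {n : ℕ} (k : Fin n → ℕ) (ξ : RealSpace n) : Continuous (qFun k ξ) := by
  unfold qFun
  have := fun r => continuous_hermiteFun (k r)
  fun_prop

theorem memLp_qFun_zero {n : ℕ} (k : Fin n → ℕ) : MemLp (qFun k 0) 2 (lebesgueT n) := by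
  unfold lebesgueT
  refine MemLp.smul_measure ?_ (by simp)
  rw [memLp_two_iff_integrable_sq_norm (continuous_qFun k 0).aestronglyMeasurable]
  have h := (Integrable.fintype_prod (μ := fun _ : Fin n => (volume : Measure ℝ))
    (f := fun r t => hermiteFun (k r) (2 * t / √2) ^ 2)
    fun r => integrable_hermiteFun_sq (k r)).const_mul
      ((2 ^ ((n : ℝ) / 2) * Real.pi ^ ((n : ℝ) / 4)) ^ 2)
  have h' := (PiLp.volume_preserving_ofLp (Fin n)).integrable_comp_of_integrable h
  refine h'.congr (.of_forall fun v => ?_)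
  simp only [Function.comp_apply, qFun, Complex.norm_real, Real.norm_eq_abs, sq_abs, mul_pow,
    Finset.prod_pow, PiLp.zero_apply, zero_add]

theorem measurePreserving_half {n : ℕ} (ξ : RealSpace n) :
    MeasurePreserving (fun v : RealSpace n => v + (2 : ℝ)⁻¹ • ξ) (lebesgueT n) (lebesgueT n) :=
  measurePreserving_add_right _ _

theorem memLp_qFun {n : ℕ} (k : Fin n → ℕ) (ξ : RealSpace n) :
    MemLp (qFun k ξ) 2 (lebesgueT n) := by
  have h := (memLp_qFun_zero k).comp_measurePreserving (measurePreserving_half ξ)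
  exact (memLp_congr_ae (.of_forall fun v => qFun_eq k ξ v)).2 h

/-- `q_{k,ξ}` as an element of `L²(ℝⁿ, μ̃_n)`. -/
def q {n : ℕ} (k : Fin n → ℕ) (ξ : RealSpace n) : Lp ℂ 2 (lebesgueT n) :=
  (memLp_qFun k ξ).toLp (qFun k ξ)

theorem q_eq {n : ℕ} (k : Fin n → ℕ) (ξ : RealSpace n) :
    q k ξ = Lp.compMeasurePreserving _ (measurePreserving_half ξ) (q k 0) := by
  rw [q, q, Lp.toLp_compMeasurePreserving]
  exact MemLp.toLp_congr _ _ (.of_forall fun v => qFun_eq k ξ v)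

theorem continuous_q {n : ℕ} (k : Fin n → ℕ) : Continuous (q (n := n) k) := by
  rw [show q (n := n) k = fun ξ => Lp.compMeasurePreserving _ (measurePreserving_half ξ) (q k 0)
    from funext fun ξ => q_eq k ξ]
  let g : RealSpace n → C(RealSpace n, RealSpace n) := fun ξ =>
    ⟨fun v => v + (2 : ℝ)⁻¹ • ξ, by fun_prop⟩
  have hg : Continuous g := ContinuousMap.continuous_of_continuous_uncurry _ (by
    change Continuous fun p : RealSpace n × RealSpace n => p.2 + (2 : ℝ)⁻¹ • p.1
    fun_prop)
  have : IsLocallyFiniteMeasure (lebesgueT n) := by unfold lebesgueT; infer_instance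
  exact Continuous.compMeasurePreservingLp (f := fun _ => q k 0) (g := g) continuous_const hg
    (fun ξ => measurePreserving_half ξ) (by simp)

theorem norm_q {n : ℕ} (k : Fin n → ℕ) (ξ : RealSpace n) : ‖q k ξ‖ = ‖q k 0‖ := by
  rw [q_eq, Lp.norm_compMeasurePreserving]

/-- The multi-indices `k ∈ ℕ₀ⁿ` with `|k| ≤ m - 1`, with the lexicographic order. -/
def multiIndices (n m : ℕ) : Finset (Lex (Fin n → ℕ)) :=
  ((Fintype.piFinset fun _ : Fin n => Finset.range m).filter fun k => ∑ r, k r < m).map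
    toLex.toEmbedding

theorem mem_multiIndices {n m : ℕ} (k : Fin n → ℕ) :
    toLex k ∈ multiIndices n m ↔ ∑ r, k r < m := by
  simp only [multiIndices, Finset.mem_map_equiv, Finset.mem_filter, Fintype.mem_piFinset,
    Finset.mem_range]
  refine ⟨fun h => h.2, fun h => ⟨fun r => ?_, h⟩⟩
  exact (Finset.single_le_sum (fun _ _ => Nat.zero_le _) (Finset.mem_univ r)).trans_lt h

/-- `d = #{k ∈ ℕ₀ⁿ : |k| ≤ m - 1}`. -/
def dim (n m : ℕ) : ℕ := (multiIndices n m).card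

/-- The increasing enumeration of the multi-indices in the lexicographic order. -/
def enum (n m : ℕ) (j : Fin (dim n m)) : Fin n → ℕ :=
  ofLex ((multiIndices n m).orderEmbOfFin rfl j)

/-- `L²(ℝⁿ, μ̃_n)^d = L²(ℝⁿ, μ̃_n; ℂ^d)`. -/
abbrev L2d (n m : ℕ) := Lp (EuclideanSpace ℂ (Fin (dim n m))) 2 (lebesgueT n)

/-- The operator `h ↦ (⟨h, q_{φ(j),ξ}⟩)_j` from `L²(ℝⁿ, μ̃_n)` to `ℂ^d`. -/
def coeffs (n m : ℕ) (ξ : RealSpace n) :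
    Lp ℂ 2 (lebesgueT n) →L[ℂ] EuclideanSpace ℂ (Fin (dim n m)) :=
  ∑ j, (innerSL ℂ (q (enum n m j) ξ)).smulRight (EuclideanSpace.single j 1)

theorem coeffs_apply (n m : ℕ) (ξ : RealSpace n) (h : Lp ℂ 2 (lebesgueT n)) (j : Fin (dim n m)) :
    coeffs n m ξ h j = inner ℂ (q (enum n m j) ξ) h := by
  simp [coeffs, Pi.single_apply]

theorem memLp_coeffs (n m : ℕ) : MemLp (coeffs n m) ∞ (lebesgueT n) := by
  have hc : Continuous (coeffs n m) := continuous_finsetSum _ fun j _ =>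
    ((ContinuousLinearMap.smulRightL ℂ (Lp ℂ 2 (lebesgueT n))
      (EuclideanSpace ℂ (Fin (dim n m)))).flip (EuclideanSpace.single j 1)).continuous.comp
        ((innerSL ℂ).continuous.comp (continuous_q (enum n m j)))
  refine memLp_top_of_bound hc.aestronglyMeasurable (∑ j : Fin (dim n m), ‖q (enum n m j) 0‖)
    (.of_forall fun ξ => ?_)
  refine (norm_sum_le _ _).trans (Finset.sum_le_sum fun j _ => ?_)
  rw [ContinuousLinearMap.norm_smulRight_apply]
  simp [norm_q]

/-- The operator `(N g)(ξ)_j = ⟨g(ξ, ·), q_{φ(j),ξ}⟩`, for `g ∈ L²(ℝⁿ; L²(ℝⁿ)) = L²(ℝ²ⁿ)`. -/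
def fiberCoeffs (n m : ℕ) : Lp (Lp ℂ 2 (lebesgueT n)) 2 (lebesgueT n) →L[ℂ] L2d n m :=
  (ContinuousLinearMap.id ℂ
    (Lp ℂ 2 (lebesgueT n) →L[ℂ] EuclideanSpace ℂ (Fin (dim n m)))).holderL (lebesgueT n) ∞ 2 2
      ((memLp_coeffs n m).toLp (coeffs n m))

/-- `R_{H_m} = N (F ⊗ I)` on `H_m`. -/
def RH (n m : ℕ) {α : ℝ} (hα : 0 < α) : flatFock n m hα →L[ℂ] L2d n m :=
  fiberCoeffs n m ∘L (fourierT n (Lp ℂ 2 (lebesgueT n))).toContinuousLinearMap ∘L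
    (slice (lebesgueT n) (lebesgueT n)).toContinuousLinearMap ∘L (flatFock n m hα).subtypeL

/-- `R_{F_{α,m}} = R_{H_m} U`. -/
def RF (n m : ℕ) {α : ℝ} (hα : 0 < α) : fock n m α →L[ℂ] L2d n m :=
  RH n m hα ∘L flattenFock n m hα

/-! ### Matrix symbols -/

/-- `L^∞(ℝⁿ)^{d×d}`: essentially bounded matrix functions, with the essential supremum of the
operator norm as the norm. -/
abbrev Symbols (n m : ℕ) := Lp (Matrix (Fin (dim n m)) (Fin (dim n m)) ℂ) ∞ (lebesgueT n)

/-- The pointwise product of matrix functions. -/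
instance (n m : ℕ) : Mul (Symbols n m) where
  mul σ τ := (σ • τ : Symbols n m)

/-- The multiplication operator `(M_σ f)(ξ) = σ(ξ) f(ξ)` on `L²(ℝⁿ, μ̃_n)^d`. -/
def mulOp {n m : ℕ} (σ : Symbols n m) : L2d n m →L[ℂ] L2d n m :=
  (LinearMap.toContinuousLinearMap (Matrix.toEuclideanCLM (n := Fin (dim n m))
    (𝕜 := ℂ)).toAlgEquiv.toLinearMap).holderL (lebesgueT n) ∞ 2 2 σ

theorem coeFn_mul {n m : ℕ} (σ τ : Symbols n m) :
    (σ * τ : Symbols n m) =ᵐ[lebesgueT n] fun ξ => σ ξ * τ ξ :=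
  Lp.coeFn_lpSMul σ τ

theorem coeFn_mulOp {n m : ℕ} (σ : Symbols n m) (f : L2d n m) :
    mulOp σ f =ᵐ[lebesgueT n] fun ξ => WithLp.toLp 2 ((σ ξ).mulVec (f ξ)) :=
  ContinuousLinearMap.coeFn_holder _ σ f

/-- `Λ(σ) = R* M_σ R` for an operator `R` from a Hilbert space to `L²(ℝⁿ, μ̃_n)^d`. -/
def Lam {n m : ℕ} {H : Type*} [NormedAddCommGroup H] [InnerProductSpace ℂ H] [CompleteSpace H]
    (R : H →L[ℂ] L2d n m) (σ : Symbols n m) : H →L[ℂ] H :=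
  ContinuousLinearMap.adjoint R ∘L mulOp σ ∘L R

end
end PolyFock

/-! Everything is reduced to one fact: `RH` is unitary from `H_m` onto `L²(ℝⁿ)^d` and turns the
translation by `a` into multiplication by the scalar character `e^{-i⟨a,ξ⟩}`. The commutant of all
these characters on `L²(ℝⁿ)^d` consists exactly of the multiplications by bounded matrix functions,
and conjugation by a unitary operator carries this description back.

Commutant of the characters (`exists_mulOp_eq`). If `B` commutes with them, then `⟨B*w(ξ), u(ξ)⟩`
and `⟨w(ξ), Bu(ξ)⟩` are integrable functions with equal integrals against every character, so they
agree almost everywhere by uniqueness for the Fourier transform. Taking for `w` a Gaussian times a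
basis vector exhibits `B` as multiplication by a matrix function; `ae_norm_le_of_forall_ae_eq`
bounds that function by `‖B‖`.

Unitarity of `R`. No orthonormal basis of the Fock space is needed, only the monomials `z̄ᵏ`. A
Gaussian integral shows that `F ⊗ I` sends `U z̄ᵏ` to `C e^{-|ξ|²/4} q_{k,ξ}` with `C ≠ 0`, and its
translates to the modulations of this function (`exists_fourierT_slice_flatten_monL2`). For each `ξ`
the `q_{k,ξ}`, over all `k`, form an orthonormal basis of the fiber: they are Hermite functions up
to an affine change of variable. For `|k| ≥ m`, averaging over rotations makes `z̄ᵏ` orthogonal to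
all `m`-analytic functions (`inner_monL2_eq_zero`). As `H_m` is invariant under translations, the
transform of any of its elements is orthogonal to all modulations of `e^{-|ξ|²/4} q_{k,ξ}`, hence to
`q_{k,ξ}` in almost every fiber. So the `d` remaining coefficients preserve the norm (`norm_RH`).
For `|k| < m` the translates of `U z̄ᵏ` lie in `H_m`, and their images, the modulations of Gaussian
multiples of the `e_j`, are total (`eq_zero_of_inner_RH`). The same vectors give the intertwining
relation `RH_rhoH`.

Completeness of the Fock space (`isClosed_fock`) rests on a single test function `Ψ` with `g * Ψ =
g` for every `m`-analytic `g`, built from the mean value property. -/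

namespace PolyFock
noncomputable section

open scoped FourierTransform SchwartzMap

/-! ### Uniqueness for the Fourier transform -/

section FourierUniqueness
variable {V E : Type*} [NormedAddCommGroup V] [InnerProductSpace ℝ V] [FiniteDimensional ℝ V]
  [MeasurableSpace V] [BorelSpace V]

/-- The multiplication formula `∫ 𝓕 f • g = ∫ f • 𝓕 g`. -/
theorem integral_fourier_smul [NormedAddCommGroup E] [NormedSpace ℂ E] [CompleteSpace E]
    {f : V → ℂ} {g : V → E} (hf : Integrable f) (hg : Integrable g) :
    ∫ ξ, 𝓕 f ξ • g ξ = ∫ x, f x • 𝓕 g x := by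
  simpa using! VectorFourier.integral_fourierIntegral_smul_eq_flip (L := innerₗ V)
    Real.continuous_fourierChar continuous_inner hf hg

theorem ae_eq_zero_of_integral_schwartz_smul [NormedAddCommGroup E] [NormedSpace ℂ E]
    [CompleteSpace E] {f : V → E} (hf : LocallyIntegrable f)
    (h : ∀ g : 𝓢(V, ℂ), ∫ x, g x • f x = 0) : f =ᵐ[volume] 0 := by
  refine ae_eq_zero_of_integral_contDiff_smul_eq_zero hf fun g hg hgc => ?_
  have hg' : ContDiff ℝ (⊤ : ℕ∞) fun x => (g x : ℂ) := Complex.ofRealCLM.contDiff.comp hg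
  have hgc' : HasCompactSupport fun x => (g x : ℂ) := hgc.comp_left (g := fun t : ℝ => (t : ℂ)) rfl
  have := h (hgc'.toSchwartzMap hg')
  simpa using this

/-- An integrable function with vanishing Fourier transform is zero. -/
theorem ae_eq_zero_of_fourier_eq_zero [NormedAddCommGroup E] [NormedSpace ℂ E] [CompleteSpace E]
    {f : V → E} (hf : Integrable f) (h : ∀ ξ, 𝓕 f ξ = 0) : f =ᵐ[volume] 0 := by
  refine ae_eq_zero_of_integral_schwartz_smul hf.locallyIntegrable fun g => ?_
  -- Every Schwartz function is the Fourier transform of a Schwartz function, so the multiplication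
  -- formula turns the vanishing of `𝓕 f` into `∫ g f = 0`.
  have h1 := integral_fourier_smul (𝓕⁻ g : 𝓢(V, ℂ)).integrable hf
  have h2 : 𝓕 (⇑(𝓕⁻ g : 𝓢(V, ℂ))) = ⇑g := by
    rw [← SchwartzMap.fourier_coe, FourierTransform.fourier_fourierInv_eq]
  rw [h2] at h1
  rw [h1]
  simp [h]

/-- The duality characterizing the Fourier transform on `L²`. -/
theorem integral_smul_fourier_Lp [NormedAddCommGroup E] [InnerProductSpace ℂ E] [CompleteSpace E]
    (f : Lp E 2 (volume : Measure V)) (g : 𝓢(V, ℂ)) :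
    ∫ ξ, g ξ • Lp.fourierTransformₗᵢ V E f ξ = ∫ x, (𝓕 g) x • f x := by
  have h := congrArg (fun T => T g) (Lp.fourier_toTemperedDistribution_eq f)
  simp only [TemperedDistribution.fourier_apply, Lp.toTemperedDistribution_apply] at h
  exact h.symm

end FourierUniqueness

/-! ### The normalized measure and the characters -/

theorem lebesgueT_eq (n : ℕ) : lebesgueT n =
    ENNReal.ofReal ((2 * Real.pi) ^ (-(n : ℝ) / 2)) • volume := rfl

theorem ae_lebesgueT (n : ℕ) : ae (lebesgueT n) = ae volume := by
  rw [lebesgueT_eq]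
  exact Measure.ae_ennreal_smul_measure_eq (by simp; positivity) _

theorem integrable_lebesgueT {n : ℕ} {E : Type*} [NormedAddCommGroup E] {f : RealSpace n → E} :
    Integrable f (lebesgueT n) ↔ Integrable f volume := by
  rw [lebesgueT_eq]
  exact integrable_smul_measure (by simp; positivity) (by simp)

theorem integral_lebesgueT {n : ℕ} {E : Type*} [NormedAddCommGroup E] [NormedSpace ℝ E]
    (f : RealSpace n → E) :
    ∫ x, f x ∂lebesgueT n = ((2 * Real.pi) ^ (-(n : ℝ) / 2) : ℝ) • ∫ x, f x := by
  rw [lebesgueT_eq, integral_smul_measure, ENNReal.toReal_ofReal (by positivity)]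

/-- The character `ξ ↦ e^{-i⟨a,ξ⟩}`. -/
def expChar {n : ℕ} (a ξ : RealSpace n) : ℂ := Complex.exp (-(inner ℝ a ξ : ℝ) * Complex.I)

theorem norm_expChar {n : ℕ} (a ξ : RealSpace n) : ‖expChar a ξ‖ = 1 := by
  rw [expChar, ← Complex.ofReal_neg, Complex.norm_exp_ofReal_mul_I]

theorem continuous_expChar {n : ℕ} (a : RealSpace n) : Continuous (expChar a) := by
  unfold expChar; fun_prop

theorem conj_expChar {n : ℕ} (a ξ : RealSpace n) :
    (starRingEnd ℂ) (expChar a ξ) = expChar (-a) ξ := by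
  rw [expChar, expChar, ← Complex.exp_conj]
  simp

/-- A function in `L¹` orthogonal to all characters is zero. -/
theorem ae_eq_zero_of_integral_expChar {n : ℕ} {E : Type*} [NormedAddCommGroup E]
    [NormedSpace ℂ E] [CompleteSpace E] {f : RealSpace n → E} (hf : Integrable f (lebesgueT n))
    (h : ∀ a, ∫ ξ, expChar a ξ • f ξ ∂lebesgueT n = 0) : f =ᵐ[lebesgueT n] 0 := by
  rw [Filter.EventuallyEq, ae_lebesgueT]
  rw [integrable_lebesgueT] at hf
  refine ae_eq_zero_of_fourier_eq_zero hf fun ξ => ?_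
  -- The kernel of `𝓕` is `e^{-2πi⟨x,ξ⟩}`, so its value at `ξ` is the integral against the character
  -- of `2πξ`.
  have h1 := h ((2 * Real.pi) • ξ)
  rw [integral_lebesgueT, smul_eq_zero_iff_right (by positivity)] at h1
  rw [Real.fourier_eq', ← h1]
  congr 1
  funext v
  rw [expChar, inner_smul_left, real_inner_comm]
  simp

end
end PolyFock

namespace PolyFock
noncomputable section

/-! ### Multiplication operators by matrix symbols -/

section MulOp
variable {n m : ℕ}

theorem coeFn_mulOp_clm (σ : Symbols n m) (f : L2d n m) :
    mulOp σ f =ᵐ[lebesgueT n] fun ξ => Matrix.toEuclideanCLM (𝕜 := ℂ) (σ ξ) (f ξ) :=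
  ContinuousLinearMap.coeFn_holder _ σ f

theorem mulOp_add (σ τ : Symbols n m) : mulOp (σ + τ) = mulOp σ + mulOp τ := map_add _ σ τ

theorem mulOp_smul (c : ℂ) (σ : Symbols n m) : mulOp (c • σ) = c • mulOp σ := map_smul _ c σ

theorem mulOp_mul (σ τ : Symbols n m) : mulOp (σ * τ) = mulOp σ ∘L mulOp τ := by
  refine ContinuousLinearMap.ext fun f => Lp.ext ?_
  filter_upwards [coeFn_mulOp_clm (σ * τ) f, coeFn_mulOp_clm σ (mulOp τ f), coeFn_mulOp_clm τ f,
    coeFn_mul σ τ] with ξ h1 h2 h3 h4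
  rw [ContinuousLinearMap.comp_apply, h1, h2, h3, h4, map_mul]
  rfl

theorem adjoint_mulOp (σ : Symbols n m) :
    ContinuousLinearMap.adjoint (mulOp σ) = mulOp (star σ) := by
  symm
  rw [ContinuousLinearMap.eq_adjoint_iff]
  intro f g
  rw [L2.inner_def, L2.inner_def]
  refine integral_congr_ae ?_
  filter_upwards [coeFn_mulOp_clm (star σ) f, coeFn_mulOp_clm σ g, Lp.coeFn_star σ] with ξ h1 h2 h3
  rw [h1, h2, h3, Pi.star_apply, map_star, ContinuousLinearMap.star_eq_adjoint,
    ContinuousLinearMap.adjoint_inner_left]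

theorem norm_mulOp_le (σ : Symbols n m) : ‖mulOp σ‖ ≤ ‖σ‖ := by
  refine ContinuousLinearMap.opNorm_le_bound _ (norm_nonneg _) fun f => ?_
  refine (ContinuousLinearMap.norm_holder_apply_apply_le _ σ f).trans ?_
  refine mul_le_mul_of_nonneg_right ?_ (norm_nonneg _)
  refine mul_le_of_le_one_left (norm_nonneg _) ?_
  refine ContinuousLinearMap.opNorm_le_bound _ zero_le_one fun A => ?_
  rw [one_mul, Matrix.cstar_norm_def]
  rfl

/-- A bounded operator that acts as multiplication by a matrix function bounds this function. -/
theorem ae_norm_le_of_forall_ae_eq (B : L2d n m →L[ℂ] L2d n m)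
    (σ : RealSpace n → Matrix (Fin (dim n m)) (Fin (dim n m)) ℂ)
    (hσ : AEStronglyMeasurable σ (lebesgueT n))
    (h : ∀ u : L2d n m, B u =ᵐ[lebesgueT n] fun ξ => Matrix.toEuclideanCLM (𝕜 := ℂ) (σ ξ) (u ξ)) :
    ∀ᵐ ξ ∂lebesgueT n, ‖σ ξ‖ ≤ ‖B‖ := by
  obtain ⟨τ, hτ, hστ⟩ := hσ
  -- Testing `B` on `1_s c` gives `∫_s ‖σ c‖² ≤ ‖B‖² ‖c‖² μ(s)` for every set `s` of finite measure,
  -- which forces the pointwise bound for each fixed `c`.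
  have key : ∀ c : EuclideanSpace ℂ (Fin (dim n m)), ∀ᵐ ξ ∂lebesgueT n,
      ‖Matrix.toEuclideanCLM (𝕜 := ℂ) (τ ξ) c‖ ≤ ‖B‖ * ‖c‖ := by
    intro c
    have hcont : Continuous fun A : Matrix (Fin (dim n m)) (Fin (dim n m)) ℂ =>
        Matrix.toEuclideanCLM (𝕜 := ℂ) A c :=
      (LinearMap.continuous_of_finiteDimensional
        ((ContinuousLinearMap.apply ℂ _ c).toLinearMap ∘ₗ (Matrix.toEuclideanCLM
          (n := Fin (dim n m)) (𝕜 := ℂ)).toAlgEquiv.toLinearMap))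
    have hm : StronglyMeasurable fun ξ => Matrix.toEuclideanCLM (𝕜 := ℂ) (τ ξ) c :=
      hcont.comp_stronglyMeasurable hτ
    have := ae_le_of_forall_setLIntegral_le_of_sigmaFinite (μ := lebesgueT n)
      (f := fun ξ => ‖Matrix.toEuclideanCLM (𝕜 := ℂ) (τ ξ) c‖ₑ ^ 2)
      (g := fun ξ => (‖B‖ₑ * ‖c‖ₑ) ^ 2) (hm.enorm.pow_const 2) fun s hs hμs => by
        have h1 := B.le_opENorm (indicatorConstLp 2 hs hμs.ne c)
        have h2 : ∀ u : L2d n m, ‖u‖ₑ ^ 2 = ∫⁻ ξ, ‖u ξ‖ₑ ^ 2 ∂lebesgueT n := by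
          intro u
          rw [Lp.enorm_def, eLpNorm_eq_lintegral_rpow_enorm_toReal two_ne_zero
            ENNReal.ofNat_ne_top, ← ENNReal.rpow_natCast, ← ENNReal.rpow_mul]
          simp
        have h3 := pow_le_pow_left₀ zero_le h1 2
        rw [mul_pow, h2, h2] at h3
        refine le_trans (le_of_eq ?_) (h3.trans (le_of_eq ?_))
        · rw [← lintegral_indicator hs]
          refine lintegral_congr_ae ?_
          filter_upwards [h (indicatorConstLp 2 hs hμs.ne c), hστ,
            indicatorConstLp_coeFn (p := 2) (hs := hs) (hμs := hμs.ne) (c := c)] with ξ e1 e2 e3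
          rw [e1, e2, e3]
          by_cases hξ : ξ ∈ s <;> simp [hξ]
        · have : ∫⁻ ξ, ‖(indicatorConstLp 2 hs hμs.ne c : L2d n m) ξ‖ₑ ^ 2 ∂lebesgueT n =
              ∫⁻ ξ in s, ‖c‖ₑ ^ 2 ∂lebesgueT n := by
            rw [← lintegral_indicator hs]
            refine lintegral_congr_ae ?_
            filter_upwards [indicatorConstLp_coeFn (p := 2) (hs := hs) (hμs := hμs.ne)
              (c := c)] with ξ e3
            rw [e3]
            by_cases hξ : ξ ∈ s <;> simp [hξ]
          rw [this]
          simp only [lintegral_const, mul_pow]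
          ring
    filter_upwards [this] with ξ hξ
    have h5 := (ENNReal.pow_le_pow_left_iff two_ne_zero).1 hξ
    rw [← ofReal_norm, ← ofReal_norm, ← ofReal_norm, ← ENNReal.ofReal_mul (norm_nonneg _)] at h5
    exact (ENNReal.ofReal_le_ofReal_iff (by positivity)).1 h5
  -- The exceptional null set depends on `c`; a countable dense set of vectors leaves a single null
  -- set, and continuity in `c` does the rest.
  have key2 := ae_all_iff.2 fun i => key (TopologicalSpace.denseSeq _ i)
  filter_upwards [key2, hστ] with ξ h1 h2
  rw [h2, Matrix.cstar_norm_def]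
  refine ContinuousLinearMap.opNorm_le_bound _ (norm_nonneg _) fun c => ?_
  refine (TopologicalSpace.denseRange_denseSeq _).induction_on (p := fun c =>
    ‖Matrix.toEuclideanCLM (𝕜 := ℂ) (τ ξ) c‖ ≤ ‖B‖ * ‖c‖) c ?_ h1
  exact isClosed_le (by fun_prop) (by fun_prop)

theorem norm_mulOp (σ : Symbols n m) : ‖mulOp σ‖ = ‖σ‖ := by
  refine le_antisymm (norm_mulOp_le σ) ?_
  have h := ae_norm_le_of_forall_ae_eq (mulOp σ) σ (Lp.aestronglyMeasurable σ) (coeFn_mulOp_clm σ)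
  rw [Lp.norm_def, eLpNorm_exponent_top]
  exact ENNReal.toReal_le_of_le_ofReal (norm_nonneg _) (eLpNormEssSup_le_of_ae_bound h)

theorem memLp_expChar_one (a : RealSpace n) :
    MemLp (fun ξ => expChar a ξ • (1 : Matrix (Fin (dim n m)) (Fin (dim n m)) ℂ)) ∞
      (lebesgueT n) := by
  refine memLp_top_of_bound ((continuous_expChar a).smul continuous_const).aestronglyMeasurable
    ‖(1 : Matrix (Fin (dim n m)) (Fin (dim n m)) ℂ)‖ (.of_forall fun ξ => ?_)
  rw [norm_smul, norm_expChar, one_mul]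

/-- The scalar symbol `e^{-i⟨a,ξ⟩}`. -/
def expSymbol (a : RealSpace n) : Symbols n m := (memLp_expChar_one a).toLp _

theorem coeFn_mulOp_expSymbol (a : RealSpace n) (f : L2d n m) :
    mulOp (expSymbol a) f =ᵐ[lebesgueT n] fun ξ => expChar a ξ • f ξ := by
  filter_upwards [coeFn_mulOp_clm (expSymbol a) f, (memLp_expChar_one (m := m) a).coeFn_toLp]
    with ξ h1 h2
  rw [h1, expSymbol, h2, map_smul, map_one]
  rfl

theorem mulOp_expSymbol_comm (a : RealSpace n) (σ : Symbols n m) :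
    mulOp (expSymbol a) ∘L mulOp σ = mulOp σ ∘L mulOp (expSymbol a) := by
  refine ContinuousLinearMap.ext fun f => Lp.ext ?_
  simp only [ContinuousLinearMap.comp_apply]
  filter_upwards [coeFn_mulOp_expSymbol a (mulOp σ f), coeFn_mulOp_clm σ f,
    coeFn_mulOp_clm σ (mulOp (expSymbol a) f), coeFn_mulOp_expSymbol a f] with ξ h1 h2 h3 h4
  rw [h1, h2, h3, h4, map_smul]

theorem star_expSymbol (a : RealSpace n) :
    star (expSymbol a : Symbols n m) = expSymbol (-a) := by
  refine Lp.ext ?_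
  filter_upwards [Lp.coeFn_star (expSymbol a : Symbols n m),
    (memLp_expChar_one (m := m) a).coeFn_toLp, (memLp_expChar_one (m := m) (-a)).coeFn_toLp]
    with ξ h1 h2 h3
  rw [h1, Pi.star_apply, expSymbol, h2, expSymbol, h3, star_smul, star_one, ← conj_expChar]
  rfl

theorem memLp_gaussianFun (n : ℕ) {b : ℝ} (hb : 0 < b) :
    MemLp (fun ξ : RealSpace n => (Real.exp (-b * ‖ξ‖ ^ 2) : ℂ)) 2 (lebesgueT n) := by
  have hc : Continuous fun ξ : RealSpace n => (Real.exp (-b * ‖ξ‖ ^ 2) : ℂ) := by fun_prop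
  rw [memLp_two_iff_integrable_sq_norm hc.aestronglyMeasurable, integrable_lebesgueT]
  have h := (GaussianFourier.integrable_cexp_neg_mul_sq_norm_add (b := (2 * b : ℝ))
    (by simpa using hb) 0 (0 : RealSpace n)).norm
  refine h.congr (.of_forall fun ξ => ?_)
  simp only [Complex.norm_exp, Complex.norm_real, Real.norm_eq_abs, Real.abs_exp, ← Real.exp_nat_mul]
  congr 1
  simp [← Complex.ofReal_pow]
  ring

/-- The vector function `e^{-|ξ|²/4} e_j`. -/
def gaussianVec (n m : ℕ) (j : Fin (dim n m)) : L2d n m :=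
  ((ContinuousLinearMap.toSpanSingleton ℂ
    (EuclideanSpace.single j (1 : ℂ))).comp_memLp'
      (memLp_gaussianFun n (b := 1 / 4) (by norm_num))).toLp _

theorem coeFn_gaussianVec (j : Fin (dim n m)) : gaussianVec n m j =ᵐ[lebesgueT n]
    fun ξ => (Real.exp (-(1 / 4) * ‖ξ‖ ^ 2) : ℂ) • EuclideanSpace.single j (1 : ℂ) :=
  MemLp.coeFn_toLp _

/-- An operator that commutes with multiplication by all characters is a multiplication
operator. -/
theorem exists_mulOp_eq (B : L2d n m →L[ℂ] L2d n m)
    (hB : ∀ a, B ∘L mulOp (expSymbol a) = mulOp (expSymbol a) ∘L B) :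
    ∃ σ : Symbols n m, mulOp σ = B := by
  -- This is where commutation is used: the difference of the two integrable functions has zero
  -- integral against each character, so Fourier uniqueness applies.
  have key : ∀ w u : L2d n m, ∀ᵐ ξ ∂lebesgueT n,
      inner ℂ (ContinuousLinearMap.adjoint B w ξ) (u ξ) = (inner ℂ (w ξ) (B u ξ) : ℂ) := by
    intro w u
    have := ae_eq_zero_of_integral_expChar
      ((L2.integrable_inner (𝕜 := ℂ) (ContinuousLinearMap.adjoint B w) u).sub
        (L2.integrable_inner (𝕜 := ℂ) w (B u))) fun a => by
        have h1 : ∫ ξ, expChar a ξ • (inner ℂ (ContinuousLinearMap.adjoint B w ξ) (u ξ) : ℂ)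
            ∂lebesgueT n =
            inner ℂ (ContinuousLinearMap.adjoint B w) (mulOp (expSymbol a) u) := by
          rw [L2.inner_def]
          refine integral_congr_ae ?_
          filter_upwards [coeFn_mulOp_expSymbol a u] with ξ h
          rw [h, inner_smul_right, smul_eq_mul]
        have h2 : ∫ ξ, expChar a ξ • (inner ℂ (w ξ) (B u ξ) : ℂ) ∂lebesgueT n =
            inner ℂ w (mulOp (expSymbol a) (B u)) := by
          rw [L2.inner_def]
          refine integral_congr_ae ?_
          filter_upwards [coeFn_mulOp_expSymbol a (B u)] with ξ h
          rw [h, inner_smul_right, smul_eq_mul]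
        have hbd : ∀ f : RealSpace n → ℂ, Integrable f (lebesgueT n) →
            Integrable (fun ξ => expChar a ξ • f ξ) (lebesgueT n) := fun f hf =>
          hf.bdd_mul (continuous_expChar a).aestronglyMeasurable
            (.of_forall fun ξ => (norm_expChar a ξ).le)
        simp only [Pi.sub_apply, smul_sub]
        rw [integral_sub (hbd _ (L2.integrable_inner _ _)) (hbd _ (L2.integrable_inner _ _)),
          h1, h2, ContinuousLinearMap.adjoint_inner_left, sub_eq_zero]
        exact congrArg (inner ℂ w) (DFunLike.congr_fun (hB a) u)
    filter_upwards [this] with ξ hξ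
    exact sub_eq_zero.1 hξ
  -- Row `i` is read off from `key` with `w = e^{-|ξ|²/4} e_i`. Constant vectors are not square
  -- integrable, so a nowhere vanishing Gaussian is inserted and then divided out.
  set τ : RealSpace n → Matrix (Fin (dim n m)) (Fin (dim n m)) ℂ := fun ξ => Matrix.of fun i j =>
    (Real.exp (-(1 / 4) * ‖ξ‖ ^ 2) : ℂ)⁻¹ *
      (starRingEnd ℂ) (ContinuousLinearMap.adjoint B (gaussianVec n m i) ξ j) with hτ
  have hτm : StronglyMeasurable τ := by
    have hcomp : ∀ i j, Measurable fun ξ => τ ξ i j := by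
      intro i j
      have h1 : Measurable fun ξ => ContinuousLinearMap.adjoint B (gaussianVec n m i) ξ j :=
        ((EuclideanSpace.proj (𝕜 := ℂ) j).continuous.comp_stronglyMeasurable
          (Lp.stronglyMeasurable (ContinuousLinearMap.adjoint B (gaussianVec n m i)))).measurable
      simp only [hτ, Matrix.of_apply]
      exact Measurable.mul (by fun_prop) (Complex.continuous_conj.measurable.comp h1)
    have heq : τ = fun ξ => ∑ i, ∑ j, τ ξ i j • Matrix.single i j (1 : ℂ) := by
      funext ξ
      conv_lhs => rw [Matrix.matrix_eq_sum_single (τ ξ)]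
      simp [Matrix.smul_single]
    rw [heq]
    refine Finset.stronglyMeasurable_fun_sum _ fun i _ => Finset.stronglyMeasurable_fun_sum _
      fun j _ => ?_
    exact (hcomp i j).stronglyMeasurable.smul_const _
  have hact : ∀ u : L2d n m, B u =ᵐ[lebesgueT n]
      fun ξ => Matrix.toEuclideanCLM (𝕜 := ℂ) (τ ξ) (u ξ) := by
    intro u
    have h1 := ae_all_iff.2 fun i => key (gaussianVec n m i) u
    have h2 := ae_all_iff.2 fun i => coeFn_gaussianVec (n := n) (m := m) i
    filter_upwards [h1, h2] with ξ h1 h2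
    ext i
    have h3 := h1 i
    rw [h2 i, inner_smul_left, EuclideanSpace.inner_single_left, PiLp.inner_apply] at h3
    have hne : (Real.exp (-(1 / 4) * ‖ξ‖ ^ 2) : ℂ) ≠ 0 := by
      exact_mod_cast (Real.exp_pos _).ne'
    rw [Matrix.ofLp_toEuclideanCLM, Matrix.mulVec, dotProduct]
    simp only [hτ, Matrix.of_apply, mul_assoc, ← Finset.mul_sum]
    simp only [Complex.conj_ofReal, map_one, one_mul] at h3
    rw [eq_inv_mul_iff_mul_eq₀ hne, ← h3]
    refine Finset.sum_congr rfl fun j _ => ?_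
    rw [RCLike.inner_apply, mul_comm]
  -- So far `τ` is only measurable; it is essentially bounded because it acts as the bounded
  -- operator `B`.
  have hbd := ae_norm_le_of_forall_ae_eq B τ hτm.aestronglyMeasurable hact
  have hmem := memLp_top_of_bound hτm.aestronglyMeasurable ‖B‖ hbd
  refine ⟨hmem.toLp τ, ContinuousLinearMap.ext fun u => Lp.ext ?_⟩
  filter_upwards [coeFn_mulOp_clm (hmem.toLp τ) u, hact u, hmem.coeFn_toLp] with ξ h1 h2 h3
  rw [h1, h2, h3]

end MulOp

/-! ### Commutants of families that are unitarily equivalent to the characters -/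

section Commutant
variable {n m : ℕ} {H : Type*} [NormedAddCommGroup H] [InnerProductSpace ℂ H] [CompleteSpace H]

/-- The commutant of a family of operators closed under adjoints. -/
def commutantVN (S : Set (H →L[ℂ] H)) : VonNeumannAlgebra H where
  toStarSubalgebra := StarSubalgebra.centralizer ℂ S
  -- A centralizer is its own double centralizer.
  centralizer_centralizer' := Set.centralizer_centralizer_centralizer _

/-- `StarSubalgebra.centralizer` takes the centralizer of `S ∪ star S`; closure under adjoints makes
the second set redundant. -/
theorem coe_commutantVN {S : Set (H →L[ℂ] H)} (hS : ∀ T ∈ S, star T ∈ S) :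
    (commutantVN S : Set (H →L[ℂ] H)) = Set.centralizer S := by
  have : (commutantVN S : Set (H →L[ℂ] H)) = Set.centralizer (S ∪ star S) := rfl
  rw [this, Set.union_eq_self_of_subset_right]
  intro T hT
  simpa using hS _ hT

/-- If a unitary `R` turns the operators `ρ(a)` into multiplications by the characters
`e^{-is⟨a,ξ⟩}`, then `σ ↦ R* M_σ R` is an isometric isomorphism onto the commutant of `ρ`. -/
theorem exists_vonNeumann_starAlgEquiv (R : H →L[ℂ] L2d n m)
    (hR : ContinuousLinearMap.adjoint R ∘L R = 1) (hR' : R ∘L ContinuousLinearMap.adjoint R = 1)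
    (ρ : RealSpace n → H →L[ℂ] H) {s : ℝ} (hs : s ≠ 0)
    (hρ : ∀ a, R ∘L ρ a = mulOp (expSymbol (s • a)) ∘L R) :
    ∃ A : VonNeumannAlgebra H, (A : Set (H →L[ℂ] H)) = Set.centralizer (Set.range ρ) ∧
      ∃ Φ : Symbols n m ≃⋆ₐ[ℂ] A.toStarSubalgebra, Isometry Φ ∧
        ∀ σ, (Φ σ : H →L[ℂ] H) = Lam R σ := by
  set R' := ContinuousLinearMap.adjoint R with hR'def
  have e1 : ∀ x, R' (R x) = x := fun x => DFunLike.congr_fun hR x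
  have e2 : ∀ x, R (R' x) = x := fun x => DFunLike.congr_fun hR' x
  have hρ1 : ∀ a x, R (ρ a x) = mulOp (expSymbol (s • a)) (R x) := fun a x =>
    DFunLike.congr_fun (hρ a) x
  have hρ2 : ∀ a x, ρ a x = R' (mulOp (expSymbol (s • a)) (R x)) := fun a x => by
    rw [← hρ1, e1]
  -- The adjoint of `ρ(a)` is `ρ(-a)`, because conjugating a character negates its parameter.
  have hstar : ∀ T ∈ Set.range ρ, star T ∈ Set.range ρ := by
    rintro _ ⟨a, rfl⟩
    refine ⟨-a, ?_⟩
    rw [ContinuousLinearMap.star_eq_adjoint, ContinuousLinearMap.eq_adjoint_iff]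
    intro x y
    rw [hρ2, hρ2, hR'def, ContinuousLinearMap.adjoint_inner_left,
      ContinuousLinearMap.adjoint_inner_right, smul_neg, ← star_expSymbol, ← adjoint_mulOp,
      ContinuousLinearMap.adjoint_inner_left]
  have hLam : ∀ σ x, Lam R σ x = R' (mulOp σ (R x)) := fun σ x => rfl
  have hmem : ∀ σ, Lam R σ ∈ commutantVN (Set.range ρ) := by
    intro σ
    rw [← SetLike.mem_coe, coe_commutantVN hstar, Set.mem_centralizer_iff]
    rintro _ ⟨a, rfl⟩
    ext x
    rw [mul_apply_eq_comp, mul_apply_eq_comp, hρ2, hLam, hLam, hρ1, e2]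
    exact congrArg R' (DFunLike.congr_fun (mulOp_expSymbol_comm (s • a) σ) (R x))
  have hRn : ∀ x, ‖R x‖ = ‖x‖ := (ContinuousLinearMap.norm_map_iff_adjoint_comp_self R).2 hR
  have hRn' : ∀ x, ‖R' x‖ = ‖x‖ := fun x => by rw [← hRn, e2]
  have hnorm : ∀ σ, ‖Lam R σ‖ = ‖σ‖ := by
    intro σ
    rw [← norm_mulOp]
    refine le_antisymm ?_ ?_
    · refine ContinuousLinearMap.opNorm_le_bound _ (norm_nonneg _) fun x => ?_
      rw [hLam, hRn', ← hRn x]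
      exact (mulOp σ).le_opNorm _
    -- For the reverse inequality `Λ(σ)` is tested on the vectors `R* x`, which exhaust `H` and have
    -- the norm of `x`.
    · refine ContinuousLinearMap.opNorm_le_bound _ (norm_nonneg _) fun x => ?_
      have := (Lam R σ).le_opNorm (R' x)
      rwa [hLam, hRn', hRn', e2] at this
  have hadd : ∀ σ τ, Lam R (σ + τ) = Lam R σ + Lam R τ := fun σ τ => by
    ext x; simp [hLam, mulOp_add]
  have hsmul : ∀ (c : ℂ) σ, Lam R (c • σ) = c • Lam R σ := fun c σ => by
    ext x; simp [hLam, mulOp_smul]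
  have hmul : ∀ σ τ, Lam R (σ * τ) = Lam R σ * Lam R τ := fun σ τ => by
    ext x; simp [hLam, mulOp_mul, e2]
  have hst : ∀ σ, Lam R (star σ) = star (Lam R σ) := fun σ => by
    rw [ContinuousLinearMap.star_eq_adjoint, ContinuousLinearMap.eq_adjoint_iff]
    intro x y
    rw [hLam, hLam, hR'def, ContinuousLinearMap.adjoint_inner_left,
      ContinuousLinearMap.adjoint_inner_right, ← adjoint_mulOp,
      ContinuousLinearMap.adjoint_inner_left]
  let Ψ : Symbols n m →+ (commutantVN (Set.range ρ)).toStarSubalgebra :=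
    { toFun := fun σ => ⟨Lam R σ, hmem σ⟩
      map_zero' := Subtype.ext (by simpa using hsmul 0 0)
      map_add' := fun σ τ => Subtype.ext (hadd σ τ) }
  have hiso : Isometry Ψ := AddMonoidHomClass.isometry_of_norm Ψ hnorm
  have hsurj : Function.Surjective Ψ := by
    rintro ⟨T, hT⟩
    have hT' : T ∈ (commutantVN (Set.range ρ) : Set (H →L[ℂ] H)) := hT
    rw [coe_commutantVN hstar, Set.mem_centralizer_iff] at hT'
    -- The symbol of `T` is that of `R T R*`. The character of `a` is realized by `ρ(s⁻¹ a)`, so `s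
    -- ≠ 0` ensures that all characters occur.
    obtain ⟨σ, hσ⟩ := exists_mulOp_eq (R ∘L T ∘L R') fun a => by
      ext1 x
      have h1 := DFunLike.congr_fun (hT' (ρ (s⁻¹ • a)) ⟨_, rfl⟩) (R' x)
      rw [mul_apply_eq_comp, mul_apply_eq_comp, hρ2, hρ2, smul_inv_smul₀ hs, e2] at h1
      have h2 := congrArg R h1
      rw [e2] at h2
      exact h2.symm
    refine ⟨σ, Subtype.ext (ContinuousLinearMap.ext fun x => ?_)⟩
    change Lam R σ x = T x
    rw [hLam, hσ]
    simp [e1]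
  refine ⟨commutantVN (Set.range ρ), coe_commutantVN hstar,
    { Equiv.ofBijective Ψ ⟨hiso.injective, hsurj⟩ with
      map_mul' := fun σ τ => Subtype.ext (hmul σ τ)
      map_add' := fun σ τ => Subtype.ext (hadd σ τ)
      map_star' := fun σ => Subtype.ext (hst σ)
      map_smul' := fun c σ => Subtype.ext (hsmul c σ) }, hiso, fun σ => rfl⟩

end Commutant
end
end PolyFock

namespace PolyFock
noncomputable section

/-! ### Hermite polynomials: orthogonality -/

section Hermite
open Polynomial

theorem integrable_eval_mul_exp (p : ℝ[X]) {b : ℝ} (hb : 0 < b) :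
    Integrable fun t : ℝ => p.eval t * Real.exp (-b * t ^ 2) := by
  induction p using Polynomial.induction_on' with
  | add p q hp hq =>
    simp only [eval_add, add_mul]
    exact hp.add hq
  | monomial j c =>
    have h := (integrable_rpow_mul_exp_neg_mul_sq hb (s := j)
      (by have : (0 : ℝ) ≤ j := j.cast_nonneg; linarith)).const_mul c
    simpa [eval_monomial, mul_assoc] using h

/-- The Hermite polynomial with real coefficients. -/
def hermiteR (k : ℕ) : ℝ[X] := (hermite k).map (Int.castRingHom ℝ)

theorem hermiteR_succ (k : ℕ) : hermiteR (k + 1) = X * hermiteR k - derivative (hermiteR k) := by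
  simp [hermiteR, hermite_succ, derivative_map]

theorem eval_hermiteR (k : ℕ) (t : ℝ) : (hermiteR k).eval t = aeval t (hermite k) :=
  eval_map_algebraMap (hermite k) t

theorem natDegree_hermiteR (k : ℕ) : (hermiteR k).natDegree = k := by
  rw [hermiteR, natDegree_map_eq_of_injective (RingHom.injective_int _), natDegree_hermite]

/-- The integrand is the derivative of `p e^{-t²/2}`: in the Gaussian weight, `X - d/dt` is the
adjoint of `d/dt`. -/
theorem integral_derivative_sub_mul_exp (p : ℝ[X]) :
    ∫ t : ℝ, (derivative p - X * p).eval t * Real.exp (-(1 / 2) * t ^ 2) = 0 := by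
  refine integral_eq_zero_of_hasDerivAt_of_integrable
    (f := fun t => p.eval t * Real.exp (-(1 / 2) * t ^ 2)) (fun t => ?_)
    (integrable_eval_mul_exp _ (by norm_num)) (integrable_eval_mul_exp _ (by norm_num))
  have h1 : HasDerivAt (fun t : ℝ => Real.exp (-(1 / 2) * t ^ 2))
      (Real.exp (-(1 / 2) * t ^ 2) * (-(1 / 2) * (2 * t))) t := by
    simpa using ((hasDerivAt_pow 2 t).const_mul (-(1 / 2) : ℝ)).exp
  refine ((p.hasDerivAt t).mul h1).congr_deriv ?_
  simp
  ring

/-- Since `He_{k+1} = (X - d/dt) He_k`, each integration by parts removes one level of the Hermite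
polynomial and puts one derivative on `p`. -/
theorem integral_hermiteR_mul (k : ℕ) (p : ℝ[X]) :
    ∫ t : ℝ, (hermiteR k * p).eval t * Real.exp (-(1 / 2) * t ^ 2) =
      ∫ t : ℝ, (derivative^[k] p).eval t * Real.exp (-(1 / 2) * t ^ 2) := by
  induction k generalizing p with
  | zero => simp [hermiteR]
  | succ k ih =>
    rw [Function.iterate_succ, Function.comp_apply, ← ih, ← sub_eq_zero, ← integral_sub
      (integrable_eval_mul_exp _ (by norm_num)) (integrable_eval_mul_exp _ (by norm_num)),
      ← neg_eq_zero, ← integral_neg, ← integral_derivative_sub_mul_exp (hermiteR k * p)]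
    congr 1
    funext t
    rw [hermiteR_succ]
    simp
    ring

/-- With `k ≤ j`, the `j`-th derivative of `He_k` is zero for `k < j`, and for `k = j` it is the
constant `j!` because `He_j` is monic of degree `j`. -/
theorem integral_hermiteR_mul_hermiteR (j k : ℕ) :
    ∫ t : ℝ, (hermiteR j).eval t * (hermiteR k).eval t * Real.exp (-(1 / 2) * t ^ 2) =
      if j = k then (k.factorial : ℝ) * √(2 * Real.pi) else 0 := by
  wlog hjk : k ≤ j generalizing j k
  · rw [if_neg (by omega), ← this k j (by omega) |>.trans (if_neg (by omega))]
    simp only [mul_comm (eval _ (hermiteR j))]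
  have h := integral_hermiteR_mul j (hermiteR k)
  simp only [eval_mul] at h
  rw [h]
  split_ifs with hjk'
  · subst hjk'
    have h1 : derivative^[j] (hermiteR j) = C (j.factorial : ℝ) := by
      rw [eq_C_of_natDegree_le_zero ((natDegree_iterate_derivative _ _).trans
        (by rw [natDegree_hermiteR, Nat.sub_self])), coeff_iterate_derivative, zero_add,
        Nat.descFactorial_self]
      simp [hermiteR]
    rw [h1]
    simp only [eval_C]
    rw [integral_const_mul, integral_gaussian]
    congr 2
    field_simp
  · rw [iterate_derivative_eq_zero (by rw [natDegree_hermiteR]; omega)]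
    simp

/-- At `t/√2` the powers of `2` in the physicist's normalization cancel, leaving `He_k(t) e^{-t²/4}`
up to a constant. This is the form in which `q_{k,ξ}` is handled below. -/
theorem hermiteFun_div_sqrt (k : ℕ) (t : ℝ) :
    hermiteFun k (t / √2) = ((k.factorial : ℝ) * √Real.pi) ^ (-(1 / 2) : ℝ) *
      (Real.exp (-(1 / 4) * t ^ 2) * (hermiteR k).eval t) := by
  have h2 : √2 ≠ (0 : ℝ) := by positivity
  have e1 : √2 * (t / √2) = t := by field_simp
  have e2 : (t / √2) ^ 2 = t ^ 2 / 2 := by rw [div_pow, Real.sq_sqrt (by norm_num)]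
  have e3 : (2 ^ k * (k.factorial : ℝ) * √Real.pi) ^ (-(1 / 2) : ℝ) =
      2 ^ (-((k : ℝ) / 2)) * ((k.factorial : ℝ) * √Real.pi) ^ (-(1 / 2) : ℝ) := by
    rw [mul_assoc, Real.mul_rpow (by positivity) (by positivity), ← Real.rpow_natCast,
      ← Real.rpow_mul (by norm_num)]
    congr 2
    ring
  have e4 : (2 : ℝ) ^ (-((k : ℝ) / 2)) * 2 ^ ((k : ℝ) / 2) = 1 := by
    rw [← Real.rpow_add (by norm_num)]; simp
  have e5 : -(1 / 2) * (t ^ 2 / 2) = -(1 / 4) * t ^ 2 := by ring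
  rw [hermiteFun, e1, e2, e3, e5, eval_hermiteR]
  linear_combination ((k.factorial : ℝ) * √Real.pi) ^ (-(1 / 2) : ℝ) *
      (Real.exp (-(1 / 4) * t ^ 2) * (aeval t) (hermite k)) * e4

/-- The constant is `1/2` from the substitution `2t ↦ t`, times `√(2π)/√π` from the norm of `He_j`.
-/
theorem integral_hermiteFun_mul (j k : ℕ) :
    ∫ t : ℝ, hermiteFun j (2 * t / √2) * hermiteFun k (2 * t / √2) =
      if j = k then (√2)⁻¹ else 0 := by
  rw [Measure.integral_comp_mul_left (fun t => hermiteFun j (t / √2) * hermiteFun k (t / √2))]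
  have h : ∀ t : ℝ, hermiteFun j (t / √2) * hermiteFun k (t / √2) =
      ((j.factorial : ℝ) * √Real.pi) ^ (-(1 / 2) : ℝ) *
      ((k.factorial : ℝ) * √Real.pi) ^ (-(1 / 2) : ℝ) *
      ((hermiteR j).eval t * (hermiteR k).eval t * Real.exp (-(1 / 2) * t ^ 2)) := by
    intro t
    have : Real.exp (-(1 / 2) * t ^ 2) =
        Real.exp (-(1 / 4) * t ^ 2) * Real.exp (-(1 / 4) * t ^ 2) := by
      rw [← Real.exp_add]; congr 1; ring
    rw [hermiteFun_div_sqrt, hermiteFun_div_sqrt, this]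
    ring
  simp only [h]
  rw [integral_const_mul, integral_hermiteR_mul_hermiteR]
  split_ifs with hjk
  · subst hjk
    rw [← Real.rpow_add (by positivity)]
    have : (-(1 / 2) + -(1 / 2) : ℝ) = -1 := by norm_num
    rw [this, Real.rpow_neg_one, Real.sqrt_mul (by norm_num)]
    have h2 : √2 * √2 = (2 : ℝ) := Real.mul_self_sqrt (by norm_num)
    have hpi : √Real.pi ≠ 0 := by positivity
    have hf : (j.factorial : ℝ) ≠ 0 := by positivity
    have h20 : √2 ≠ (0 : ℝ) := by positivity
    rw [abs_of_pos (by norm_num)]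
    simp only [smul_eq_mul]
    field_simp
    linarith
  · simp

end Hermite

/-! ### Orthonormality of the functions `q_{k,0}` -/

theorem qFun_zero_right {n : ℕ} (k : Fin n → ℕ) (v : RealSpace n) :
    qFun k 0 v = ((2 ^ ((n : ℝ) / 2) * Real.pi ^ ((n : ℝ) / 4) *
      ∏ r, hermiteFun (k r) (2 * v r / √2) : ℝ) : ℂ) := by
  simp [qFun]

theorem integral_prod_coord {n : ℕ} {𝕜 : Type*} [RCLike 𝕜] (f : Fin n → ℝ → 𝕜) :
    ∫ v : RealSpace n, ∏ r, f r (v r) = ∏ r, ∫ t, f r t := by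
  rw [← integral_fintype_prod_eq_prod (μ := fun _ => volume), ← volume_pi]
  exact (EuclideanSpace.volume_preserving_symm_measurableEquiv_toLp (Fin n)).integral_comp'
    (fun x : Fin n → ℝ => ∏ r, f r (x r))

theorem integrable_prod_coord {n : ℕ} {𝕜 : Type*} [RCLike 𝕜] {f : Fin n → ℝ → 𝕜}
    (hf : ∀ r, Integrable (f r)) : Integrable fun v : RealSpace n => ∏ r, f r (v r) :=
  (PiLp.volume_preserving_ofLp (Fin n)).integrable_comp_of_integrable
    (Integrable.fintype_prod (μ := fun _ : Fin n => (volume : Measure ℝ)) hf)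

/-- The integral factors over the coordinates. The prefactor of `q` is the one for which the
constants balance: `(2π)^{-n/2} · 2ⁿ π^{n/2} · (√2)^{-n} = 1`. -/
theorem inner_q_zero {n : ℕ} (k l : Fin n → ℕ) :
    inner ℂ (q k 0) (q l 0) = if k = l then (1 : ℂ) else 0 := by
  have h1 : inner ℂ (q k 0) (q l 0) = ∫ v, (inner ℂ (qFun k 0 v) (qFun l 0 v) : ℂ) ∂lebesgueT n := by
    rw [L2.inner_def]
    refine integral_congr_ae ?_
    filter_upwards [(memLp_qFun k 0).coeFn_toLp, (memLp_qFun l 0).coeFn_toLp] with v e1 e2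
    rw [q, q, e1, e2]
  have h2 : ∀ v : RealSpace n, (inner ℂ (qFun k 0 v) (qFun l 0 v) : ℂ) =
      ((2 ^ (n : ℝ) * Real.pi ^ ((n : ℝ) / 2) * ∏ r, (hermiteFun (k r) (2 * v r / √2) *
        hermiteFun (l r) (2 * v r / √2)) : ℝ) : ℂ) := by
    intro v
    have e1 : (2 : ℝ) ^ (n : ℝ) = 2 ^ ((n : ℝ) / 2) * 2 ^ ((n : ℝ) / 2) := by
      rw [← Real.rpow_add (by norm_num)]; congr 1; ring
    have e2 : Real.pi ^ ((n : ℝ) / 2) = Real.pi ^ ((n : ℝ) / 4) * Real.pi ^ ((n : ℝ) / 4) := by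
      rw [← Real.rpow_add Real.pi_pos]; congr 1; ring
    rw [qFun_zero_right, qFun_zero_right, RCLike.inner_apply, Complex.conj_ofReal,
      ← Complex.ofReal_mul, Finset.prod_mul_distrib, e1, e2]
    congr 1
    ring
  rw [h1, integral_congr_ae (.of_forall h2), integral_lebesgueT, integral_complex_ofReal,
    integral_const_mul, integral_prod_coord (fun r t => hermiteFun (k r) (2 * t / √2) *
      hermiteFun (l r) (2 * t / √2))]
  simp only [integral_hermiteFun_mul]
  split_ifs with hkl
  · subst hkl
    simp only [if_true, Finset.prod_const, Finset.card_univ, Fintype.card_fin]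
    rw [Complex.real_smul, ← Complex.ofReal_mul, ← Complex.ofReal_one]
    congr 1
    have e1 : (2 * Real.pi) ^ (-(n : ℝ) / 2) = 2 ^ (-(n : ℝ) / 2) * (Real.pi ^ ((n : ℝ) / 2))⁻¹ := by
      rw [Real.mul_rpow (by norm_num) Real.pi_pos.le, ← Real.rpow_neg Real.pi_pos.le]
      congr 2
      ring
    have e2 : ((√2)⁻¹ : ℝ) ^ n = 2 ^ (-(n : ℝ) / 2) := by
      rw [Real.sqrt_eq_rpow, ← Real.rpow_neg (by norm_num), ← Real.rpow_mul_natCast (by norm_num)]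
      congr 1
      ring
    have e3 : (2 : ℝ) ^ (-(n : ℝ) / 2) * 2 ^ (n : ℝ) * 2 ^ (-(n : ℝ) / 2) = 1 := by
      rw [← Real.rpow_add (by norm_num), ← Real.rpow_add (by norm_num)]
      convert Real.rpow_zero _
      ring
    have e4 : Real.pi ^ ((n : ℝ) / 2) ≠ 0 := by positivity
    rw [e1, e2, ← e3]
    field_simp
  · obtain ⟨r, hr⟩ := Function.ne_iff.1 hkl
    rw [Finset.prod_eq_zero (Finset.mem_univ r) (if_neg hr)]
    simp

/-! ### Hermite functions: completeness -/

theorem memLp_prod_coord {n : ℕ} {g : Fin n → ℝ → ℂ} (hg : ∀ r, Continuous (g r))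
    (hi : ∀ r, Integrable fun t => ‖g r t‖ ^ 2) :
    MemLp (fun v : RealSpace n => ∏ r, g r (v r)) 2 (lebesgueT n) := by
  have hc : Continuous fun v : RealSpace n => ∏ r, g r (v r) := by fun_prop
  rw [memLp_two_iff_integrable_sq_norm hc.aestronglyMeasurable, integrable_lebesgueT]
  simpa [Finset.prod_pow] using integrable_prod_coord hi

theorem integrable_norm_eval_sq_exp (p : Polynomial ℂ) :
    Integrable fun t : ℝ => ‖(Real.exp (-t ^ 2) : ℂ) * p.eval (2 * t : ℂ)‖ ^ 2 := by
  have key : ∀ p : Polynomial ℂ, MemLp (fun t : ℝ => (Real.exp (-t ^ 2) : ℂ) *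
      p.eval (2 * t : ℂ)) 2 := by
    intro p
    induction p using Polynomial.induction_on' with
    | add p q hp hq =>
      simp only [Polynomial.eval_add, mul_add]
      exact hp.add hq
    | monomial j c =>
      have hc : Continuous fun t : ℝ => (Real.exp (-t ^ 2) : ℂ) *
        (Polynomial.monomial j c).eval (2 * t : ℂ) := by fun_prop
      rw [memLp_two_iff_integrable_sq_norm hc.aestronglyMeasurable]
      refine (integrable_eval_mul_exp (Polynomial.C (‖c‖ ^ 2 * 4 ^ j) * Polynomial.X ^ (2 * j))
        (b := 2) (by norm_num)).congr (.of_forall fun t => ?_)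
      have : Real.exp (-2 * t ^ 2) = Real.exp (-t ^ 2) ^ 2 := by
        rw [← Real.exp_nat_mul]; congr 1; push_cast; ring
      simp only [Polynomial.eval_mul, Polynomial.eval_C, Polynomial.eval_pow, Polynomial.eval_X,
        Polynomial.eval_monomial, norm_mul, norm_pow, Complex.norm_real, Real.norm_eq_abs,
        Real.abs_exp, this, mul_pow, Complex.norm_two]
      rw [pow_mul, ← sq_abs t, ← pow_mul 2 j 2, mul_comm j 2, pow_mul 2 2 j]
      ring
  exact (key p).norm.integrable_sq

/-- This function will dominate `e^{-t²}` times the partial sums of the series of `e^{-ist}`. Since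
`2|st| ≤ s² + t²`, its square is at most `e^{s²} e^{-t²}`. -/
theorem integrable_exp_abs_sq (s : ℝ) :
    Integrable fun t : ℝ => ‖((Real.exp (-t ^ 2) * Real.exp |s * t| : ℝ) : ℂ)‖ ^ 2 := by
  refine ((integrable_exp_neg_mul_sq (b := 1) one_pos).const_mul (Real.exp (s ^ 2))).mono'
    (by fun_prop) (.of_forall fun t => ?_)
  rw [norm_pow, norm_norm, Complex.norm_real, ← Real.exp_add, Real.norm_eq_abs, Real.abs_exp,
    ← Real.exp_nat_mul, ← Real.exp_add, Real.exp_le_exp, abs_mul]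
  push_cast
  nlinarith [sq_nonneg (|s| - |t|), sq_abs s, sq_abs t]

/-- The monic Hermite polynomials as a basis of `ℂ[X]`. -/
def hermiteBasis : Module.Basis ℕ ℂ (Polynomial ℂ) :=
  Polynomial.Sequence.basis
    ⟨fun k => (Polynomial.hermite k).map (Int.castRingHom ℂ), fun k => by
      rw [Polynomial.degree_map_eq_of_injective (RingHom.injective_int _),
        Polynomial.degree_hermite]⟩
    fun k => by
      change IsUnit ((Polynomial.hermite k).map (Int.castRingHom ℂ)).leadingCoeff
      rw [((Polynomial.hermite_monic k).map _).leadingCoeff]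
      exact isUnit_one

theorem hermiteBasis_apply (k : ℕ) :
    hermiteBasis k = (Polynomial.hermite k).map (Int.castRingHom ℂ) :=
  Polynomial.Sequence.basis_eq_self _ _ k

theorem eval_hermiteBasis (k : ℕ) (t : ℝ) :
    (hermiteBasis k).eval (t : ℂ) = (((hermiteR k).eval t : ℝ) : ℂ) := by
  rw [hermiteBasis_apply, hermiteR, Polynomial.eval_map, Polynomial.eval_map]
  have := Polynomial.hom_eval₂ (Polynomial.hermite k) (Int.castRingHom ℝ) Complex.ofRealHom t
  simp only [Complex.ofRealHom_eq_coe] at this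
  rw [this]
  congr 1

theorem integrable_mul_prod_coord {n : ℕ} (u : Lp ℂ 2 (lebesgueT n)) {g : Fin n → ℝ → ℂ}
    (hg : ∀ r, Continuous (g r)) (hi : ∀ r, Integrable fun t => ‖g r t‖ ^ 2) :
    Integrable (fun v => u v * ∏ r, g r (v r)) (lebesgueT n) :=
  (Lp.memLp u).integrable_mul (memLp_prod_coord hg hi)

/-- A polynomial in `2t` times the Gaussian `e^{-t²}`. -/
def polyGauss (p : Polynomial ℂ) (t : ℝ) : ℂ := (Real.exp (-t ^ 2) : ℂ) * p.eval (2 * t : ℂ)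

theorem continuous_polyGauss (p : Polynomial ℂ) : Continuous (polyGauss p) := by
  unfold polyGauss; fun_prop

theorem integrable_mul_prod_polyGauss {n : ℕ} (u : Lp ℂ 2 (lebesgueT n))
    (p : Fin n → Polynomial ℂ) :
    Integrable (fun v => u v * ∏ r, polyGauss (p r) (v r)) (lebesgueT n) :=
  integrable_mul_prod_coord u (fun r => continuous_polyGauss (p r))
    fun r => integrable_norm_eval_sq_exp (p r)

theorem prod_polyGauss_update {n : ℕ} [DecidableEq (Fin n)] (p : Fin n → Polynomial ℂ) (i : Fin n) (x : Polynomial ℂ)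
    (v : RealSpace n) : ∏ r, polyGauss (Function.update p i x r) (v r) =
      polyGauss x (v i) * ∏ r ∈ Finset.univ.erase i, polyGauss (p r) (v r) := by
  rw [← Finset.mul_prod_erase _ _ (Finset.mem_univ i), Function.update_self]
  congr 1
  refine Finset.prod_congr rfl fun r hr => ?_
  rw [Function.update_of_ne (Finset.ne_of_mem_erase hr)]

/-- The pairing of a square integrable function with products of polynomials times a Gaussian. -/
def polyPairing {n : ℕ} (u : Lp ℂ 2 (lebesgueT n)) :
    MultilinearMap ℂ (fun _ : Fin n => Polynomial ℂ) ℂ where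
  toFun p := ∫ v, u v * ∏ r, polyGauss (p r) (v r) ∂lebesgueT n
  map_update_add' := by
    intro _ p i x y
    rw [← integral_add (integrable_mul_prod_polyGauss _ _)
      (integrable_mul_prod_polyGauss _ _)]
    congr 1
    funext v
    simp only [prod_polyGauss_update]
    simp only [polyGauss, Polynomial.eval_add]
    ring
  map_update_smul' := by
    intro _ p i c x
    rw [smul_eq_mul, ← integral_const_mul]
    congr 1
    funext v
    simp only [prod_polyGauss_update]
    simp only [polyGauss, Polynomial.eval_smul, smul_eq_mul]
    ring

theorem polyPairing_apply {n : ℕ} (u : Lp ℂ 2 (lebesgueT n)) (p : Fin n → Polynomial ℂ) :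
    polyPairing u p = ∫ v, u v * ∏ r, polyGauss (p r) (v r) ∂lebesgueT n := rfl

theorem qFun_zero_eq_prod {n : ℕ} (k : Fin n → ℕ) (v : RealSpace n) :
    qFun k 0 v = ((2 ^ ((n : ℝ) / 2) * Real.pi ^ ((n : ℝ) / 4) *
      ∏ r, (((k r).factorial : ℝ) * √Real.pi) ^ (-(1 / 2) : ℝ) : ℝ) : ℂ) *
      ∏ r, polyGauss (hermiteBasis (k r)) (v r) := by
  have : ∀ r, polyGauss (hermiteBasis (k r)) (v r) =
      ((Real.exp (-(1 / 4) * (2 * v r) ^ 2) * (hermiteR (k r)).eval (2 * v r) : ℝ) : ℂ) := by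
    intro r
    rw [polyGauss, Complex.ofReal_mul, ← eval_hermiteBasis]
    push_cast
    congr 2
    ring
  simp only [this, qFun_zero_right, hermiteFun_div_sqrt]
  rw [Finset.prod_mul_distrib, ← mul_assoc]
  push_cast
  rfl

/-- A multilinear map is determined on tuples of basis vectors, and on Hermite polynomials the
pairing is a nonzero multiple of `⟨q_{k,0}, u⟩`. Thus orthogonality to the `q_{k,0}` becomes
orthogonality to all products of polynomials times the Gaussian. -/
theorem polyPairing_eq_zero {n : ℕ} {u : Lp ℂ 2 (lebesgueT n)}
    (h : ∀ k, inner ℂ (q k 0) u = (0 : ℂ)) : polyPairing u = 0 := by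
  refine Module.Basis.ext_multilinear (fun _ => hermiteBasis) fun k => ?_
  rw [polyPairing_apply, zero_apply]
  have h1 := h k
  set c : ℝ := 2 ^ ((n : ℝ) / 2) * Real.pi ^ ((n : ℝ) / 4) *
    ∏ r, (((k r).factorial : ℝ) * √Real.pi) ^ (-(1 / 2) : ℝ) with hc
  have hc0 : (c : ℂ) ≠ 0 := by
    have : 0 < c := by
      have : 0 < ∏ r, (((k r).factorial : ℝ) * √Real.pi) ^ (-(1 / 2) : ℝ) :=
        Finset.prod_pos fun r _ => by positivity
      positivity
    exact_mod_cast this.ne'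
  have h2 : inner ℂ (q k 0) u =
      (c : ℂ) * ∫ v, u v * ∏ r, polyGauss (hermiteBasis (k r)) (v r) ∂lebesgueT n := by
    rw [L2.inner_def, ← integral_const_mul]
    refine integral_congr_ae ?_
    filter_upwards [(memLp_qFun k 0).coeFn_toLp] with v hv
    have hre : (starRingEnd ℂ) (qFun k 0 v) = qFun k 0 v := by
      rw [qFun, Complex.conj_ofReal]
    rw [q, hv, RCLike.inner_apply, hre, qFun_zero_eq_prod, ← hc]
    ring
  rw [h2] at h1
  exact (mul_eq_zero.1 h1).resolve_left hc0

/-- The partial sums of the exponential series of `-ist`, as polynomials in `2t`. -/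
def expPoly (s : ℝ) (N : ℕ) : Polynomial ℂ := ∑ j ∈ Finset.range N,
  Polynomial.C ((-s * Complex.I / 2) ^ j / (j.factorial : ℂ)) * Polynomial.X ^ j

theorem eval_expPoly (s : ℝ) (N : ℕ) (t : ℝ) : (expPoly s N).eval (2 * t : ℂ) =
    ∑ j ∈ Finset.range N, (-(s * t) * Complex.I) ^ j / (j.factorial : ℂ) := by
  simp only [expPoly, Polynomial.eval_finsetSum, Polynomial.eval_mul, Polynomial.eval_C,
    Polynomial.eval_pow, Polynomial.eval_X]
  refine Finset.sum_congr rfl fun j _ => ?_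
  rw [div_mul_eq_mul_div, ← mul_pow]
  congr 2
  ring

theorem norm_polyGauss_expPoly_le (s : ℝ) (N : ℕ) (t : ℝ) : ‖polyGauss (expPoly s N) t‖ ≤
    ‖((Real.exp (-t ^ 2) * Real.exp |s * t| : ℝ) : ℂ)‖ := by
  rw [polyGauss, eval_expPoly, norm_mul, Complex.norm_real, Complex.norm_real, norm_mul]
  refine mul_le_mul_of_nonneg_left ?_ (norm_nonneg _)
  rw [Real.norm_of_nonneg (Real.exp_pos _).le]
  refine (norm_sum_le _ _).trans (le_trans (le_of_eq ?_)
    (Real.sum_le_exp_of_nonneg (abs_nonneg (s * t)) N))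
  refine Finset.sum_congr rfl fun j _ => ?_
  simp [abs_mul]

theorem tendsto_polyGauss_expPoly (s t : ℝ) :
    Filter.Tendsto (fun N => polyGauss (expPoly s N) t) Filter.atTop
      (nhds ((Real.exp (-t ^ 2) : ℂ) * Complex.exp (-(s * t) * Complex.I))) := by
  unfold polyGauss
  refine Filter.Tendsto.const_mul _ ?_
  simp only [eval_expPoly]
  rw [Complex.exp_eq_exp_ℂ]
  exact (NormedSpace.expSeries_div_hasSum_exp _).tendsto_sum_nat

/-- A square integrable function orthogonal to all `q_{k,0}` is zero. -/
theorem eq_zero_of_inner_q_zero {n : ℕ} (u : Lp ℂ 2 (lebesgueT n))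
    (h : ∀ k, inner ℂ (q k 0) u = (0 : ℂ)) : u = 0 := by
  set f : RealSpace n → ℂ := fun v => u v * ∏ r, (Real.exp (-(v r) ^ 2) : ℂ) with hf
  have hfi : Integrable f (lebesgueT n) := by
    simpa [hf, polyGauss] using integrable_mul_prod_polyGauss u fun _ => 1
  -- The function `u e^{-|v|²}` has zero Fourier transform: each factor `e^{-i a_r v_r}` of the
  -- character is the limit of its Taylor polynomials, the pairings with polynomials vanish, and
  -- dominated convergence passes to the limit.
  have hf0 := ae_eq_zero_of_integral_expChar hfi fun a => by
    have hlim := tendsto_integral_of_dominated_convergence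
      (F := fun N v => u v * ∏ r, polyGauss (expPoly (a r) N) (v r))
      (f := fun v => expChar a v • f v) (μ := lebesgueT n)
      (fun v => ‖u v * ∏ r, ((Real.exp (-(v r) ^ 2) * Real.exp |a r * v r| : ℝ) : ℂ)‖)
      (fun N => (integrable_mul_prod_polyGauss u _).aestronglyMeasurable)
      (integrable_mul_prod_coord u
        (g := fun r t => ((Real.exp (-t ^ 2) * Real.exp |a r * t| : ℝ) : ℂ))
        (fun r => by fun_prop) fun r => integrable_exp_abs_sq (a r)).norm
      (fun N => .of_forall fun v => by
        rw [norm_mul, norm_mul, norm_prod, norm_prod]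
        exact mul_le_mul_of_nonneg_left (Finset.prod_le_prod (fun _ _ => norm_nonneg _)
          fun r _ => norm_polyGauss_expPoly_le _ _ _) (norm_nonneg _))
      (.of_forall fun v => by
        have e : expChar a v • f v = u v * ∏ r, ((Real.exp (-(v r) ^ 2) : ℂ) *
            Complex.exp (-(a r * v r) * Complex.I)) := by
          have e1 : expChar a v = ∏ r, Complex.exp (-(a r * v r) * Complex.I) := by
            rw [← Complex.exp_sum, expChar, PiLp.inner_apply, ← Finset.sum_mul]
            simp [mul_comm]
          rw [Finset.prod_mul_distrib, e1, hf, smul_eq_mul]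
          ring
        rw [e]
        exact Filter.Tendsto.const_mul _ (tendsto_finsetProd _ fun r _ =>
          tendsto_polyGauss_expPoly _ _))
    refine tendsto_nhds_unique hlim ?_
    have : ∀ N, ∫ v, u v * ∏ r, polyGauss (expPoly (a r) N) (v r) ∂lebesgueT n = 0 := fun N => by
      rw [← polyPairing_apply u (fun r => expPoly (a r) N), polyPairing_eq_zero h]
      rfl
    simp [this]
  rw [Lp.eq_zero_iff_ae_eq_zero]
  filter_upwards [hf0] with v hv
  refine (mul_eq_zero.1 hv).resolve_right (Finset.prod_ne_zero_iff.2 fun r _ => ?_)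
  exact_mod_cast (Real.exp_pos _).ne'

/-! ### The orthonormal bases of the fibers -/

theorem inner_q {n : ℕ} (k l : Fin n → ℕ) (ξ : RealSpace n) :
    inner ℂ (q k ξ) (q l ξ) = if k = l then (1 : ℂ) else 0 := by
  rw [q_eq k, q_eq l, ← inner_q_zero]
  exact (Lp.compMeasurePreservingₗᵢ ℂ (E := ℂ) (p := 2) _
    (measurePreserving_half ξ)).inner_map_map (q k 0) (q l 0)

/-- Translation by `ξ/2` is invertible and isometric and carries `q_{k,0}` to `q_{k,ξ}`, so
completeness at `0` implies completeness at every `ξ`. -/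
theorem eq_zero_of_inner_q {n : ℕ} (ξ : RealSpace n) (u : Lp ℂ 2 (lebesgueT n))
    (h : ∀ k, inner ℂ (q k ξ) u = (0 : ℂ)) : u = 0 := by
  set τ := Lp.compMeasurePreservingₗᵢ ℂ (E := ℂ) (p := 2) _ (measurePreserving_half ξ) with hτ
  set τ' := Lp.compMeasurePreservingₗᵢ ℂ (E := ℂ) (p := 2) _ (measurePreserving_half (-ξ)) with hτ'
  have hinv : τ (τ' u) = u := by
    refine Lp.ext ?_
    have h1 := Lp.coeFn_compMeasurePreserving (τ' u) (measurePreserving_half ξ)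
    have h2 := (measurePreserving_half ξ).quasiMeasurePreserving.ae_eq_comp
      (Lp.coeFn_compMeasurePreserving u (measurePreserving_half (-ξ)))
    refine h1.trans (h2.trans (.of_forall fun v => ?_))
    simp
  have h0 : τ' u = 0 := eq_zero_of_inner_q_zero _ fun k => by
    rw [← h k, ← τ.inner_map_map, hinv, q_eq k ξ]
    rfl
  rw [← hinv, h0, map_zero]

theorem sum_enum_lt {n m : ℕ} (j : Fin (dim n m)) : ∑ r, enum n m j r < m := by
  rw [← mem_multiIndices]
  exact Finset.orderEmbOfFin_mem (multiIndices n m) rfl j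

theorem exists_enum_eq {n m : ℕ} (k : Fin n → ℕ) (hk : ∑ r, k r < m) : ∃ j, enum n m j = k := by
  rw [← mem_multiIndices] at hk
  have h : toLex k ∈ Set.range ((multiIndices n m).orderEmbOfFin rfl) := by
    rw [Finset.range_orderEmbOfFin]; exact hk
  obtain ⟨j, hj⟩ := h
  exact ⟨j, congrArg ofLex hj⟩

theorem enum_injective (n m : ℕ) : Function.Injective (enum n m) := fun _ _ hij =>
  ((multiIndices n m).orderEmbOfFin rfl).injective (ofLex.injective hij)

theorem coeffs_q_enum {n m : ℕ} (ξ : RealSpace n) (j : Fin (dim n m)) :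
    coeffs n m ξ (q (enum n m j) ξ) = EuclideanSpace.single j 1 := by
  ext i
  rw [coeffs_apply, inner_q]
  simp [(enum_injective n m).eq_iff]

/-- Vectors orthogonal to all `q_{k,ξ}` with `|k| ≥ m` are recovered from their coefficients. -/
theorem norm_coeffs_eq {n m : ℕ} (ξ : RealSpace n) (u : Lp ℂ 2 (lebesgueT n))
    (h : ∀ k : Fin n → ℕ, m ≤ ∑ r, k r → inner ℂ (q k ξ) u = (0 : ℂ)) :
    ‖coeffs n m ξ u‖ = ‖u‖ := by
  -- The difference of the two sides is orthogonal to every `q_{k,ξ}`: for `|k| < m` by the choice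
  -- of the coefficients, for `|k| ≥ m` by hypothesis.
  have hu : u = ∑ j, coeffs n m ξ u j • q (enum n m j) ξ := by
    rw [← sub_eq_zero]
    refine eq_zero_of_inner_q ξ _ fun k => ?_
    rw [inner_sub_right, inner_sum, sub_eq_zero]
    simp only [inner_smul_right, inner_q]
    by_cases hk : ∑ r, k r < m
    · obtain ⟨j, rfl⟩ := exists_enum_eq k hk
      simp [(enum_injective n m).eq_iff, coeffs_apply]
    · rw [h k (not_lt.1 hk), Finset.sum_eq_zero]
      intro j _
      rw [if_neg, mul_zero]
      rintro rfl
      exact hk (sum_enum_lt j)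
  have h1 : (inner ℂ u u : ℂ) = inner ℂ (coeffs n m ξ u) (coeffs n m ξ u) := by
    conv_lhs => rw [hu, sum_inner]
    rw [PiLp.inner_apply]
    refine Finset.sum_congr rfl fun j _ => ?_
    rw [← hu, inner_smul_left, ← coeffs_apply, RCLike.inner_apply, mul_comm]
  rw [inner_self_eq_norm_sq_to_K, inner_self_eq_norm_sq_to_K] at h1
  have h2 : ‖u‖ ^ 2 = ‖coeffs n m ξ u‖ ^ 2 := by exact_mod_cast h1
  exact ((sq_eq_sq₀ (norm_nonneg _) (norm_nonneg _)).1 h2).symm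

end
end PolyFock

namespace PolyFock
noncomputable section

/-! ### The algebra of the Wirtinger derivatives -/

section Wirtinger
variable {n : ℕ}

/-- Symmetry of the second real derivative of a smooth function. -/
theorem dbar_comm (r s : Fin n) {f : ComplexSpace n → ℂ} (hf : ContDiff ℝ (⊤ : ℕ∞) f) :
    dbar r (dbar s f) = dbar s (dbar r f) := by
  have hd : ∀ z, DifferentiableAt ℝ (fderiv ℝ f) z := fun z =>
    (hf.fderiv_right (m := (⊤ : ℕ∞)) (by simp)).differentiable (by simp) z
  have hv : ∀ (v : ComplexSpace n) z, HasFDerivAt (fun z => fderiv ℝ f z v)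
      ((fderiv ℝ (fderiv ℝ f) z).flip v) z := fun v z => by
    have := (hd z).hasFDerivAt.clm_apply (hasFDerivAt_const v z)
    simpa using this
  have hb : ∀ (t : Fin n) z, HasFDerivAt (dbar t f) ((1 / 2 : ℂ) •
      ((fderiv ℝ (fderiv ℝ f) z).flip (EuclideanSpace.single t 1) +
        Complex.I • (fderiv ℝ (fderiv ℝ f) z).flip (EuclideanSpace.single t Complex.I))) z :=
    fun t z => ((hv _ z).add ((hv _ z).const_mul _)).const_mul _
  have hsymm : ∀ z v w, fderiv ℝ (fderiv ℝ f) z v w = fderiv ℝ (fderiv ℝ f) z w v := fun z v w =>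
    (hf.contDiffAt.isSymmSndFDerivAt (by
      rw [minSmoothness_of_isRCLikeNormedField]; exact WithTop.coe_le_coe.2 (le_top : (2 : ℕ∞) ≤ ⊤))).eq v w
  funext z
  conv_lhs => unfold dbar
  conv_rhs => unfold dbar
  change (1 / 2 : ℂ) * (fderiv ℝ (dbar s f) z _ + Complex.I * fderiv ℝ (dbar s f) z _) =
    (1 / 2 : ℂ) * (fderiv ℝ (dbar r f) z _ + Complex.I * fderiv ℝ (dbar r f) z _)
  rw [(hb s z).fderiv, (hb r z).fderiv]
  simp only [smul_apply, add_apply, ContinuousLinearMap.flip_apply, smul_eq_mul]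
  rw [hsymm z (EuclideanSpace.single s 1) (EuclideanSpace.single r 1),
    hsymm z (EuclideanSpace.single s Complex.I) (EuclideanSpace.single r 1),
    hsymm z (EuclideanSpace.single s 1) (EuclideanSpace.single r Complex.I),
    hsymm z (EuclideanSpace.single s Complex.I) (EuclideanSpace.single r Complex.I)]
  ring

theorem contDiff_dbar_iterate (r : Fin n) (j : ℕ) {f : ComplexSpace n → ℂ}
    (hf : ContDiff ℝ (⊤ : ℕ∞) f) : ContDiff ℝ (⊤ : ℕ∞) ((dbar r)^[j] f) := by
  induction j with
  | zero => exact hf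
  | succ j ih => rw [Function.iterate_succ_apply']; exact contDiff_dbar r ih

theorem dbar_iterate_comm (r s : Fin n) (j : ℕ) {f : ComplexSpace n → ℂ}
    (hf : ContDiff ℝ (⊤ : ℕ∞) f) : (dbar s)^[j] (dbar r f) = dbar r ((dbar s)^[j] f) := by
  induction j with
  | zero => rfl
  | succ j ih =>
    rw [Function.iterate_succ_apply', ih, dbar_comm s r (contDiff_dbar_iterate s j hf),
      Function.iterate_succ_apply']

theorem contDiff_foldr_dbar (k : Fin n → ℕ) (l : List (Fin n)) {f : ComplexSpace n → ℂ}
    (hf : ContDiff ℝ (⊤ : ℕ∞) f) :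
    ContDiff ℝ (⊤ : ℕ∞) (l.foldr (fun r g => (dbar r)^[k r] g) f) := by
  induction l with
  | nil => exact hf
  | cons r l ih => exact contDiff_dbar_iterate r (k r) ih

theorem contDiff_dbarPow (k : Fin n → ℕ) {f : ComplexSpace n → ℂ}
    (hf : ContDiff ℝ (⊤ : ℕ∞) f) : ContDiff ℝ (⊤ : ℕ∞) (dbarPow k f) :=
  contDiff_foldr_dbar k _ hf

theorem dbarPow_zero (f : ComplexSpace n → ℂ) : dbarPow 0 f = f := by
  unfold dbarPow
  induction List.finRange n with
  | nil => rfl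
  | cons r l ih => simp

/-- `dbarPow` composes the derivatives in the fixed order of the coordinates. The extra `∂/∂z̄_r` is
moved through this composition to the slot of `r`, which occurs exactly once. -/
theorem dbar_dbarPow (r : Fin n) (k : Fin n → ℕ) {f : ComplexSpace n → ℂ}
    (hf : ContDiff ℝ (⊤ : ℕ∞) f) : dbar r (dbarPow k f) = dbarPow (k + Pi.single r 1) f := by
  have key : ∀ l : List (Fin n), l.Nodup →
      l.foldr (fun s g => (dbar s)^[(k + Pi.single r 1 : Fin n → ℕ) s] g) f =
        if r ∈ l then dbar r (l.foldr (fun s g => (dbar s)^[k s] g) f)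
        else l.foldr (fun s g => (dbar s)^[k s] g) f := by
    intro l hl
    induction l with
    | nil => simp
    | cons s l ih =>
      rw [List.nodup_cons] at hl
      simp only [List.foldr_cons]
      rw [ih hl.2]
      by_cases hsr : s = r
      · subst hsr
        rw [if_neg hl.1, if_pos List.mem_cons_self]
        simp [Function.iterate_succ_apply']
      · have hk : (k + Pi.single r 1 : Fin n → ℕ) s = k s := by simp [hsr]
        rw [hk]
        by_cases hrl : r ∈ l
        · rw [if_pos hrl, if_pos (List.mem_cons_of_mem _ hrl),
            dbar_iterate_comm r s _ (contDiff_foldr_dbar k l hf)]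
        · rw [if_neg hrl, if_neg]
          rw [List.mem_cons]
          tauto
  rw [dbarPow, dbarPow, key _ (List.nodup_finRange n), if_pos (List.mem_finRange r)]

theorem dbarPow_dbar (r : Fin n) (k : Fin n → ℕ) {f : ComplexSpace n → ℂ}
    (hf : ContDiff ℝ (⊤ : ℕ∞) f) : dbarPow k (dbar r f) = dbarPow (k + Pi.single r 1) f := by
  rw [dbarPow_comm (dbar r) (fun s f hf => dbar_comm s r hf) k hf, dbar_dbarPow r k hf]

theorem dbar_mul (r : Fin n) {f g : ComplexSpace n → ℂ} (hf : ContDiff ℝ (⊤ : ℕ∞) f)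
    (hg : ContDiff ℝ (⊤ : ℕ∞) g) :
    dbar r (fun z => f z * g z) = fun z => f z * dbar r g z + dbar r f z * g z := by
  funext z
  have h : HasFDerivAt (fun z => f z * g z) _ z :=
    ((hf.differentiable (by simp) z).hasFDerivAt).mul ((hg.differentiable (by simp) z).hasFDerivAt)
  simp only [dbar]
  rw [h.fderiv]
  simp only [add_apply, smul_apply, smul_eq_mul]
  ring

theorem dbar_const_mul (r : Fin n) (c : ℂ) {f : ComplexSpace n → ℂ}
    (hf : ContDiff ℝ (⊤ : ℕ∞) f) : dbar r (fun z => c * f z) = fun z => c * dbar r f z := by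
  funext z
  simp only [dbar]
  rw [fderiv_const_mul (hf.differentiable (by simp) z)]
  simp only [smul_apply, smul_eq_mul]
  ring

theorem dbarPow_const_mul (k : Fin n → ℕ) (c : ℂ) {f : ComplexSpace n → ℂ}
    (hf : ContDiff ℝ (⊤ : ℕ∞) f) : dbarPow k (fun z => c * f z) = fun z => c * dbarPow k f z :=
  dbarPow_comm (fun f z => c * f z) (fun r _ hf => dbar_const_mul r c hf) k hf

theorem dbarPow_const_zero (k : Fin n → ℕ) : dbarPow k (fun _ : ComplexSpace n => (0 : ℂ)) =
    fun _ => 0 := by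
  simpa using dbarPow_const_mul k 0 (f := fun _ : ComplexSpace n => (0 : ℂ)) contDiff_const

theorem dbarPow_sum {ι : Type*} (S : Finset ι) (k : Fin n → ℕ) {f : ι → ComplexSpace n → ℂ}
    (hf : ∀ i, ContDiff ℝ (⊤ : ℕ∞) (f i)) :
    dbarPow k (∑ i ∈ S, f i) = ∑ i ∈ S, dbarPow k (f i) := by
  classical
  induction S using Finset.induction_on with
  | empty => simpa using! dbarPow_const_zero k
  | insert i S hi ih =>
    have : ContDiff ℝ (⊤ : ℕ∞) (∑ i ∈ S, f i) := by
      rw [show (∑ i ∈ S, f i) = fun z => ∑ i ∈ S, f i z by ext; simp]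
      exact ContDiff.sum fun i _ => hf i
    rw [Finset.sum_insert hi, Finset.sum_insert hi, dbarPow_add k (hf i) this, ih]

/-- The monomial `z̄^j`. -/
def conjMon (j : Fin n → ℕ) (z : ComplexSpace n) : ℂ := ∏ s, (starRingEnd ℂ) (z s) ^ j s

theorem contDiff_conj_coord (s : Fin n) :
    ContDiff ℝ (⊤ : ℕ∞) fun z : ComplexSpace n => (starRingEnd ℂ) (z s) :=
  (Complex.conjCLE.toContinuousLinearMap ∘L
    (EuclideanSpace.proj (𝕜 := ℂ) s).restrictScalars ℝ : ComplexSpace n →L[ℝ] ℂ).contDiff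

theorem contDiff_conjMon (j : Fin n → ℕ) : ContDiff ℝ (⊤ : ℕ∞) (conjMon j) :=
  contDiff_prod fun s _ => (contDiff_conj_coord s).pow _

theorem dbar_conj_coord (r s : Fin n) :
    dbar r (fun z : ComplexSpace n => (starRingEnd ℂ) (z s)) =
      fun _ => if s = r then 1 else 0 := by
  funext z
  have h : HasFDerivAt (fun z : ComplexSpace n => (starRingEnd ℂ) (z s))
      (Complex.conjCLE.toContinuousLinearMap ∘L
        (EuclideanSpace.proj (𝕜 := ℂ) s).restrictScalars ℝ : ComplexSpace n →L[ℝ] ℂ) z :=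
    (Complex.conjCLE.toContinuousLinearMap ∘L
      (EuclideanSpace.proj (𝕜 := ℂ) s).restrictScalars ℝ : ComplexSpace n →L[ℝ] ℂ).hasFDerivAt
  rw [dbar, h.fderiv]
  by_cases hs : s = r
  · subst hs; simp; norm_num
  · simp [hs]

theorem dbar_conj_coord_pow (r s : Fin n) (p : ℕ) :
    dbar r (fun z : ComplexSpace n => (starRingEnd ℂ) (z s) ^ p) =
      fun z => if s = r then p * (starRingEnd ℂ) (z s) ^ (p - 1) else 0 := by
  induction p with
  | zero =>
    funext z
    simp [dbar]
  | succ p ih =>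
    simp only [pow_succ]
    rw [dbar_mul r ((contDiff_conj_coord s).pow p) (contDiff_conj_coord s), ih, dbar_conj_coord]
    funext z
    split_ifs with h
    · cases p with
      | zero => simp
      | succ p => simp; ring
    · simp

theorem dbar_prod_eq_zero (r : Fin n) (S : Finset (Fin n)) {g : Fin n → ComplexSpace n → ℂ}
    (hg : ∀ s, ContDiff ℝ (⊤ : ℕ∞) (g s)) (h0 : ∀ s ∈ S, dbar r (g s) = 0) :
    dbar r (fun z => ∏ s ∈ S, g s z) = 0 := by
  induction S using Finset.induction_on with
  | empty => funext z; simp [dbar]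
  | insert i S hi ih =>
    simp only [Finset.prod_insert hi]
    rw [dbar_mul r (hg i) (contDiff_prod fun s _ => hg s),
      ih fun s hs => h0 s (Finset.mem_insert_of_mem hs), h0 i (Finset.mem_insert_self i S)]
    funext z
    simp

theorem dbar_conjMon (r : Fin n) (j : Fin n → ℕ) :
    dbar r (conjMon j) = fun z => j r * conjMon (j - Pi.single r 1) z := by
  have e : ∀ j : Fin n → ℕ, conjMon j = fun z => (starRingEnd ℂ) (z r) ^ j r *
      ∏ s ∈ Finset.univ.erase r, (starRingEnd ℂ) (z s) ^ j s := fun j => by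
    funext z
    rw [conjMon, Finset.mul_prod_erase _ (fun s => (starRingEnd ℂ) (z s) ^ j s)
      (Finset.mem_univ r)]
  rw [e j, dbar_mul r ((contDiff_conj_coord r).pow _)
    (contDiff_prod fun s _ => (contDiff_conj_coord s).pow _), dbar_conj_coord_pow,
    dbar_prod_eq_zero r _ (g := fun s z => (starRingEnd ℂ) (z s) ^ j s)
      (fun s => (contDiff_conj_coord s).pow _)]
  · funext z
    rw [e (j - Pi.single r 1)]
    simp only [if_true, Pi.zero_apply, mul_zero, zero_add, Pi.sub_apply, Pi.single_eq_same,
      ← mul_assoc]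
    congr 1
    refine Finset.prod_congr rfl fun s hs => ?_
    rw [Pi.single_eq_of_ne (Finset.ne_of_mem_erase hs), Nat.sub_zero]
  · intro s hs
    rw [dbar_conj_coord_pow]
    funext z
    exact if_neg (Finset.ne_of_mem_erase hs)

theorem dbar_conjMon_mul (r : Fin n) (j : Fin n → ℕ) {h : ComplexSpace n → ℂ}
    (hh : ContDiff ℝ (⊤ : ℕ∞) h) (hr : dbar r h = 0) :
    dbar r (fun z => conjMon j z * h z) =
      fun z => j r * (conjMon (j - Pi.single r 1) z * h z) := by
  rw [dbar_mul r (contDiff_conjMon j) hh, hr, dbar_conjMon]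
  funext z
  simp
  ring

/-- The factor `h` is annihilated by every `∂/∂z̄_r`, so only `z̄^j` is differentiated, and more
than `j_r` derivatives in `z̄_r` kill it. The induction on `|k|` always spends a derivative in such
a variable `r`, which keeps `j_r < k_r` until `j_r = 0`. -/
theorem dbarPow_conjMon_mul_eq_zero {h : ComplexSpace n → ℂ} (hh : ContDiff ℝ (⊤ : ℕ∞) h)
    (hr : ∀ r, dbar r h = 0) (k j : Fin n → ℕ) (hkj : ∃ r, j r < k r) :
    dbarPow k (fun z => conjMon j z * h z) = 0 := by
  induction hN : ∑ r, k r generalizing k j with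
  | zero =>
    obtain ⟨r, hr⟩ := hkj
    have := (Finset.sum_eq_zero_iff.1 hN) r (Finset.mem_univ r)
    omega
  | succ N ih =>
    obtain ⟨r, hrr⟩ := hkj
    have hk : k = (k - Pi.single r 1) + Pi.single r 1 := by
      funext s
      by_cases hs : s = r
      · subst hs; simp; omega
      · simp [hs]
    have hsum : ∑ s, (k - Pi.single r 1 : Fin n → ℕ) s = N := by
      have h1 : ∑ s, k s = ∑ s, (k - Pi.single r 1 : Fin n → ℕ) s + 1 := by
        conv_lhs => rw [hk]
        simp only [Pi.add_apply, Finset.sum_add_distrib, Finset.sum_pi_single']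
        simp
      omega
    rw [hk, ← dbarPow_dbar r _ ((contDiff_conjMon j).mul hh), dbar_conjMon_mul r j hh (hr r),
      dbarPow_const_mul _ _ ((contDiff_conjMon _).mul hh)]
    rcases Nat.eq_zero_or_pos (j r) with h0 | h0
    · funext z; simp [h0]
    · rw [ih _ _ ⟨r, by simp; omega⟩ hsum]
      funext z
      simp

/-- The constant is `j! = ∏ j_r!`; only its nonvanishing and its independence of `h` matter. -/
theorem exists_dbarPow_conjMon_mul_self (j : Fin n → ℕ) :
    ∃ c : ℂ, c ≠ 0 ∧ ∀ h : ComplexSpace n → ℂ, ContDiff ℝ (⊤ : ℕ∞) h → (∀ r, dbar r h = 0) →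
      dbarPow j (fun z => conjMon j z * h z) = fun z => c * h z := by
  induction hN : ∑ r, j r generalizing j with
  | zero =>
    have h0 : j = 0 := funext fun r => (Finset.sum_eq_zero_iff.1 hN) r (Finset.mem_univ r)
    subst h0
    refine ⟨1, one_ne_zero, fun h _ _ => ?_⟩
    rw [dbarPow_zero]
    funext z
    simp [conjMon]
  | succ N ih =>
    obtain ⟨r, -, hrr⟩ := Finset.exists_ne_zero_of_sum_ne_zero (hN.trans_ne (Nat.succ_ne_zero N))
    have hk : j = (j - Pi.single r 1) + Pi.single r 1 := by
      funext s
      by_cases hs : s = r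
      · subst hs; simp; omega
      · simp [hs]
    have hsum : ∑ s, (j - Pi.single r 1 : Fin n → ℕ) s = N := by
      have h1 : ∑ s, j s = ∑ s, (j - Pi.single r 1 : Fin n → ℕ) s + 1 := by
        conv_lhs => rw [hk]
        simp only [Pi.add_apply, Finset.sum_add_distrib, Finset.sum_pi_single']
        simp
      omega
    obtain ⟨c, hc, hcc⟩ := ih _ hsum
    refine ⟨j r * c, mul_ne_zero (Nat.cast_ne_zero.2 hrr) hc, fun h hh hr => ?_⟩
    have h1 := dbarPow_dbar r (j - Pi.single r 1) ((contDiff_conjMon j).mul hh)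
    rw [← hk, dbar_conjMon_mul r j hh (hr r), dbarPow_const_mul _ _ ((contDiff_conjMon _).mul hh),
      hcc h hh hr] at h1
    rw [← h1]
    funext z
    ring

theorem isPolyanalytic_conjMon_mul {m : ℕ} {h : ComplexSpace n → ℂ}
    (hh : ContDiff ℝ (⊤ : ℕ∞) h) (hr : ∀ r, dbar r h = 0) {j : Fin n → ℕ} (hj : ∑ r, j r < m) :
    IsPolyanalytic m fun z => conjMon j z * h z := by
  refine ⟨(contDiff_conjMon j).mul hh, fun k hk => dbarPow_conjMon_mul_eq_zero hh hr k j ?_⟩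
  by_contra! hcon
  have := Finset.sum_le_sum fun r (_ : r ∈ Finset.univ) => hcon r
  omega

/-- The Cauchy–Riemann equations say that the real derivative sends `i e_r` to `i` times the image
of `e_r`, which makes it complex linear. -/
theorem differentiable_of_dbar_eq_zero {h : ComplexSpace n → ℂ} (hh : ContDiff ℝ (⊤ : ℕ∞) h)
    (hr : ∀ r, dbar r h = 0) : Differentiable ℂ h := by
  intro z
  rw [differentiableAt_iff_restrictScalars ℝ (hh.differentiable (by simp) z)]
  refine ⟨∑ r, fderiv ℝ h z (EuclideanSpace.single r 1) • EuclideanSpace.proj (𝕜 := ℂ) r, ?_⟩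
  have hI : ∀ r, fderiv ℝ h z (EuclideanSpace.single r Complex.I) =
      Complex.I * fderiv ℝ h z (EuclideanSpace.single r 1) := by
    intro r
    have h1 := congrFun (hr r) z
    simp only [dbar, Pi.zero_apply] at h1
    linear_combination (-2 * Complex.I) * h1 + fderiv ℝ h z (EuclideanSpace.single r Complex.I) *
      Complex.I_mul_I
  ext v
  have hv : v = ∑ r, ((v r).re • EuclideanSpace.single r (1 : ℂ) +
      (v r).im • EuclideanSpace.single r Complex.I) := by
    ext s
    simp [Pi.single_apply, Finset.sum_add_distrib]
  conv_rhs => rw [hv]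
  simp only [map_sum, map_add, map_smul, hI]
  simp only [ContinuousLinearMap.coe_restrictScalars', FunLike.coe_sum,
    Finset.sum_apply, smul_apply, EuclideanSpace.coe_proj, smul_eq_mul, Complex.real_smul]
  refine Finset.sum_congr rfl fun r _ => ?_
  conv_lhs => rw [← Complex.re_add_im (v r)]
  ring

/-- To prove a property of all `m`-analytic functions, it is enough to consider the products
`z̄^j h` with `h` entire and `|j| < m`. -/
theorem IsPolyanalytic.induction {Q : (ComplexSpace n → ℂ) → Prop} {m : ℕ}
    (h0 : Q 0) (hadd : ∀ f g, Q f → Q g → Q (f + g))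
    (hmul : ∀ (j : Fin n → ℕ) (h : ComplexSpace n → ℂ), ∑ r, j r < m → Differentiable ℂ h →
      Q fun z => conjMon j z * h z)
    {f : ComplexSpace n → ℂ} (hf : IsPolyanalytic m f) : Q f := by
  induction m generalizing f with
  | zero =>
    have := hf.2 0 (by simp)
    rw [dbarPow_zero] at this
    rwa [this]
  | succ m ih =>
    have hd : ∀ j : Fin n → ℕ, ContDiff ℝ (⊤ : ℕ∞) (dbarPow j f) := fun j =>
      contDiff_dbarPow j hf.1
    have hr : ∀ j : Fin n → ℕ, ∑ r, j r = m → ∀ r, dbar r (dbarPow j f) = 0 := fun j hj r => by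
      rw [dbar_dbarPow r j hf.1]
      refine hf.2 _ ?_
      simp [Finset.sum_add_distrib, hj]
    choose c hc hcc using exists_dbarPow_conjMon_mul_self (n := n)
    -- The candidates for the top-order terms of `f`: for `|j| = m` the function `D̄^j f` is entire,
    -- because one more derivative vanishes, and `T j` is normalized so that `D̄^j (T j) = D̄^j f`.
    let T : (Fin n → ℕ) → ComplexSpace n → ℂ := fun j z =>
      conjMon j z * ((c j)⁻¹ * dbarPow j f z)
    have hT : ∀ j, ContDiff ℝ (⊤ : ℕ∞) (T j) := fun j =>
      (contDiff_conjMon j).mul (contDiff_const.mul (hd j))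
    have hTr : ∀ j : Fin n → ℕ, ∑ r, j r = m → ∀ r,
        dbar r (fun z => (c j)⁻¹ * dbarPow j f z) = 0 := fun j hj r => by
      rw [dbar_const_mul r _ (hd j), hr j hj r]
      funext z
      simp
    set S := Finset.piAntidiag (Finset.univ : Finset (Fin n)) m with hS
    have hSm : ∀ j, j ∈ S ↔ ∑ r, j r = m := fun j => by simp [hS, Finset.mem_piAntidiag]
    have hsum : ContDiff ℝ (⊤ : ℕ∞) (∑ j ∈ S, T j) := by
      rw [show (∑ j ∈ S, T j) = fun z => ∑ j ∈ S, T j z by ext; simp]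
      exact ContDiff.sum fun j _ => hT j
    have hsum' : ContDiff ℝ (⊤ : ℕ∞) (fun z => (-1 : ℂ) * (∑ j ∈ S, T j) z) :=
      contDiff_const.mul hsum
    -- For `|k| = |j| = m` and `j ≠ k`, some `k_r` exceeds `j_r`, so `D̄^k (T j) = 0`. Subtracting
    -- all `T j` therefore removes exactly the derivatives of order `m`.
    have hrest : IsPolyanalytic m (f + fun z => (-1 : ℂ) * (∑ j ∈ S, T j) z) := by
      refine ⟨hf.1.add hsum', fun k hk => ?_⟩
      rw [dbarPow_add k hf.1 hsum', dbarPow_const_mul k _ hsum, dbarPow_sum S k hT,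
        Finset.sum_eq_single k]
      · have h1 := hcc k _ (contDiff_const.mul (hd k)) (hTr k hk)
        simp only [T]
        rw [h1]
        funext z
        simp [mul_inv_cancel_left₀ (hc k)]
      · intro j hj hjk
        refine dbarPow_conjMon_mul_eq_zero (contDiff_const.mul (hd j)) (hTr j ((hSm j).1 hj)) k j ?_
        by_contra! hcon
        have := (Finset.sum_eq_sum_iff_of_le fun r _ => hcon r).1 (hk.trans ((hSm j).1 hj).symm)
        exact hjk (funext fun r => (this r (Finset.mem_univ r)).symm)
      · intro hk'
        exact absurd ((hSm k).2 hk) hk'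
    have h1 := ih (fun j h hj => hmul j h (by omega)) hrest
    have h2 : Q (∑ j ∈ S, T j) := by
      refine Finset.sum_induction _ Q hadd h0 fun j hj => ?_
      exact hmul j _ (by rw [(hSm j).1 hj]; omega)
        (differentiable_of_dbar_eq_zero (contDiff_const.mul (hd j)) (hTr j ((hSm j).1 hj)))
    have := hadd _ _ h1 h2
    convert this using 1
    funext z
    simp

end Wirtinger
end
end PolyFock

namespace PolyFock
noncomputable section

/-! ### Averaging over rotations -/

section Rotation
variable {n : ℕ}

/-- Multiplication by a complex number of modulus one, as a real linear isometry. -/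
def rotationₗᵢ (n : ℕ) (c : Circle) : ComplexSpace n ≃ₗᵢ[ℝ] ComplexSpace n where
  toFun z := (c : ℂ) • z
  invFun z := (c⁻¹ : ℂ) • z
  left_inv z := by simp [smul_smul]
  right_inv z := by simp [smul_smul]
  map_add' z w := smul_add _ _ _
  map_smul' t z := smul_comm _ _ _
  norm_map' z := by
    change ‖(c : ℂ) • z‖ = ‖z‖
    rw [norm_smul, Circle.norm_coe, one_mul]

theorem measurePreserving_rotation (c : Circle) :
    MeasurePreserving (fun z : ComplexSpace n => (c : ℂ) • z) volume volume :=
  (rotationₗᵢ n c).measurePreserving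

theorem measurePreserving_rotation_gaussian (α : ℝ) (c : Circle) :
    MeasurePreserving (fun z : ComplexSpace n => (c : ℂ) • z) (gaussian n α) (gaussian n α) := by
  have h := measurePreserving_rotation (n := n) c
  refine ⟨h.measurable, Measure.ext fun s hs => ?_⟩
  rw [Measure.map_apply h.measurable hs, gaussian, withDensity_apply _ (h.measurable hs),
    withDensity_apply _ hs, ← h.setLIntegral_comp_preimage hs (by fun_prop)]
  simp only [norm_smul, Circle.norm_coe, one_mul]

/-- An integrable function whose averages over circles `{e^{iθ} z}` vanish has integral zero, for
every measure invariant under these rotations. -/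
theorem integral_eq_zero_of_circleAverage {μ : Measure (ComplexSpace n)} [SFinite μ]
    (hμ : ∀ c : Circle, MeasurePreserving (fun z : ComplexSpace n => (c : ℂ) • z) μ μ)
    {u : ComplexSpace n → ℂ} (hu : Integrable u μ)
    (h : ∀ z, Real.circleAverage (fun w => u (w • z)) 0 1 = 0) : ∫ z, u z ∂μ = 0 := by
  have hpi : (0 : ℝ) < 2 * Real.pi := by positivity
  set ν : Measure ℝ := volume.restrict (Set.Ioc 0 (2 * Real.pi)) with hν
  -- Fubini's theorem is applied to `u(e^{iθ} z)` on `(0, 2π] × ℂⁿ`. Its integrability comes from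
  -- this measure-preserving skew rotation; integrating first in `z` gives `2π ∫ u`, first in `θ`
  -- gives zero.
  have hskew : MeasurePreserving (fun p : ℝ × ComplexSpace n =>
      (p.1, (Circle.exp p.1 : ℂ) • p.2)) (ν.prod μ) (ν.prod μ) :=
    (MeasurePreserving.id ν).skew_product (g := fun θ z => (Circle.exp θ : ℂ) • z)
      (by unfold Function.uncurry; fun_prop) (.of_forall fun θ => (hμ (Circle.exp θ)).map_eq)
  have hint : Integrable (fun p : ℝ × ComplexSpace n => u ((Circle.exp p.1 : ℂ) • p.2))
      (ν.prod μ) :=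
    hskew.integrable_comp_of_integrable (hu.comp_snd ν)
  have h1 : ∫ θ, ∫ z, u ((Circle.exp θ : ℂ) • z) ∂μ ∂ν =
      ∫ z, ∫ θ, u ((Circle.exp θ : ℂ) • z) ∂ν ∂μ := integral_integral_swap hint
  have h2 : ∀ θ : ℝ, ∫ z, u ((Circle.exp θ : ℂ) • z) ∂μ = ∫ z, u z ∂μ := fun θ => by
    have := (hμ (Circle.exp θ)).map_eq
    conv_rhs => rw [← this]
    rw [integral_map (hμ _).aemeasurable]
    rw [this]; exact hu.aestronglyMeasurable
  have h3 : ∀ z, ∫ θ, u ((Circle.exp θ : ℂ) • z) ∂ν = 0 := fun z => by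
    have h4 := h z
    rw [Real.circleAverage_def, smul_eq_zero_iff_right (by positivity),
      intervalIntegral.integral_of_le hpi.le] at h4
    simpa [circleMap, Circle.coe_exp] using h4
  simp only [h2, h3, integral_zero, integral_const, smul_eq_zero] at h1
  refine h1.resolve_left ?_
  simp [hν, Measure.real, Real.pi_pos.le, Real.pi_pos.ne']

/-- The mean value property in the single variable `w`. The factor `0 ^ p` is `1` for `p = 0` and
`0` otherwise, so both cases needed later are covered. -/
theorem circleAverage_smul_of_differentiable {h : ComplexSpace n → ℂ} (hh : Differentiable ℂ h)
    (x z : ComplexSpace n) (p : ℕ) :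
    Real.circleAverage (fun w => w ^ p * h (x + w • z)) 0 1 = 0 ^ p * h x := by
  have hd : Differentiable ℂ fun w : ℂ => w ^ p * h (x + w • z) :=
    (differentiable_id.pow p).mul (hh.comp
      ((differentiable_const x).add (differentiable_id.smul_const z)))
  have := (hd.diffContOnCl (s := Metric.ball 0 |(1 : ℝ)|)).circleAverage
  simpa using this

theorem conjMon_smul_of_norm_eq_one (j : Fin n → ℕ) {w : ℂ} (hw : ‖w‖ = 1) (z : ComplexSpace n) :
    w ^ (∑ r, j r) * conjMon j (w • z) = conjMon j z := by
  have h1 : w * (starRingEnd ℂ) w = 1 := by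
    rw [Complex.mul_conj, Complex.normSq_eq_norm_sq, hw]; simp
  rw [conjMon, conjMon, ← Finset.prod_pow_eq_pow_sum, ← Finset.prod_mul_distrib]
  refine Finset.prod_congr rfl fun s _ => ?_
  rw [PiLp.smul_apply, smul_eq_mul, map_mul, ← mul_pow, ← mul_assoc, h1, one_mul]

/-- It suffices to treat `z̄^j h` with `h` entire and `|j| < m`. On the unit circle `w̄ = w⁻¹`, so
the average becomes that of `w^{l-|j|} h(wz)` times a constant; as `l > |j|`, the mean value
property gives zero. -/
theorem IsPolyanalytic.circleAverage_eq_zero {m : ℕ} {f : ComplexSpace n → ℂ}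
    (hf : IsPolyanalytic m f) (z : ComplexSpace n) {l : ℕ} (hl : m ≤ l) :
    Real.circleAverage (fun w => w ^ l * f (w • z)) 0 1 = 0 := by
  have hci : ∀ f : ComplexSpace n → ℂ, Continuous f →
      CircleIntegrable (fun w => w ^ l * f (w • z)) 0 1 := fun f hf =>
    (Continuous.continuousOn (by fun_prop)).circleIntegrable zero_le_one
  refine (hf.induction (Q := fun f => Continuous f ∧
    Real.circleAverage (fun w => w ^ l * f (w • z)) 0 1 = 0) ?_ ?_ ?_).2
  · refine ⟨continuous_const, ?_⟩
    simp [Real.circleAverage_def]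
  · rintro f g ⟨hf, hf0⟩ ⟨hg, hg0⟩
    refine ⟨hf.add hg, ?_⟩
    have := Real.circleAverage_fun_add (hci f hf) (hci g hg)
    simp only [Pi.add_apply, mul_add]
    rw [this, hf0, hg0, add_zero]
  · intro j h hj hh
    refine ⟨(contDiff_conjMon j).continuous.mul hh.continuous, ?_⟩
    have h1 := circleAverage_smul_of_differentiable hh 0 z (l - ∑ r, j r)
    rw [zero_pow (by omega), zero_mul] at h1
    have h2 : Real.circleAverage (fun w => conjMon j z • (w ^ (l - ∑ r, j r) * h (0 + w • z))) 0 1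
        = 0 := by
      rw [Real.circleAverage_fun_smul, h1, smul_zero]
    refine (Real.circleAverage_congr_sphere fun w hw => ?_).trans h2
    have hw1 : ‖w‖ = 1 := by simpa using hw
    simp only [smul_eq_mul, zero_add]
    rw [← conjMon_smul_of_norm_eq_one j hw1 z]
    conv_lhs => rw [← Nat.sub_add_cancel (hj.le.trans hl), pow_add]
    ring

end Rotation

/-! ### The monomials `z̄^k` in the Fock space -/

section Monomials
variable {n : ℕ}

theorem norm_conjMon_le (k : Fin n → ℕ) (z : ComplexSpace n) :
    ‖conjMon k z‖ ≤ ‖z‖ ^ ∑ r, k r := by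
  rw [conjMon, norm_prod, ← Finset.prod_pow_eq_pow_sum]
  refine Finset.prod_le_prod (fun _ _ => norm_nonneg _) fun s _ => ?_
  rw [norm_pow, RCLike.norm_conj]
  exact pow_le_pow_left₀ (norm_nonneg _) (PiLp.norm_apply_le z s) _

/-- Half of the Gaussian absorbs the power through `t^p / p! ≤ e^t` with `t = α|z|²/2`; the other
half is integrable. -/
theorem integrable_norm_pow_mul_exp {α : ℝ} (hα : 0 < α) (p : ℕ) :
    Integrable fun z : ComplexSpace n => (‖z‖ ^ 2) ^ p * Real.exp (-α * ‖z‖ ^ 2) := by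
  have h := (GaussianFourier.integrable_cexp_neg_mul_sq_norm_add (b := (α / 2 : ℝ))
    (by simpa using hα) 0 (0 : ComplexSpace n)).norm.const_mul (p.factorial * (2 / α) ^ p)
  refine h.mono' (by fun_prop) (.of_forall fun z => ?_)
  have h1 := Real.pow_div_factorial_le_exp (α / 2 * ‖z‖ ^ 2) (by positivity) p
  rw [div_le_iff₀ (by positivity)] at h1
  have h2 : ‖Complex.exp (-(α / 2 : ℝ) * (‖z‖ : ℂ) ^ 2 + 0 * (inner ℝ 0 z : ℝ))‖ =
      Real.exp (-(α / 2) * ‖z‖ ^ 2) := by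
    rw [Complex.norm_exp]
    congr 1
    simp [← Complex.ofReal_pow]
  have h3 : Real.exp (-α * ‖z‖ ^ 2) =
      Real.exp (-(α / 2) * ‖z‖ ^ 2) * Real.exp (-(α / 2) * ‖z‖ ^ 2) := by
    rw [← Real.exp_add]; congr 1; ring
  have h4 : Real.exp (α / 2 * ‖z‖ ^ 2) * Real.exp (-(α / 2) * ‖z‖ ^ 2) = 1 := by
    rw [← Real.exp_add]; simp
  rw [h2, Real.norm_of_nonneg (by positivity), h3]
  have h5 : (‖z‖ ^ 2) ^ p = (2 / α) ^ p * (α / 2 * ‖z‖ ^ 2) ^ p := by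
    rw [← mul_pow]; congr 1; field_simp
  rw [h5]
  calc (2 / α) ^ p * (α / 2 * ‖z‖ ^ 2) ^ p *
        (Real.exp (-(α / 2) * ‖z‖ ^ 2) * Real.exp (-(α / 2) * ‖z‖ ^ 2))
      ≤ (2 / α) ^ p * (Real.exp (α / 2 * ‖z‖ ^ 2) * p.factorial) *
        (Real.exp (-(α / 2) * ‖z‖ ^ 2) * Real.exp (-(α / 2) * ‖z‖ ^ 2)) := by gcongr
    _ = p.factorial * (2 / α) ^ p * Real.exp (-(α / 2) * ‖z‖ ^ 2) := by
      linear_combination (p.factorial * (2 / α) ^ p * Real.exp (-(α / 2) * ‖z‖ ^ 2)) * h4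

theorem integrable_gaussian_iff {α : ℝ} (hα : 0 < α) {E : Type*} [NormedAddCommGroup E]
    [NormedSpace ℝ E] {f : ComplexSpace n → E} : Integrable f (gaussian n α) ↔
      Integrable fun z => (α ^ n / Real.pi ^ n * Real.exp (-α * ‖z‖ ^ 2)) • f z := by
  rw [gaussian, integrable_withDensity_iff_integrable_smul' (by fun_prop) (by simp)]
  refine integrable_congr (.of_forall fun z => ?_)
  simp only
  rw [ENNReal.toReal_ofReal (by positivity)]

theorem memLp_conjMon {α : ℝ} (hα : 0 < α) (k : Fin n → ℕ) :
    MemLp (conjMon k) 2 (gaussian n α) := by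
  have hc := (contDiff_conjMon k).continuous
  rw [memLp_two_iff_integrable_sq_norm hc.aestronglyMeasurable, integrable_gaussian_iff hα]
  refine ((integrable_norm_pow_mul_exp hα (∑ r, k r)).const_mul (α ^ n / Real.pi ^ n)).mono'
    (by fun_prop) (.of_forall fun z => ?_)
  have h1 := pow_le_pow_left₀ (norm_nonneg _) (norm_conjMon_le k z) 2
  rw [← pow_mul, mul_comm, pow_mul] at h1
  rw [Real.norm_of_nonneg (by positivity), smul_eq_mul, mul_assoc, mul_comm (Real.exp _)]
  gcongr

/-- `z̄^k` as an element of `L²` of the Gaussian measure. -/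
def monL2 {α : ℝ} (hα : 0 < α) (k : Fin n → ℕ) : Lp ℂ 2 (gaussian n α) :=
  (memLp_conjMon hα k).toLp _

theorem monL2_mem_fock {α : ℝ} (hα : 0 < α) {m : ℕ} {k : Fin n → ℕ} (hk : ∑ r, k r < m) :
    monL2 hα k ∈ fock n m α := by
  refine ⟨fun z => conjMon k z * 1, isPolyanalytic_conjMon_mul contDiff_const
    (fun r => by funext z; simp [dbar]) hk, ?_⟩
  simpa using! (memLp_conjMon hα k).coeFn_toLp

instance (n : ℕ) (α : ℝ) : SFinite (gaussian n α) := by unfold gaussian; infer_instance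

/-- The monomials `z̄^k` with `|k| ≥ m` are orthogonal to the `m`-analytic Fock space. -/
theorem inner_monL2_eq_zero {α : ℝ} (hα : 0 < α) {m : ℕ} {k : Fin n → ℕ} (hk : m ≤ ∑ r, k r)
    {f : Lp ℂ 2 (gaussian n α)} (hf : f ∈ fock n m α) : inner ℂ (monL2 hα k) f = (0 : ℂ) := by
  obtain ⟨g, hg, hfg⟩ := hf
  have h1 : inner ℂ (monL2 hα k) f =
      ∫ z, g z * (starRingEnd ℂ) (conjMon k z) ∂gaussian n α := by
    rw [L2.inner_def]
    refine integral_congr_ae ?_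
    filter_upwards [hfg, (memLp_conjMon hα k).coeFn_toLp] with z e1 e2
    rw [monL2, e1, e2, RCLike.inner_apply]
  rw [h1]
  -- On each circle the conjugate of `z̄ᵏ` contributes the factor `w^{|k|}` with `|k| ≥ m`, which
  -- makes the circle average vanish.
  refine integral_eq_zero_of_circleAverage (measurePreserving_rotation_gaussian α) ?_ fun z => ?_
  · exact ((memLp_congr_ae hfg).1 (Lp.memLp f)).integrable_mul (memLp_conjMon hα k).star
  · have h2 : Real.circleAverage (fun w => (starRingEnd ℂ) (conjMon k z) •
        (w ^ (∑ r, k r) * g (w • z))) 0 1 = 0 := by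
      rw [Real.circleAverage_fun_smul, hg.circleAverage_eq_zero z hk, smul_zero]
    refine (Real.circleAverage_congr_sphere fun w hw => ?_).trans h2
    have hw1 : ‖w‖ = 1 := by simpa using hw
    have h3 : (starRingEnd ℂ) (conjMon k (w • z)) =
        w ^ (∑ r, k r) * (starRingEnd ℂ) (conjMon k z) := by
      simp only [conjMon, map_prod, map_pow, PiLp.smul_apply, smul_eq_mul, map_mul,
        Complex.conj_conj, mul_pow, Finset.prod_mul_distrib, Finset.prod_pow_eq_pow_sum]
    simp only [h3, smul_eq_mul]
    ring

end Monomials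
end
end PolyFock

namespace PolyFock
noncomputable section

/-! ### Convolutions and Wirtinger derivatives -/

section Convolution
variable {n : ℕ}

/-- The convolution of complex functions on `ℂⁿ`. -/
abbrev cconv (f g : ComplexSpace n → ℂ) : ComplexSpace n → ℂ :=
  convolution f g (ContinuousLinearMap.mul ℝ ℂ) volume

theorem cconv_apply (f g : ComplexSpace n → ℂ) (x : ComplexSpace n) :
    cconv f g x = ∫ t, f t * g (x - t) := rfl

theorem hasCompactSupport_dbar (r : Fin n) {g : ComplexSpace n → ℂ} (hg : HasCompactSupport g) :
    HasCompactSupport (dbar r g) :=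
  ((hg.fderiv_apply ℝ _).add (hg.fderiv_apply ℝ _).mul_left).mul_left

theorem dbar_cconv (r : Fin n) {f g : ComplexSpace n → ℂ} (hf : LocallyIntegrable f)
    (hg : ContDiff ℝ (⊤ : ℕ∞) g) (hgc : HasCompactSupport g) :
    dbar r (cconv f g) = cconv f (dbar r g) := by
  funext x
  have h1 := hgc.hasFDerivAt_convolution_right (ContinuousLinearMap.mul ℝ ℂ) hf
    (hg.of_le (by simp)) x
  have hc : Continuous (fderiv ℝ g) := hg.continuous_fderiv (by simp)
  have h2 : ∀ v, fderiv ℝ (cconv f g) x v = ∫ t, f t * fderiv ℝ g (x - t) v := fun v => by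
    rw [h1.fderiv, convolution_precompR_apply _ hf (hgc.fderiv ℝ) hc]
    rfl
  have hi : ∀ v, Integrable fun t => f t * fderiv ℝ g (x - t) v := fun v =>
    (hgc.fderiv_apply ℝ v).convolutionExists_right (ContinuousLinearMap.mul ℝ ℂ) hf
      (by fun_prop) x
  rw [dbar, h2, h2, ← integral_const_mul, ← integral_add (hi _) ((hi _).const_mul _),
    ← integral_const_mul, cconv_apply]
  congr 1
  funext t
  rw [dbar]
  ring

/-- Integration by parts in `t`; its sign cancels the sign from differentiating `g(x - t)` in `t`.
Together with `dbar_cconv` this lets the derivatives of a convolution fall on either factor. -/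
theorem cconv_dbar (r : Fin n) {f g : ComplexSpace n → ℂ} (hf : ContDiff ℝ (⊤ : ℕ∞) f)
    (hg : ContDiff ℝ (⊤ : ℕ∞) g) (hgc : HasCompactSupport g) :
    cconv f (dbar r g) = cconv (dbar r f) g := by
  funext x
  have hgx : ∀ t, HasFDerivAt (fun t => g (x - t)) (-fderiv ℝ g (x - t)) t := fun t => by
    have := ((hg.differentiable (by simp) (x - t)).hasFDerivAt).comp t
      ((hasFDerivAt_id t).const_sub x)
    simpa using! this
  have hfc : Continuous (fderiv ℝ f) := hf.continuous_fderiv (by simp)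
  have hgc' : Continuous (fderiv ℝ g) := hg.continuous_fderiv (by simp)
  have hloc : ∀ u : ComplexSpace n → ℂ, Continuous u → LocallyIntegrable u := fun u hu =>
    hu.locallyIntegrable
  have hi1 : ∀ v, Integrable fun t => fderiv ℝ f t v * g (x - t) := fun v =>
    hgc.convolutionExists_right (ContinuousLinearMap.mul ℝ ℂ) (hloc _ (by fun_prop))
      hg.continuous x
  have hi2 : ∀ v, Integrable fun t => f t * fderiv ℝ g (x - t) v := fun v =>
    (hgc.fderiv_apply ℝ v).convolutionExists_right (ContinuousLinearMap.mul ℝ ℂ)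
      (hloc _ hf.continuous) (by fun_prop) x
  have hi3 : Integrable fun t => f t * g (x - t) :=
    hgc.convolutionExists_right (ContinuousLinearMap.mul ℝ ℂ) (hloc _ hf.continuous)
      hg.continuous x
  have key : ∀ v, ∫ t, f t * fderiv ℝ g (x - t) v = ∫ t, fderiv ℝ f t v * g (x - t) := fun v => by
    have := integral_mul_fderiv_eq_neg_fderiv_mul_of_integrable (μ := volume) (f := f)
      (g := fun t => g (x - t)) (v := v) (hi1 v) (by
        simpa [fun t => (hgx t).fderiv] using (hi2 v).neg) hi3
      (fun t _ => hf.differentiable (by simp) t) (fun t _ => (hgx t).differentiableAt)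
    simp only [fun t => (hgx t).fderiv, neg_apply, mul_neg, integral_neg, neg_inj] at this
    exact this
  have e1 : cconv f (dbar r g) x = (1 / 2 : ℂ) *
      ((∫ t, f t * fderiv ℝ g (x - t) (EuclideanSpace.single r 1)) +
        Complex.I * ∫ t, f t * fderiv ℝ g (x - t) (EuclideanSpace.single r Complex.I)) := by
    rw [cconv_apply, ← integral_const_mul, ← integral_add (hi2 _) ((hi2 _).const_mul _),
      ← integral_const_mul]
    congr 1
    funext t
    rw [dbar]
    ring
  have e2 : cconv (dbar r f) g x = (1 / 2 : ℂ) *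
      ((∫ t, fderiv ℝ f t (EuclideanSpace.single r 1) * g (x - t)) +
        Complex.I * ∫ t, fderiv ℝ f t (EuclideanSpace.single r Complex.I) * g (x - t)) := by
    rw [cconv_apply, ← integral_const_mul, ← integral_add (hi1 _) ((hi1 _).const_mul _),
      ← integral_const_mul]
    congr 1
    funext t
    rw [dbar]
    ring
  rw [e1, e2, key, key]

theorem contDiff_cconv {f g : ComplexSpace n → ℂ} (hf : LocallyIntegrable f)
    (hg : ContDiff ℝ (⊤ : ℕ∞) g) (hgc : HasCompactSupport g) :
    ContDiff ℝ (⊤ : ℕ∞) (cconv f g) :=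
  hgc.contDiff_convolution_right _ hf hg

theorem dbarPow_cconv_left (k : Fin n → ℕ) {f g : ComplexSpace n → ℂ}
    (hf : ContDiff ℝ (⊤ : ℕ∞) f) (hg : ContDiff ℝ (⊤ : ℕ∞) g) (hgc : HasCompactSupport g) :
    dbarPow k (cconv f g) = cconv (dbarPow k f) g :=
  dbarPow_comm (fun f => cconv f g) (fun r f hf => by
    rw [dbar_cconv r hf.continuous.locallyIntegrable hg hgc, cconv_dbar r hf hg hgc]) k hf

theorem dbarPow_cconv_right (k : Fin n → ℕ) {f g : ComplexSpace n → ℂ} (hf : LocallyIntegrable f)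
    (hg : ContDiff ℝ (⊤ : ℕ∞) g) (hgc : HasCompactSupport g) :
    dbarPow k (cconv f g) = cconv f (dbarPow k g) ∧ HasCompactSupport (dbarPow k g) := by
  have iter : ∀ (r : Fin n) (j : ℕ) (g : ComplexSpace n → ℂ), ContDiff ℝ (⊤ : ℕ∞) g →
      HasCompactSupport g → (dbar r)^[j] (cconv f g) = cconv f ((dbar r)^[j] g) ∧
        HasCompactSupport ((dbar r)^[j] g) := by
    intro r j
    induction j with
    | zero => exact fun g _ hgc => ⟨rfl, hgc⟩
    | succ j ih =>
      intro g hg hgc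
      rw [Function.iterate_succ_apply, Function.iterate_succ_apply, dbar_cconv r hf hg hgc]
      exact ih _ (contDiff_dbar r hg) (hasCompactSupport_dbar r hgc)
  unfold dbarPow
  induction List.finRange n with
  | nil => exact ⟨rfl, hgc⟩
  | cons r l ih =>
    simp only [List.foldr_cons]
    rw [ih.1]
    exact iter r (k r) _ (contDiff_foldr_dbar k l hg) ih.2

/-! ### A reproducing test function for polyanalytic functions -/

/-- A smooth radial function with compact support. -/
def radialBump (n : ℕ) (z : ComplexSpace n) : ℝ := Real.smoothTransition (2 - ‖z‖ ^ 2)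

theorem contDiff_radialBump (n : ℕ) : ContDiff ℝ (⊤ : ℕ∞) (radialBump n) :=
  Real.smoothTransition.contDiff.comp (contDiff_const.sub (contDiff_norm_sq ℝ))

theorem hasCompactSupport_radialBump (n : ℕ) : HasCompactSupport (radialBump n) := by
  refine HasCompactSupport.intro (isCompact_closedBall (0 : ComplexSpace n) 2) fun z hz => ?_
  refine Real.smoothTransition.zero_of_nonpos ?_
  have : 2 < ‖z‖ := by simpa using hz
  nlinarith

theorem integral_radialBump_pos (n : ℕ) : 0 < ∫ z, radialBump n z := by
  refine (contDiff_radialBump n).continuous.integral_pos_of_hasCompactSupport_nonneg_nonzero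
    (hasCompactSupport_radialBump n) (fun z => Real.smoothTransition.nonneg _) (x := 0) ?_
  rw [radialBump, Real.smoothTransition.one_of_one_le (by simp)]
  exact one_ne_zero

/-- The normalization of the radial bump function. -/
def mollifier (n : ℕ) (z : ComplexSpace n) : ℂ :=
  (((∫ w, radialBump n w)⁻¹ * radialBump n z : ℝ) : ℂ)

theorem contDiff_mollifier (n : ℕ) : ContDiff ℝ (⊤ : ℕ∞) (mollifier n) :=
  Complex.ofRealCLM.contDiff.comp (contDiff_const.mul (contDiff_radialBump n))

theorem hasCompactSupport_mollifier (n : ℕ) : HasCompactSupport (mollifier n) :=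
  ((hasCompactSupport_radialBump n).mul_left (f := fun _ => (∫ w, radialBump n w)⁻¹)).comp_left
    (g := fun t : ℝ => (t : ℂ)) rfl

theorem integral_mollifier (n : ℕ) : ∫ z, mollifier n z = 1 := by
  unfold mollifier
  rw [integral_complex_ofReal, integral_const_mul, inv_mul_cancel₀ (integral_radialBump_pos n).ne',
    Complex.ofReal_one]

theorem mollifier_smul {w : ℂ} (hw : ‖w‖ = 1) (z : ComplexSpace n) :
    mollifier n (w • z) = mollifier n z := by
  rw [mollifier, mollifier, radialBump, radialBump, norm_smul, hw, one_mul]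

/-- The mean value property of entire functions. -/
theorem cconv_mollifier_of_differentiable {h : ComplexSpace n → ℂ} (hh : Differentiable ℂ h) :
    cconv h (mollifier n) = h := by
  funext x
  have hcs := hasCompactSupport_mollifier n
  have hc := (contDiff_mollifier n).continuous
  have hi : Integrable fun t => h (x - t) * mollifier n t := by
    refine Continuous.integrable_of_hasCompactSupport ?_ hcs.mul_left
    exact (hh.continuous.comp (by fun_prop)).mul hc
  have hi2 : Integrable (mollifier n) := hc.integrable_of_hasCompactSupport hcs
  -- The mollifier is constant on the circles `{w t : |w| = 1}`, and the average of `h(x - wt)` over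
  -- such a circle is `h(x)`, so the integrand has zero circle averages.
  have key : ∫ t, (h (x - t) * mollifier n t - h x * mollifier n t) = 0 := by
    refine integral_eq_zero_of_circleAverage measurePreserving_rotation
      (hi.sub (hi2.const_mul (h x))) fun t => ?_
    have hci : CircleIntegrable (fun w => h (x + w • (-t))) 0 1 :=
      (hh.continuous.comp (by fun_prop)).continuousOn.circleIntegrable zero_le_one
    have h1 := circleAverage_smul_of_differentiable hh x (-t) 0
    simp only [pow_zero, one_mul] at h1
    have h2 : Real.circleAverage (fun w => mollifier n t • (h (x + w • (-t)) - h x)) 0 1 = 0 := by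
      rw [Real.circleAverage_fun_smul, Real.circleAverage_fun_sub hci (circleIntegrable_const _ _ _),
        h1, Real.circleAverage_const, sub_self, smul_zero]
    refine (Real.circleAverage_congr_sphere fun w hw => ?_).trans h2
    have hw1 : ‖w‖ = 1 := by simpa using hw
    simp only [mollifier_smul hw1, smul_neg, ← sub_eq_add_neg, smul_eq_mul]
    ring
  rw [integral_sub hi (hi2.const_mul _), integral_const_mul, integral_mollifier, mul_one,
    sub_eq_zero] at key
  rw [cconv, convolution_eq_swap, ← key]
  rfl

theorem cconv_assoc {f g k : ComplexSpace n → ℂ} (hf : Continuous f) (hg : Continuous g)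
    (hgc : HasCompactSupport g) (hk : Continuous k) (hkc : HasCompactSupport k) :
    cconv (cconv f g) k = cconv f (cconv g k) := by
  funext x
  refine convolution_assoc (ContinuousLinearMap.mul ℝ ℂ) (ContinuousLinearMap.mul ℝ ℂ)
    (ContinuousLinearMap.mul ℝ ℂ) (ContinuousLinearMap.mul ℝ ℂ) (fun x y z => mul_assoc x y z)
    hf.aestronglyMeasurable hg.aestronglyMeasurable hk.aestronglyMeasurable
    (.of_forall (hgc.convolutionExists_right _ hf.locallyIntegrable hg))
    (.of_forall (hkc.norm.convolutionExists_right _ hg.norm.locallyIntegrable hk.norm)) ?_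
  refine (hgc.norm.convolution (ContinuousLinearMap.mul ℝ ℝ) hkc.norm).convolutionExists_right _
    hf.norm.locallyIntegrable ?_ x
  exact hkc.norm.continuous_convolution_right _ hg.norm.locallyIntegrable hk.norm

/-- There is a test function whose convolution with every `m`-analytic function reproduces the
function. -/
theorem exists_reproducing (n m : ℕ) : ∃ Ψ : ComplexSpace n → ℂ, ContDiff ℝ (⊤ : ℕ∞) Ψ ∧
    HasCompactSupport Ψ ∧ ∀ g, IsPolyanalytic m g → cconv g Ψ = g := by
  induction m with
  | zero =>
    refine ⟨0, contDiff_const, HasCompactSupport.zero, fun g hg => ?_⟩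
    have := hg.2 0 (by simp)
    rw [dbarPow_zero] at this
    rw [this]
    simp
  | succ m ih =>
    obtain ⟨Ψ, hΨ, hΨc, hrep⟩ := ih
    have hφ := contDiff_mollifier n
    have hφc := hasCompactSupport_mollifier n
    have hφΨ : ContDiff ℝ (⊤ : ℕ∞) (cconv (mollifier n) Ψ) :=
      contDiff_cconv hφ.continuous.locallyIntegrable hΨ hΨc
    have hφΨc : HasCompactSupport (cconv (mollifier n) Ψ) := hφc.convolution _ hΨc
    -- The witness satisfies `δ - Ψ' = (δ - φ) * (δ - Ψ)` formally, with `φ` the mollifier: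
    -- convolving with `δ - φ` lowers the order of analyticity by one, and `δ - Ψ` then annihilates
    -- the result.
    refine ⟨Ψ + mollifier n - cconv (mollifier n) Ψ, (hΨ.add hφ).sub hφΨ,
      (hΨc.add hφc).sub hφΨc, fun g hg => ?_⟩
    have hgl := hg.1.continuous.locallyIntegrable (μ := (volume : Measure (ComplexSpace n)))
    have hgφ : ContDiff ℝ (⊤ : ℕ∞) (cconv g (mollifier n)) := contDiff_cconv hgl hφ hφc
    -- For `|k| = m` the function `D̄ᵏ g` is entire, hence reproduced by the mollifier, so `D̄ᵏ (g -
    -- g * φ) = D̄ᵏ g - (D̄ᵏ g) * φ = 0`.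
    have hdiff : IsPolyanalytic m (g - cconv g (mollifier n)) := by
      refine ⟨hg.1.sub hgφ, fun k hk => ?_⟩
      have e : g - cconv g (mollifier n) = g + fun z => (-1 : ℂ) * cconv g (mollifier n) z := by
        funext z; simp [sub_eq_add_neg]
      have hent : Differentiable ℂ (dbarPow k g) :=
        differentiable_of_dbar_eq_zero (contDiff_dbarPow k hg.1) fun r => by
          rw [dbar_dbarPow r k hg.1]
          exact hg.2 _ (by simp [Finset.sum_add_distrib, hk])
      rw [e, dbarPow_add k hg.1 (contDiff_const.mul hgφ), dbarPow_const_mul k _ hgφ,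
        dbarPow_cconv_left k hg.1 hφ hφc, cconv_mollifier_of_differentiable hent]
      funext z
      simp
    have h1 := hrep _ hdiff
    have hex : ∀ u v : ComplexSpace n → ℂ, Continuous u → Continuous v → HasCompactSupport v →
        ∀ x, Integrable fun t => u t * v (x - t) := fun u v hu hv hvc x =>
      hvc.convolutionExists_right (ContinuousLinearMap.mul ℝ ℂ) hu.locallyIntegrable hv x
    have h2 : cconv (g - cconv g (mollifier n)) Ψ =
        cconv g Ψ - cconv g (cconv (mollifier n) Ψ) := by
      rw [← cconv_assoc hg.1.continuous hφ.continuous hφc hΨ.continuous hΨc]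
      funext x
      rw [Pi.sub_apply, cconv_apply, cconv_apply, cconv_apply,
        ← integral_sub (hex g Ψ hg.1.continuous hΨ.continuous hΨc x)
          (hex _ Ψ hgφ.continuous hΨ.continuous hΨc x)]
      simp [sub_mul]
    have h3 : cconv g (Ψ + mollifier n - cconv (mollifier n) Ψ) =
        cconv g Ψ + cconv g (mollifier n) - cconv g (cconv (mollifier n) Ψ) := by
      funext x
      have i1 := hex g Ψ hg.1.continuous hΨ.continuous hΨc x
      have i2 := hex g (mollifier n) hg.1.continuous hφ.continuous hφc x
      have i3 := hex g _ hg.1.continuous hφΨ.continuous hφΨc x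
      have i12 : Integrable fun t => g t * Ψ (x - t) + g t * mollifier n (x - t) := i1.add i2
      rw [Pi.sub_apply, Pi.add_apply, cconv_apply, cconv_apply g Ψ, cconv_apply g (mollifier n),
        cconv_apply g (cconv _ _), ← integral_add i1 i2, ← integral_sub i12 i3]
      congr 1
      funext t
      simp only [Pi.sub_apply, Pi.add_apply]
      ring
    rw [h3]
    rw [h2] at h1
    rw [add_sub_right_comm, h1, sub_add_cancel]

end Convolution

/-! ### The Fock space is complete -/

section Closed
variable {n : ℕ} {α : ℝ}

theorem ae_gaussian (hα : 0 < α) : ae (gaussian n α) = ae volume := by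
  refine le_antisymm (withDensity_absolutelyContinuous _ _).ae_le
    (withDensity_absolutelyContinuous' (by fun_prop) (.of_forall fun z => ?_)).ae_le
  simp only [ne_eq, ENNReal.ofReal_eq_zero, not_le]
  positivity

theorem isFiniteMeasure_gaussian (hα : 0 < α) : IsFiniteMeasure (gaussian n α) := by
  refine isFiniteMeasure_withDensity_ofReal ?_
  simpa using ((integrable_norm_pow_mul_exp (n := n) hα 0).const_mul (α ^ n / Real.pi ^ n)).2

theorem locallyIntegrable_Lp (hα : 0 < α) (f : Lp ℂ 2 (gaussian n α)) :
    LocallyIntegrable f (volume : Measure (ComplexSpace n)) := by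
  have := isFiniteMeasure_gaussian (n := n) hα
  have h1 : Integrable f (gaussian n α) := (Lp.memLp f).integrable (by norm_num)
  rw [integrable_gaussian_iff hα] at h1
  have h2 := h1.locallyIntegrable.mul_continuous (g := fun z =>
    (((α ^ n / Real.pi ^ n * Real.exp (-α * ‖z‖ ^ 2))⁻¹ : ℝ) : ℂ)) (by
      refine Complex.continuous_ofReal.comp (Continuous.inv₀ (by fun_prop) fun z => ?_)
      positivity)
  refine h2.congr (.of_forall fun z => ?_)
  have : (α ^ n / Real.pi ^ n * Real.exp (-α * ‖z‖ ^ 2)) ≠ 0 := by positivity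
  simp only [Complex.real_smul]
  rw [mul_right_comm, ← Complex.ofReal_mul, mul_inv_cancel₀ this, Complex.ofReal_one, one_mul]

theorem integral_gaussian_eq (hα : 0 < α) (f : ComplexSpace n → ℂ) : ∫ z, f z ∂gaussian n α =
    ∫ z, (α ^ n / Real.pi ^ n * Real.exp (-α * ‖z‖ ^ 2)) • f z := by
  rw [gaussian, integral_withDensity_eq_integral_toReal_smul (by fun_prop) (by simp)]
  congr 1
  funext z
  rw [ENNReal.toReal_ofReal (by positivity)]

/-- Pairing with a continuous function with compact support is continuous on `L²(γ)`. -/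
theorem continuous_integral_mul (hα : 0 < α) {ψ : ComplexSpace n → ℂ} (hψ : Continuous ψ)
    (hψc : HasCompactSupport ψ) :
    Continuous fun f : Lp ℂ 2 (gaussian n α) => ∫ t, f t * ψ t := by
  have := isFiniteMeasure_gaussian (n := n) hα
  set ρ : ComplexSpace n → ℝ := fun z => α ^ n / Real.pi ^ n * Real.exp (-α * ‖z‖ ^ 2) with hρ
  have hρ0 : ∀ z, 0 < ρ z := fun z => by positivity
  -- The pairing is the inner product with the conjugate of `ψ/ρ`, where `ρ` is the Gaussian
  -- density; compact support of `ψ` keeps this quotient square integrable although `1/ρ` grows.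
  have hw : MemLp (fun z => (starRingEnd ℂ) (ψ z * ((ρ z)⁻¹ : ℝ))) 2 (gaussian n α) := by
    refine Continuous.memLp_of_hasCompactSupport ?_ ?_
    · refine Complex.continuous_conj.comp (hψ.mul (Complex.continuous_ofReal.comp
        (Continuous.inv₀ (by fun_prop) fun z => (hρ0 z).ne')))
    · exact hψc.mul_right.comp_left (map_zero _)
  have key : ∀ f : Lp ℂ 2 (gaussian n α), ∫ t, f t * ψ t = inner ℂ (hw.toLp _) f := by
    intro f
    rw [L2.inner_def]
    have h1 : ∫ z, (inner ℂ ((hw.toLp _ : Lp ℂ 2 (gaussian n α)) z) (f z) : ℂ) ∂gaussian n α =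
        ∫ z, f z * (ψ z * ((ρ z)⁻¹ : ℝ)) ∂gaussian n α := by
      refine integral_congr_ae ?_
      filter_upwards [hw.coeFn_toLp] with z hz
      rw [hz, RCLike.inner_apply, Complex.conj_conj]
    rw [h1, integral_gaussian_eq hα]
    congr 1
    funext z
    have h2 := (hρ0 z).ne'
    rw [Complex.real_smul]
    change _ = (ρ z : ℂ) * _
    have h3 : (ρ z : ℂ) ≠ 0 := by exact_mod_cast h2
    push_cast
    field_simp
  simp only [key]
  exact continuous_const.inner continuous_id

/-- Elements `f` of the Fock space satisfy `f = f * Ψ` almost everywhere and `f * D̄ᵏΨ = 0` for `|k|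
= m`. At a fixed point each of these convolutions is continuous in the `L²` norm, so both identities
survive limits, the first along an almost everywhere convergent subsequence. For a limit `f`, the
smooth function `f * Ψ` is then an `m`-analytic representative. -/
theorem isClosed_fock (n m : ℕ) (hα : 0 < α) :
    IsClosed (fock n m α : Set (Lp ℂ 2 (gaussian n α))) := by
  obtain ⟨Ψ, hΨ, hΨc, hrep⟩ := exists_reproducing n m
  have hcont : ∀ (ψ : ComplexSpace n → ℂ), Continuous ψ → HasCompactSupport ψ → ∀ z,
      Continuous fun f : Lp ℂ 2 (gaussian n α) => cconv f ψ z := fun ψ hψ hψc z =>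
    continuous_integral_mul hα (ψ := fun t => ψ (z - t)) (by fun_prop)
      (hψc.comp_homeomorph (Homeomorph.subLeft z))
  have hcongr : ∀ (f : Lp ℂ 2 (gaussian n α)) (g ψ : ComplexSpace n → ℂ), f =ᵐ[gaussian n α] g →
      cconv f ψ = cconv g ψ := fun f g ψ h => by
    funext z
    rw [Filter.EventuallyEq, ae_gaussian hα] at h
    rw [cconv_apply, cconv_apply]
    refine integral_congr_ae ?_
    filter_upwards [h] with t ht
    rw [ht]
  refine isClosed_of_closure_subset fun f hf => ?_
  refine ⟨cconv f Ψ, ⟨contDiff_cconv (locallyIntegrable_Lp hα f) hΨ hΨc, fun k hk => ?_⟩, ?_⟩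
  · obtain ⟨h1, h2⟩ := dbarPow_cconv_right k (locallyIntegrable_Lp hα f) hΨ hΨc
    rw [h1]
    funext z
    have hcl : IsClosed {f : Lp ℂ 2 (gaussian n α) | cconv f (dbarPow k Ψ) z = 0} :=
      isClosed_eq (hcont _ (contDiff_dbarPow k hΨ).continuous h2 z) continuous_const
    refine closure_minimal (fun f hf => ?_) hcl hf
    obtain ⟨g, hg, hfg⟩ := hf
    have h3 := (dbarPow_cconv_right k (hg.1.continuous.locallyIntegrable) hΨ hΨc).1
    rw [hrep g hg, hg.2 k hk] at h3
    change cconv f (dbarPow k Ψ) z = 0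
    rw [hcongr f g _ hfg, ← h3]
    rfl
  · obtain ⟨u, hu, hlim⟩ := mem_closure_iff_seq_limit.1 hf
    obtain ⟨ns, hns, hae⟩ := (tendstoInMeasure_of_tendsto_Lp hlim).exists_seq_tendsto_ae
    have hu' : ∀ᵐ z ∂gaussian n α, ∀ i, u i z = cconv (u i) Ψ z := ae_all_iff.2 fun i => by
      obtain ⟨g, hg, hfg⟩ := hu i
      filter_upwards [hfg] with z hz
      rw [hcongr _ g _ hfg, hrep g hg, hz]
    filter_upwards [hae, hu'] with z h1 h2
    refine tendsto_nhds_unique h1 ?_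
    simp only [h2]
    exact ((hcont Ψ hΨ.continuous hΨc z).tendsto f).comp (hlim.comp hns.tendsto_atTop)

theorem completeSpace_fock (n m : ℕ) (hα : 0 < α) : CompleteSpace (fock n m α) :=
  (isClosed_fock n m hα).completeSpace_coe

end Closed
end
end PolyFock

namespace PolyFock
noncomputable section

/-! ### Fourier integrals of Gaussians times polynomials -/

section GaussianIntegral
open Polynomial

theorem derivative_hermite_succ (k : ℕ) :
    derivative (hermite (k + 1)) = (k + 1 : ℤ[X]) * hermite k := by
  induction k with
  | zero => simp [hermite_succ]
  | succ k ih =>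
    have h := hermite_succ (k + 1)
    rw [h, derivative_sub, derivative_mul, derivative_X, ih, derivative_mul]
    have h2 := hermite_succ k
    simp only [derivative_add, derivative_natCast, derivative_one, add_zero, zero_mul, zero_add]
    push_cast
    linear_combination (-(k + 1 : ℤ[X])) * h2

theorem eval_hermiteR_add_two (k : ℕ) (t : ℝ) : (hermiteR (k + 2)).eval t =
    t * (hermiteR (k + 1)).eval t - (k + 1) * (hermiteR k).eval t := by
  have h : derivative (hermiteR (k + 1)) = (k + 1 : ℝ[X]) * hermiteR k := by
    rw [hermiteR, derivative_map, derivative_hermite_succ]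
    simp [hermiteR]
  rw [hermiteR_succ, h]
  simp

/-- The function `p(x) e^{-x²/2 - isx}`. -/
def polyExp (p : ℂ[X]) (s x : ℝ) : ℂ :=
  p.eval (x : ℂ) * Complex.exp (-(1 / 2) * (x : ℂ) ^ 2 - Complex.I * s * x)

theorem continuous_polyExp (p : ℂ[X]) (s : ℝ) : Continuous (polyExp p s) := by
  unfold polyExp; fun_prop

theorem norm_polyExp (p : ℂ[X]) (s x : ℝ) :
    ‖polyExp p s x‖ = ‖p.eval (x : ℂ)‖ * Real.exp (-(1 / 2) * x ^ 2) := by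
  rw [polyExp, norm_mul, Complex.norm_exp]
  congr 2
  simp [← Complex.ofReal_pow]

theorem integrable_polyExp (p : ℂ[X]) (s : ℝ) : Integrable (polyExp p s) := by
  induction p using Polynomial.induction_on' with
  | add p q hp hq =>
    refine (hp.add hq).congr (.of_forall fun x => ?_)
    simp [polyExp, add_mul]
  | monomial j c =>
    have h := ((integrable_eval_mul_exp (X ^ j) (b := 1 / 2) (by norm_num)).norm).const_mul ‖c‖
    refine h.mono' (continuous_polyExp _ s).aestronglyMeasurable (.of_forall fun x => ?_)
    rw [norm_polyExp, eval_monomial]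
    simp [mul_assoc]

theorem integral_polyExp_derivative (p : ℂ[X]) (s : ℝ) :
    ∫ x, polyExp (derivative p - (X + C (Complex.I * s)) * p) s x = 0 := by
  refine integral_eq_zero_of_hasDerivAt_of_integrable (f := polyExp p s) (fun x => ?_)
    (integrable_polyExp _ s) (integrable_polyExp _ s)
  have h1 : HasDerivAt (fun x : ℝ => p.eval (x : ℂ)) ((derivative p).eval (x : ℂ)) x :=
    (p.hasDerivAt (x : ℂ)).comp_ofReal
  have h2 : HasDerivAt (fun x : ℝ => Complex.exp (-(1 / 2) * (x : ℂ) ^ 2 - Complex.I * s * x))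
      (Complex.exp (-(1 / 2) * (x : ℂ) ^ 2 - Complex.I * s * x) *
        (-(1 / 2) * (2 * (x : ℂ)) - Complex.I * s)) x := by
    have h3 : HasDerivAt (fun z : ℂ => Complex.exp (-(1 / 2) * z ^ 2 - Complex.I * s * z))
        (Complex.exp (-(1 / 2) * (x : ℂ) ^ 2 - Complex.I * s * x) *
          (-(1 / 2) * (2 * (x : ℂ)) - Complex.I * s)) (x : ℂ) := by
      have := (((hasDerivAt_pow 2 (x : ℂ)).const_mul (-(1 / 2) : ℂ)).sub
        ((hasDerivAt_id (x : ℂ)).const_mul (Complex.I * s))).cexp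
      simpa using! this
    exact h3.comp_ofReal
  refine (h1.mul h2).congr_deriv ?_
  simp only [polyExp, eval_sub, eval_mul, eval_add, eval_X, eval_C]
  ring

theorem polyExp_integral_linear (p r : ℂ[X]) (c : ℂ) (s : ℝ) :
    ∫ x, polyExp (p + C c * r) s x = (∫ x, polyExp p s x) + c * ∫ x, polyExp r s x := by
  rw [← integral_const_mul, ← integral_add (integrable_polyExp p s)
    ((integrable_polyExp r s).const_mul c)]
  congr 1
  funext x
  simp [polyExp]
  ring

/-- Writing `X + is = B + i(y + s)` with `B = X - iy`, the vanishing integral of the derivative of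
`Bᵏ e^{-x²/2 - isx}` gives a three-term recursion in `k`. It is the Hermite recursion at `y + s`,
twisted by `(-i)ᵏ`. -/
theorem integral_polyExp_pow (k : ℕ) (y s : ℝ) :
    ∫ x, polyExp ((X - C (Complex.I * y)) ^ k) s x =
      (-Complex.I) ^ k * ((hermiteR k).eval (y + s) : ℝ) * ∫ x, polyExp 1 s x := by
  set B : ℂ[X] := X - C (Complex.I * y) with hB
  have hBd : derivative B = 1 := by simp [hB]
  -- At `k = 0` the truncated exponent `k - 1` is harmless, since its term carries the factor `k`.
  have hstep : ∀ k : ℕ, ∫ x, polyExp (B ^ (k + 1)) s x =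
      k * (∫ x, polyExp (B ^ (k - 1)) s x) -
        Complex.I * (y + s) * ∫ x, polyExp (B ^ k) s x := by
    intro k
    have h1 := integral_polyExp_derivative (B ^ k) s
    have e : derivative (B ^ k) - (X + C (Complex.I * s)) * B ^ k =
        (0 + C (k : ℂ) * B ^ (k - 1)) + C (-1) * (B ^ (k + 1) + C (Complex.I * (y + s)) * B ^ k) := by
      rw [derivative_pow, hBd, pow_succ]
      simp only [hB, map_add, map_mul, map_neg, map_one]
      ring
    rw [e, polyExp_integral_linear, polyExp_integral_linear, polyExp_integral_linear] at h1
    have h0 : ∫ x, polyExp 0 s x = 0 := by simp [polyExp]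
    rw [h0] at h1
    linear_combination -h1
  induction k using Nat.strong_induction_on with
  | _ k ih =>
    match k with
    | 0 => simp [hermiteR]
    | 1 =>
      have := hstep 0
      simp only [zero_add, pow_zero, Nat.cast_zero, zero_mul, zero_sub] at this
      rw [this]
      simp [hermiteR]
    | k + 2 =>
      have h1 := hstep (k + 1)
      rw [Nat.add_sub_cancel, ih k (by omega), ih (k + 1) (by omega)] at h1
      rw [h1, eval_hermiteR_add_two]
      push_cast
      linear_combination ((-Complex.I) ^ k * (k + 1) * ((hermiteR k).eval (y + s) : ℝ) *
        ∫ x, polyExp 1 s x) * Complex.I_mul_I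

theorem integral_polyExp_one (s : ℝ) : ∫ x, polyExp 1 s x =
    (2 * Real.pi : ℂ) ^ (1 / 2 : ℂ) * Complex.exp (-(1 / 2) * (s : ℂ) ^ 2) := by
  have h := integral_cexp_quadratic (b := -(1 / 2)) (by norm_num) (-Complex.I * s) 0
  have e : ∀ x : ℝ, polyExp 1 s x =
      Complex.exp (-(1 / 2) * (x : ℂ) ^ 2 + -Complex.I * s * x + 0) := fun x => by
    rw [polyExp, eval_one, one_mul]
    congr 1
    ring
  simp only [e]
  rw [h]
  congr 2
  · ring_nf
  · rw [neg_mul, neg_sq, mul_pow, Complex.I_sq]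
    ring

/-- The one-dimensional Fourier integral behind the identity `F U z̄^k = c e^{-|ξ|²/4} q_{k,ξ}`. -/
theorem integral_flat_one (k : ℕ) (ξ y : ℝ) :
    ∫ x : ℝ, Complex.exp (-(ξ * x) * Complex.I) *
      (Complex.exp (-(1 / 2) * (x : ℂ) ^ 2 - 1 / 2 * (y : ℂ) ^ 2 - Complex.I * (x * y)) *
        ((x : ℂ) - Complex.I * y) ^ k) =
      (2 * Real.pi : ℂ) ^ (1 / 2 : ℂ) * (-Complex.I) ^ k *
        ((Real.exp (-(1 / 4) * ξ ^ 2) * (Real.exp (-(1 / 4) * (ξ + 2 * y) ^ 2) *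
          (hermiteR k).eval (ξ + 2 * y)) : ℝ) : ℂ) := by
  have e : ∀ x : ℝ, Complex.exp (-(ξ * x) * Complex.I) *
      (Complex.exp (-(1 / 2) * (x : ℂ) ^ 2 - 1 / 2 * (y : ℂ) ^ 2 - Complex.I * (x * y)) *
        ((x : ℂ) - Complex.I * y) ^ k) = Complex.exp (-(1 / 2) * (y : ℂ) ^ 2) *
          polyExp ((X - C (Complex.I * y)) ^ k) (y + ξ) x := fun x => by
    have h : Complex.exp (-(ξ * x) * Complex.I) *
        Complex.exp (-(1 / 2) * (x : ℂ) ^ 2 - 1 / 2 * (y : ℂ) ^ 2 - Complex.I * (x * y)) =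
        Complex.exp (-(1 / 2) * (y : ℂ) ^ 2) *
          Complex.exp (-(1 / 2) * (x : ℂ) ^ 2 - Complex.I * ((y + ξ : ℝ) : ℂ) * x) := by
      rw [← Complex.exp_add, ← Complex.exp_add]
      congr 1
      push_cast
      ring
    simp only [polyExp, eval_pow, eval_sub, eval_X, eval_C]
    linear_combination ((x : ℂ) - Complex.I * y) ^ k * h
  simp only [e]
  rw [integral_const_mul, integral_polyExp_pow, integral_polyExp_one]
  -- The exponents match by `y²/2 + (y + ξ)²/2 = ξ²/4 + (ξ + 2y)²/4`; this splits off the Gaussian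
  -- in `ξ` from the one inside `q_{k,ξ}`.
  have h1 : Complex.exp (-(1 / 2) * (y : ℂ) ^ 2) * Complex.exp (-(1 / 2) * ((y + ξ : ℝ) : ℂ) ^ 2) =
      ((Real.exp (-(1 / 4) * ξ ^ 2) * Real.exp (-(1 / 4) * (ξ + 2 * y) ^ 2) : ℝ) : ℂ) := by
    rw [← Real.exp_add, ← Complex.exp_add, Complex.ofReal_exp]
    congr 1
    push_cast
    ring
  have h2 : y + (y + ξ) = ξ + 2 * y := by ring
  rw [h2]
  push_cast at h1 ⊢
  linear_combination ((-Complex.I) ^ k * ((hermiteR k).eval (ξ + 2 * y) : ℝ) *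
    (2 * Real.pi : ℂ) ^ (1 / 2 : ℂ)) * h1

end GaussianIntegral
end
end PolyFock

namespace PolyFock
noncomputable section

open scoped FourierTransform SchwartzMap

/-! ### Slices and the partial Fourier transform -/

theorem integrable_two_smul {X E : Type*} [MeasurableSpace X] {μ : Measure X}
    [NormedAddCommGroup E] [NormedSpace ℂ E] {h : X → ℂ} {g : X → E} (hh : MemLp h 2 μ)
    (hg : MemLp g 2 μ) : Integrable (fun x => h x • g x) μ :=
  memLp_one_iff_integrable.1 (hg.smul hh)

theorem memLp_two_mul_prod {X Y : Type*} [MeasurableSpace X] [MeasurableSpace Y] {μ : Measure X}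
    {ν : Measure Y} {h : X → ℂ} {e : Y → ℂ} (hh : MemLp h 2 μ) (he : MemLp e 2 ν) :
    MemLp (fun p : X × Y => h p.1 * e p.2) 2 (μ.prod ν) := by
  have hm : AEStronglyMeasurable (fun p : X × Y => h p.1 * e p.2) (μ.prod ν) :=
    hh.1.comp_fst.mul he.1.comp_snd
  rw [memLp_two_iff_integrable_sq_norm hm]
  simpa only [norm_mul, mul_pow] using hh.norm.integrable_sq.mul_prod he.norm.integrable_sq

section SliceIntegral
variable {X Y : Type*} [MeasurableSpace X] [MeasurableSpace Y] {μ : Measure X} {ν : Measure Y}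
  [SigmaFinite μ] [SigmaFinite ν]

theorem coeFn_slice_toLp [MeasurableSpace.CountablyGenerated Y] {f : X × Y → ℂ} (hf : MemLp f 2 (μ.prod ν)) :
    slice μ ν (hf.toLp f) =ᵐ[μ] fun x => classL2 ν fun y => f (x, y) := by
  refine (MemLp.coeFn_toLp (memLp_classL2_slice (hf.toLp f))).trans ?_
  filter_upwards [Measure.ae_ae_of_ae_prod hf.coeFn_toLp] with x hx
  exact classL2_congr hx

/-- Weak integrals of slices, computed by Fubini's theorem. -/
theorem inner_integral_smul_slice [MeasurableSpace.CountablyGenerated Y] {f : X × Y → ℂ} (hf : MemLp f 2 (μ.prod ν)) {h : X → ℂ}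
    (hh : MemLp h 2 μ) (e : Lp ℂ 2 ν) :
    inner ℂ e (∫ x, h x • slice μ ν (hf.toLp f) x ∂μ) =
      ∫ y, (starRingEnd ℂ) (e y) * ∫ x, h x * f (x, y) ∂μ ∂ν := by
  have hi : Integrable (fun x => h x • slice μ ν (hf.toLp f) x) μ :=
    integrable_two_smul hh (Lp.memLp _)
  have he : MemLp (fun y => (starRingEnd ℂ) (e y)) 2 ν := (Lp.memLp e).star
  have hF : Integrable (fun p : X × Y => (h p.1 * (starRingEnd ℂ) (e p.2)) * f p) (μ.prod ν) :=
    integrable_two_smul (memLp_two_mul_prod hh he) hf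
  rw [← integral_inner hi]
  have h1 : ∫ x, inner ℂ e (h x • slice μ ν (hf.toLp f) x) ∂μ =
      ∫ x, ∫ y, (h x * (starRingEnd ℂ) (e y)) * f (x, y) ∂ν ∂μ := by
    refine integral_congr_ae ?_
    filter_upwards [coeFn_slice_toLp hf, memLp_slice hf] with x hx hm
    rw [hx, inner_smul_right, classL2_of_memLp hm, L2.inner_def, ← integral_const_mul]
    refine integral_congr_ae ?_
    filter_upwards [hm.coeFn_toLp] with y hy
    rw [hy, RCLike.inner_apply]
    ring
  rw [h1, integral_integral_swap hF]
  refine integral_congr_ae (.of_forall fun y => ?_)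
  simp only
  rw [← integral_const_mul]
  refine integral_congr_ae (.of_forall fun x => ?_)
  simp only
  ring

end SliceIntegral

theorem integral_comp_inv_two_pi_smul {n : ℕ} {E : Type*} [NormedAddCommGroup E] [NormedSpace ℝ E]
    (f : RealSpace n → E) :
    ∫ ξ, f ((2 * Real.pi)⁻¹ • ξ) ∂lebesgueT n = ((2 * Real.pi) ^ ((n : ℝ) / 2) : ℝ) • ∫ ξ, f ξ := by
  rw [integral_lebesgueT, Measure.integral_comp_smul, smul_smul, finrank_euclideanSpace_fin]
  congr 1
  rw [inv_pow, inv_inv, abs_of_pos (by positivity), ← Real.rpow_natCast,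
    ← Real.rpow_add (by positivity)]
  congr 1
  ring

/-- The duality characterizing `fourierT`. -/
theorem integral_smul_fourierT {n : ℕ} {E : Type*} [NormedAddCommGroup E] [InnerProductSpace ℂ E]
    [CompleteSpace E] (f : Lp E 2 (lebesgueT n)) (g : 𝓢(RealSpace n, ℂ)) :
    ∫ ξ, g ((2 * Real.pi)⁻¹ • ξ) • fourierT n E f ξ ∂lebesgueT n =
      (((2 * Real.pi) ^ ((n : ℝ) / 2) : ℝ) : ℂ) • ∫ x, (𝓕 g) x • f x ∂lebesgueT n := by
  set c : ℝ := (2 * Real.pi) ^ (-(n : ℝ) / 4) with hc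
  set f₁ := weightedComp (isWeightedChange_id n) f with hf₁
  have h1 : fourierT n E f =ᵐ[lebesgueT n] fun ξ =>
      (c : ℂ) • Lp.fourierTransformₗᵢ (RealSpace n) E f₁ ((2 * Real.pi)⁻¹ • ξ) :=
    coeFn_weightedComp (isWeightedChange_dilation n) _
  have h2 : f₁ =ᵐ[volume] fun x => (c : ℂ) • f x := coeFn_weightedComp (isWeightedChange_id n) f
  have h3 : ∫ ξ, g ((2 * Real.pi)⁻¹ • ξ) • fourierT n E f ξ ∂lebesgueT n =
      ∫ ξ, (c : ℂ) • (g ((2 * Real.pi)⁻¹ • ξ) •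
        Lp.fourierTransformₗᵢ (RealSpace n) E f₁ ((2 * Real.pi)⁻¹ • ξ)) ∂lebesgueT n := by
    refine integral_congr_ae ?_
    filter_upwards [h1] with ξ hξ
    rw [hξ, smul_comm]
  have h5 := integral_comp_inv_two_pi_smul (n := n) fun ξ =>
    (c : ℂ) • (g ξ • Lp.fourierTransformₗᵢ (RealSpace n) E f₁ ξ)
  have h4 : ∫ x, (𝓕 g) x • f₁ x = ∫ x, (c : ℂ) • ((𝓕 g) x • f x) := by
    refine integral_congr_ae ?_
    filter_upwards [h2] with x hx
    rw [hx, smul_comm]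
  rw [h3, h5, integral_smul, integral_smul_fourier_Lp, h4, integral_smul, integral_lebesgueT,
    ← Complex.coe_smul, ← Complex.coe_smul]
  congr 1
  rw [smul_smul, ← Complex.ofReal_mul, hc, ← Real.rpow_add (by positivity)]
  congr 3
  ring

theorem memLp_lebesgueT {n : ℕ} {E : Type*} [NormedAddCommGroup E] {f : RealSpace n → E} {p : ℝ≥0∞} :
    MemLp f p (lebesgueT n) ↔ MemLp f p volume := by
  rw [lebesgueT_eq]
  refine ⟨fun h => ?_, fun h => h.smul_measure (by simp)⟩
  have h' := h.smul_measure (c := (ENNReal.ofReal ((2 * Real.pi) ^ (-(n : ℝ) / 2)))⁻¹)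
    (by simp; positivity)
  rwa [smul_smul, ENNReal.inv_mul_cancel (by simp; positivity) (by simp), one_smul] at h'

/-- The dilation `x ↦ c x`. -/
def dilationCLE (n : ℕ) {c : ℝ} (hc : c ≠ 0) : RealSpace n ≃L[ℝ] RealSpace n :=
  (LinearEquiv.smulOfNeZero ℝ (RealSpace n) c hc).toContinuousLinearEquiv

theorem memLp_schwartz_dilation {n : ℕ} (g : 𝓢(RealSpace n, ℂ)) :
    MemLp (fun ξ : RealSpace n => g ((2 * Real.pi)⁻¹ • ξ)) 2 (lebesgueT n) :=
  memLp_lebesgueT.2 ((SchwartzMap.compCLMOfContinuousLinearEquiv ℂ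
    (dilationCLE n (c := (2 * Real.pi)⁻¹) (by positivity)) g).memLp 2 volume)

/-- The dilation permutes the Schwartz functions, so this is the uniqueness of a locally integrable
function with given Schwartz pairings. The dilated form is the one supplied by
`integral_smul_fourierT`. -/
theorem Lp_ext_schwartz_dilation {n : ℕ} {E : Type*} [NormedAddCommGroup E]
    [InnerProductSpace ℂ E] [CompleteSpace E] (f₁ f₂ : Lp E 2 (lebesgueT n))
    (h : ∀ g : 𝓢(RealSpace n, ℂ), ∫ ξ, g ((2 * Real.pi)⁻¹ • ξ) • f₁ ξ ∂lebesgueT n =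
      ∫ ξ, g ((2 * Real.pi)⁻¹ • ξ) • f₂ ξ ∂lebesgueT n) : f₁ = f₂ := by
  have hpi : 2 * Real.pi ≠ 0 := by positivity
  have key : ∀ g : 𝓢(RealSpace n, ℂ), ∫ ξ, g ξ • (f₁ ξ - f₂ ξ) = 0 := fun g => by
    have h1 := h (SchwartzMap.compCLMOfContinuousLinearEquiv ℂ (dilationCLE n hpi) g)
    have e : ∀ ξ : RealSpace n, SchwartzMap.compCLMOfContinuousLinearEquiv ℂ (dilationCLE n hpi) g
        ((2 * Real.pi)⁻¹ • ξ) = g ξ := fun ξ => by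
      simp only [SchwartzMap.compCLMOfContinuousLinearEquiv_apply, Function.comp_apply]
      congr 1
      change (2 * Real.pi) • ((2 * Real.pi)⁻¹ • ξ) = ξ
      rw [smul_smul, mul_inv_cancel₀ hpi, one_smul]
    have hg : MemLp g 2 (lebesgueT n) := memLp_lebesgueT.2 (g.memLp 2 volume)
    simp only [e] at h1
    rw [← sub_eq_zero, ← integral_sub (integrable_two_smul hg (Lp.memLp _))
      (integrable_two_smul hg (Lp.memLp _)), integral_lebesgueT,
      smul_eq_zero_iff_right (by positivity)] at h1
    simpa only [smul_sub] using h1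
  have hm : MemLp (fun ξ => f₁ ξ - f₂ ξ) 2 (volume : Measure (RealSpace n)) :=
    memLp_lebesgueT.1 ((Lp.memLp f₁).sub (Lp.memLp f₂))
  have h0 := ae_eq_zero_of_integral_schwartz_smul (hm.locallyIntegrable (by norm_num)) key
  rw [Filter.EventuallyEq, ← ae_lebesgueT] at h0
  refine Lp.ext ?_
  filter_upwards [h0] with ξ hξ
  exact sub_eq_zero.1 hξ

theorem fourier_inv_two_pi_smul {n : ℕ} (f : RealSpace n → ℂ) (ξ : RealSpace n) :
    𝓕 f ((2 * Real.pi)⁻¹ • ξ) = ∫ x, expChar ξ x * f x := by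
  rw [Real.fourier_eq']
  congr 1
  funext x
  rw [expChar, inner_smul_right, real_inner_comm, smul_eq_mul]
  congr 2
  have : (Real.pi : ℂ) ≠ 0 := by exact_mod_cast Real.pi_ne_zero
  push_cast
  field_simp

/-- A pointwise computation of the partial Fourier transform of an integrable function. -/
theorem fourierT_slice_toLp {n : ℕ} {G w : RealSpace n × RealSpace n → ℂ}
    (hG : MemLp G 2 ((lebesgueT n).prod (lebesgueT n)))
    (hw : MemLp w 2 ((lebesgueT n).prod (lebesgueT n)))
    (hGi : ∀ y, Integrable (fun x => G (x, y)) (lebesgueT n))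
    (h : ∀ ξ y, ∫ x, expChar ξ x * G (x, y) ∂lebesgueT n = w (ξ, y)) :
    fourierT n _ (slice (lebesgueT n) (lebesgueT n) (hG.toLp G)) =
      slice (lebesgueT n) (lebesgueT n) (hw.toLp w) := by
  -- The `L²` transform is accessible only by duality. Both sides are paired with a Schwartz
  -- function of `ξ` and a vector `v` of the fiber; Fubini's theorem then leaves, for each fixed
  -- `y`, the multiplication formula for the integrable function `G(·, y)`.
  refine Lp_ext_schwartz_dilation _ _ fun g => (integral_smul_fourierT _ g).trans ?_
  have hg := memLp_schwartz_dilation g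
  have hg' : MemLp (⇑(𝓕 g : 𝓢(RealSpace n, ℂ))) 2 (lebesgueT n) :=
    memLp_lebesgueT.2 ((𝓕 g : 𝓢(RealSpace n, ℂ)).memLp 2 volume)
  refine ext_inner_left ℂ fun v => (inner_smul_right _ _ _).trans ?_
  refine ((congrArg _ (inner_integral_smul_slice hG hg' v)).trans ?_).trans
    (inner_integral_smul_slice hw hg v).symm
  rw [← integral_const_mul]
  refine integral_congr_ae (.of_forall fun y => ?_)
  simp only
  rw [mul_left_comm]
  congr 1
  have e3 : ∀ ξ, w (ξ, y) =
      ((2 * Real.pi) ^ (-(n : ℝ) / 2) : ℝ) * 𝓕 (fun x => G (x, y)) ((2 * Real.pi)⁻¹ • ξ) :=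
    fun ξ => by
      rw [← h, integral_lebesgueT, fourier_inv_two_pi_smul, Complex.real_smul]
  simp only [e3]
  have e4 := integral_comp_inv_two_pi_smul (n := n) fun ξ =>
    g ξ * (((2 * Real.pi) ^ (-(n : ℝ) / 2) : ℝ) * 𝓕 (fun x => G (x, y)) ξ)
  rw [e4, integral_lebesgueT, Complex.real_smul, Complex.real_smul]
  have e5 := integral_fourier_smul (f := ⇑g) (g := fun x => G (x, y)) g.integrable
    (integrable_lebesgueT.1 (hGi y))
  simp only [smul_eq_mul] at e5
  rw [SchwartzMap.fourier_coe, e5, ← integral_const_mul]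
  congr 2
  funext ξ
  ring

end
end PolyFock

namespace PolyFock
noncomputable section

/-! ### The partial Fourier transform of the flattened monomials -/

/-- The function `U z̄ᵏ`. -/
def flatMon {n : ℕ} (α : ℝ) (k : Fin n → ℕ) (p : RealSpace n × RealSpace n) : ℂ :=
  flatWeight p • conjMon k (flatPoint α p)

theorem flatMon_eq_prod {n : ℕ} (α : ℝ) (k : Fin n → ℕ) (x y : RealSpace n) :
    flatMon α k (x, y) = ((2 : ℝ) ^ ((n : ℝ) / 2) : ℝ) * (∏ r, (((√α)⁻¹ : ℝ) : ℂ) ^ k r) *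
      ∏ r, (Complex.exp (-(1 / 2) * (x r : ℂ) ^ 2 - 1 / 2 * (y r : ℂ) ^ 2
        - Complex.I * (x r * y r)) * ((x r : ℂ) - Complex.I * y r) ^ k r) := by
  have h1 : Complex.exp (-(1 / 2) * (‖x‖ : ℂ) ^ 2 - 1 / 2 * (‖y‖ : ℂ) ^ 2
      - Complex.I * (inner ℝ x y : ℝ)) = ∏ r, Complex.exp (-(1 / 2) * (x r : ℂ) ^ 2 -
        1 / 2 * (y r : ℂ) ^ 2 - Complex.I * (x r * y r)) := by
    rw [← Complex.exp_sum]
    congr 1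
    rw [← Complex.ofReal_pow, ← Complex.ofReal_pow, EuclideanSpace.real_norm_sq_eq,
      EuclideanSpace.real_norm_sq_eq, PiLp.inner_apply]
    simp only [Finset.sum_sub_distrib, ← Finset.mul_sum]
    push_cast
    congr 2
    refine Finset.sum_congr rfl fun r _ => ?_
    simp [mul_comm]
  have h2 : conjMon k (flatPoint α (x, y)) = (∏ r, (((√α)⁻¹ : ℝ) : ℂ) ^ k r) *
      ∏ r, ((x r : ℂ) - Complex.I * y r) ^ k r := by
    rw [conjMon, ← Finset.prod_mul_distrib]
    refine Finset.prod_congr rfl fun r _ => ?_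
    rw [← mul_pow]
    congr 1
    simp [flatPoint, complexPoint, sub_eq_add_neg]
    ring
  rw [flatMon, flatWeight, h1, h2, Finset.prod_mul_distrib, smul_eq_mul]
  ring

theorem integrable_flatMon {n : ℕ} (α : ℝ) (k : Fin n → ℕ) (y : RealSpace n) :
    Integrable (fun x => flatMon α k (x, y)) (lebesgueT n) := by
  rw [integrable_lebesgueT]
  simp only [flatMon_eq_prod]
  refine Integrable.const_mul (integrable_prod_coord (f := fun r t =>
    Complex.exp (-(1 / 2) * (t : ℂ) ^ 2 - 1 / 2 * (y r : ℂ) ^ 2 - Complex.I * (t * y r)) *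
      ((t : ℂ) - Complex.I * y r) ^ k r) fun r => ?_) _
  refine ((integrable_polyExp ((Polynomial.X - Polynomial.C (Complex.I * y r)) ^ k r)
    (y r)).const_mul (Complex.exp (-(1 / 2) * (y r : ℂ) ^ 2))).congr (.of_forall fun t => ?_)
  simp only [polyExp, Polynomial.eval_pow, Polynomial.eval_sub, Polynomial.eval_X,
    Polynomial.eval_C]
  rw [mul_left_comm, ← Complex.exp_add, mul_comm]
  congr 2
  ring

theorem expChar_eq_prod {n : ℕ} (a ξ : RealSpace n) :
    expChar a ξ = ∏ r, Complex.exp (-(a r * ξ r) * Complex.I) := by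
  rw [expChar, ← Complex.exp_sum, PiLp.inner_apply]
  congr 1
  push_cast
  rw [← Finset.sum_mul, Finset.sum_neg_distrib]
  congr 2
  refine Finset.sum_congr rfl fun r _ => ?_
  simp [mul_comm]

/-- All factors split over the coordinates, and each coordinate contributes `integral_flat_one`.
Only `C ≠ 0` is used later: this is what ties the monomial `z̄ᵏ` to the basis vector `q_{k,ξ}` in
every fiber. -/
theorem exists_integral_expChar_mul_flatMon {n : ℕ} {α : ℝ} (hα : 0 < α) (k : Fin n → ℕ) :
    ∃ C : ℂ, C ≠ 0 ∧ ∀ ξ y, ∫ x, expChar ξ x * flatMon α k (x, y) ∂lebesgueT n =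
      C * (Real.exp (-(1 / 4) * ‖ξ‖ ^ 2) : ℂ) * qFun k ξ y := by
  have hs : 0 < √α := Real.sqrt_pos.2 hα
  -- `A` collects the constants of the integral and `B` the normalization of `q_{k,ξ}`, so `C =
  -- A/B`.
  set A : ℂ := ((2 * Real.pi) ^ (-(n : ℝ) / 2) : ℝ) * (((2 : ℝ) ^ ((n : ℝ) / 2) : ℝ) *
    (∏ r, (((√α)⁻¹ : ℝ) : ℂ) ^ k r) *
      ∏ r, ((2 * Real.pi : ℂ) ^ (1 / 2 : ℂ) * (-Complex.I) ^ k r)) with hA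
  set B : ℝ := 2 ^ ((n : ℝ) / 2) * Real.pi ^ ((n : ℝ) / 4) *
    ∏ r, (((k r).factorial : ℝ) * √Real.pi) ^ (-(1 / 2) : ℝ) with hB
  have hB0 : B ≠ 0 := by positivity
  have hA0 : A ≠ 0 := by
    rw [hA]
    have h2 : (2 * Real.pi : ℂ) ≠ 0 := by exact_mod_cast (by positivity : 2 * Real.pi ≠ 0)
    refine mul_ne_zero (Complex.ofReal_ne_zero.2 (by positivity)) (mul_ne_zero (mul_ne_zero
      (Complex.ofReal_ne_zero.2 (by positivity)) (Finset.prod_ne_zero_iff.2 fun r _ =>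
        pow_ne_zero _ (Complex.ofReal_ne_zero.2 (by positivity)))) (Finset.prod_ne_zero_iff.2
          fun r _ => mul_ne_zero ?_ (pow_ne_zero _ (neg_ne_zero.2 Complex.I_ne_zero))))
    simp [Complex.cpow_eq_zero_iff, h2]
  refine ⟨A / B, div_ne_zero hA0 (Complex.ofReal_ne_zero.2 hB0), fun ξ y => ?_⟩
  have e1 : ∀ x, expChar ξ x * flatMon α k (x, y) = (((2 : ℝ) ^ ((n : ℝ) / 2) : ℝ) *
      (∏ r, (((√α)⁻¹ : ℝ) : ℂ) ^ k r)) * ∏ r, (Complex.exp (-(ξ r * x r) * Complex.I) *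
        (Complex.exp (-(1 / 2) * (x r : ℂ) ^ 2 - 1 / 2 * (y r : ℂ) ^ 2
          - Complex.I * (x r * y r)) * ((x r : ℂ) - Complex.I * y r) ^ k r)) := fun x => by
    rw [flatMon_eq_prod, expChar_eq_prod, mul_left_comm, ← Finset.prod_mul_distrib]
  have e2 := integral_prod_coord (𝕜 := ℂ) fun r (t : ℝ) =>
    (Complex.exp (-(ξ r * t) * Complex.I) *
        (Complex.exp (-(1 / 2) * (t : ℂ) ^ 2 - 1 / 2 * (y r : ℂ) ^ 2
          - Complex.I * (t * y r)) * ((t : ℂ) - Complex.I * y r) ^ k r))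
  have e3 : qFun k ξ y = ((B * ∏ r, (Real.exp (-(1 / 4) * (ξ r + 2 * y r) ^ 2) *
      (hermiteR (k r)).eval (ξ r + 2 * y r)) : ℝ) : ℂ) := by
    rw [qFun]
    simp only [hermiteFun_div_sqrt]
    rw [Finset.prod_mul_distrib, hB]
    congr 1
    ring
  have e4 : Real.exp (-(1 / 4) * ‖ξ‖ ^ 2) = ∏ r, Real.exp (-(1 / 4) * (ξ r) ^ 2) := by
    rw [← Real.exp_sum, EuclideanSpace.real_norm_sq_eq, Finset.mul_sum]
  rw [integral_lebesgueT, integral_congr_ae (.of_forall e1), integral_const_mul, e2, e3, e4]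
  simp only [integral_flat_one]
  rw [Finset.prod_mul_distrib, Complex.real_smul, hA]
  have hBC : (B : ℂ) ≠ 0 := Complex.ofReal_ne_zero.2 hB0
  rw [← Complex.ofReal_prod, Finset.prod_mul_distrib (f := fun r => Real.exp (-(1 / 4) * (ξ r) ^ 2)),
    Complex.ofReal_mul, Complex.ofReal_mul B]
  clear_value B
  field_simp

theorem expChar_sub {n : ℕ} (ξ x a : RealSpace n) :
    expChar ξ x = expChar a ξ * expChar ξ (x - a) := by
  rw [expChar, expChar, expChar, ← Complex.exp_add, inner_sub_right, real_inner_comm a ξ]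
  congr 1
  push_cast
  ring

theorem memLp_flatMon {n : ℕ} {α : ℝ} (hα : 0 < α) (k : Fin n → ℕ) :
    MemLp (flatMon α k) 2 ((lebesgueT n).prod (lebesgueT n)) :=
  (isWeightedChange_flat hα).memLp (memLp_conjMon hα k)

theorem memLp_shift_flatMon {n : ℕ} {α : ℝ} (hα : 0 < α) (k : Fin n → ℕ) (a : RealSpace n) :
    MemLp (fun p : RealSpace n × RealSpace n => flatMon α k (p.1 - a, p.2)) 2
      ((lebesgueT n).prod (lebesgueT n)) :=
  (memLp_flatMon hα k).comp_measurePreserving (measurePreserving_horizontal a)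

theorem translation_flatten_monL2 {n : ℕ} {α : ℝ} (hα : 0 < α) (k : Fin n → ℕ)
    (a : RealSpace n) :
    translation a (flatten n hα (monL2 hα k)) = (memLp_shift_flatMon hα k a).toLp _ := by
  have h : flatten n hα (monL2 hα k) = (memLp_flatMon hα k).toLp _ :=
    MemLp.toLp_congr ((isWeightedChange_flat hα).memLp (Lp.memLp _)) _
      ((isWeightedChange_flat hα).ae_smul_eq (memLp_conjMon hα k).coeFn_toLp)
  rw [h]
  exact Lp.toLp_compMeasurePreserving (memLp_flatMon hα k) (measurePreserving_horizontal a)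

theorem memLp_gaussian_mul_qFun {n : ℕ} (k : Fin n → ℕ) (C : ℂ) (a : RealSpace n) :
    MemLp (fun p : RealSpace n × RealSpace n =>
      C * (expChar a p.1 * (Real.exp (-(1 / 4) * ‖p.1‖ ^ 2) : ℂ)) * qFun k p.1 p.2) 2
      ((lebesgueT n).prod (lebesgueT n)) := by
  have h1 : MemLp (fun ξ : RealSpace n => C * (expChar a ξ * (Real.exp (-(1 / 4) * ‖ξ‖ ^ 2) : ℂ)))
      2 (lebesgueT n) := by
    refine MemLp.const_mul ?_ C
    refine (memLp_gaussianFun n (b := 1 / 4) (by norm_num)).mono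
      ((continuous_expChar a).mul (by fun_prop)).aestronglyMeasurable (.of_forall fun ξ => ?_)
    rw [norm_mul, norm_expChar, one_mul]
  have h2 := memLp_two_mul_prod h1 (memLp_qFun_zero k)
  -- The shear `(ξ, v) ↦ (ξ, v + ξ/2)` turns a product function, whose square integrability is
  -- clear, into the one with `q_{k,ξ}(v) = q_{k,0}(v + ξ/2)`.
  have hmp : MeasurePreserving (fun p : RealSpace n × RealSpace n =>
      (p.1, p.2 + (2 : ℝ)⁻¹ • p.1)) ((lebesgueT n).prod (lebesgueT n))
      ((lebesgueT n).prod (lebesgueT n)) :=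
    (MeasurePreserving.id _).skew_product (g := fun ξ v => v + (2 : ℝ)⁻¹ • ξ) (by fun_prop)
      (.of_forall fun ξ => (measurePreserving_half ξ).map_eq)
  refine (h2.comp_measurePreserving hmp).ae_eq (.of_forall fun p => ?_)
  simp only [Function.comp_apply]
  rw [← qFun_eq]

/-- The partial Fourier transform of the translates of `U z̄ᵏ`. -/
theorem exists_fourierT_slice_flatten_monL2 {n : ℕ} {α : ℝ} (hα : 0 < α) (k : Fin n → ℕ) :
    ∃ C : ℂ, C ≠ 0 ∧ ∀ a : RealSpace n,
      fourierT n _ (slice (lebesgueT n) (lebesgueT n)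
        (translation a (flatten n hα (monL2 hα k)))) =ᵐ[lebesgueT n]
      fun ξ => (C * (expChar a ξ * (Real.exp (-(1 / 4) * ‖ξ‖ ^ 2) : ℂ))) • q k ξ := by
  obtain ⟨C, hC, h⟩ := exists_integral_expChar_mul_flatMon hα k
  refine ⟨C, hC, fun a => ?_⟩
  rw [translation_flatten_monL2, fourierT_slice_toLp _ (memLp_gaussian_mul_qFun k C a)]
  · refine (coeFn_slice_toLp _).trans (.of_forall fun ξ => ?_)
    simp only
    rw [q, ← MemLp.toLp_const_smul]
    exact classL2_of_memLp ((memLp_qFun k ξ).const_smul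
      (C * (expChar a ξ * (Real.exp (-(1 / 4) * ‖ξ‖ ^ 2) : ℂ))))
  · exact fun y => (integrable_flatMon α k y).comp_sub_right a
  · intro ξ y
    have e : ∀ x, expChar ξ x * flatMon α k (x - a, y) =
      expChar a ξ * (expChar ξ (x - a) * flatMon α k (x - a, y)) := fun x => by
      rw [expChar_sub ξ x a, mul_assoc]
    simp only [e]
    rw [integral_const_mul, integral_sub_right_eq_self
      (fun x => expChar ξ x * flatMon α k (x, y)) a, h]
    ring

end
end PolyFock

namespace PolyFock
noncomputable section

/-! ### The operators `R` are unitary and intertwine translations with characters -/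

/-- Stars and bars: the slack `m - 1 - |k|`, added as a zeroth entry, turns the multi-indices into
`n + 1` natural numbers with sum `m - 1`. -/
theorem dim_eq_choose (n : ℕ) {m : ℕ} (hm : 1 ≤ m) : dim n m = (n + m - 1).choose n := by
  obtain ⟨M, rfl⟩ := Nat.exists_eq_add_of_le' hm
  let e : multiIndices n (M + 1) ≃ {P : Fin (n + 1) → ℕ // ∑ i, P i = M} :=
    { toFun := fun k => ⟨Fin.cons (M - ∑ r, ofLex k.1 r) (ofLex k.1), by
        have := (mem_multiIndices (ofLex k.1)).1 k.2
        rw [Fin.sum_cons]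
        omega⟩
      invFun := fun P => ⟨toLex (Fin.tail P.1), (mem_multiIndices _).2 (by
        have := P.2
        rw [Fin.sum_univ_succ] at this
        simp only [Fin.tail]
        omega)⟩
      left_inv := fun k => Subtype.ext (by simp)
      right_inv := fun P => Subtype.ext (by
        have := P.2
        rw [Fin.sum_univ_succ] at this
        conv_rhs => rw [← Fin.cons_self_tail P.1]
        simp only [ofLex_toLex, Fin.tail]
        congr 1
        omega) }
  rw [dim, ← Fintype.card_coe, Fintype.card_congr (e.trans (Sym.equivNatSumOfFintype _ _).symm),
    Sym.card_sym_eq_choose, Fintype.card_fin]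
  have h1 : n + 1 + M - 1 = n + M := by omega
  have h2 : n + (M + 1) - 1 = n + M := by omega
  rw [h1, h2, ← Nat.choose_symm_add]

theorem translation_translation {n : ℕ} (a b : RealSpace n)
    (f : Lp ℂ 2 ((lebesgueT n).prod (lebesgueT n))) :
    translation a (translation b f) = translation (a + b) f := by
  have h : ∀ c g, translation c g =ᵐ[(lebesgueT n).prod (lebesgueT n)]
      fun p => (g : RealSpace n × RealSpace n → ℂ) (p.1 - c, p.2) := fun c g =>
    Lp.coeFn_compMeasurePreserving g (measurePreserving_horizontal c)
  refine Lp.ext ?_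
  filter_upwards [h a (translation b f), h (a + b) f,
    (measurePreserving_horizontal a).quasiMeasurePreserving.ae (h b f)] with p h1 h2 h3
  rw [h1, h2, h3, sub_sub]

theorem translation_zero {n : ℕ} (f : Lp ℂ 2 ((lebesgueT n).prod (lebesgueT n))) :
    translation 0 f = f := by
  refine Lp.ext ?_
  refine (Lp.coeFn_compMeasurePreserving f (measurePreserving_horizontal 0)).trans
    (.of_forall fun p => ?_)
  simp

theorem inner_translation_left {n : ℕ} (a : RealSpace n)
    (f g : Lp ℂ 2 ((lebesgueT n).prod (lebesgueT n))) :
    inner ℂ (translation a f) g = inner ℂ f (translation (-a) g) := by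
  rw [← (translation a).inner_map_map f, translation_translation, add_neg_cancel, translation_zero]

/-- Orthogonality to all modulations of `v` means pointwise orthogonality to `v`. -/
theorem ae_inner_eq_zero_of_modulations {n : ℕ} {E : Type*} [NormedAddCommGroup E]
    [InnerProductSpace ℂ E] {v : RealSpace n → E}
    (F : RealSpace n → Lp E 2 (lebesgueT n))
    (hF : ∀ a, F a =ᵐ[lebesgueT n] fun ξ => expChar a ξ • v ξ) (u : Lp E 2 (lebesgueT n))
    (h : ∀ a, inner ℂ (F a) u = 0) : ∀ᵐ ξ ∂lebesgueT n, inner ℂ (v ξ) (u ξ) = 0 := by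
  have h1 : ∀ a, (fun ξ => inner ℂ (F a ξ) (u ξ)) =ᵐ[lebesgueT n]
      fun ξ => expChar (-a) ξ • inner ℂ (v ξ) (u ξ) := fun a => by
    filter_upwards [hF a] with ξ hξ
    rw [hξ, inner_smul_left, conj_expChar, smul_eq_mul]
  refine ae_eq_zero_of_integral_expChar ?_ fun a => ?_
  -- At `a = 0` the character is `1`, so `v` itself represents the square integrable `F 0`, and `⟨v,
  -- u⟩` is integrable.
  · refine (L2.integrable_inner (𝕜 := ℂ) (F 0) u).congr ((h1 0).trans (.of_forall fun ξ => ?_))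
    simp [expChar]
  · have h2 := h (-a)
    rw [L2.inner_def, integral_congr_ae (h1 (-a)), neg_neg] at h2
    exact h2

theorem coeFn_fiberCoeffs (n m : ℕ) (f : Lp (Lp ℂ 2 (lebesgueT n)) 2 (lebesgueT n)) :
    fiberCoeffs n m f =ᵐ[lebesgueT n] fun ξ => coeffs n m ξ (f ξ) := by
  have h := ContinuousLinearMap.coeFn_holder (r := 2) (ContinuousLinearMap.id ℂ
    (Lp ℂ 2 (lebesgueT n) →L[ℂ] EuclideanSpace ℂ (Fin (dim n m))))
      ((memLp_coeffs n m).toLp (coeffs n m)) f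
  filter_upwards [h, (memLp_coeffs n m).coeFn_toLp] with ξ h1 h2
  refine h1.trans ?_
  rw [h2]
  rfl

theorem inner_fourierT_slice {n : ℕ} (f g : Lp ℂ 2 ((lebesgueT n).prod (lebesgueT n))) :
    inner ℂ (fourierT n _ (slice (lebesgueT n) (lebesgueT n) f))
      (fourierT n _ (slice (lebesgueT n) (lebesgueT n) g)) = (inner ℂ f g : ℂ) :=
  LinearIsometry.inner_map_map (𝕜 := ℂ)
    ((fourierT n (Lp ℂ 2 (lebesgueT n))).comp (slice (lebesgueT n) (lebesgueT n))) f g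

/-- An isometry whose range has trivial orthogonal complement is unitary. -/
theorem adjoint_comp_self_and_comp_adjoint {H K : Type*} [NormedAddCommGroup H]
    [InnerProductSpace ℂ H] [CompleteSpace H] [NormedAddCommGroup K] [InnerProductSpace ℂ K]
    [CompleteSpace K] (R : H →L[ℂ] K) (hR : ∀ x, ‖R x‖ = ‖x‖)
    (h : ∀ u, (∀ x, inner ℂ (R x) u = 0) → u = 0) :
    ContinuousLinearMap.adjoint R ∘L R = 1 ∧ R ∘L ContinuousLinearMap.adjoint R = 1 := by
  have h1 := R.norm_map_iff_adjoint_comp_self.1 hR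
  refine ⟨h1, ContinuousLinearMap.ext fun u => ?_⟩
  refine sub_eq_zero.1 (h _ fun x => ?_)
  have h2 := DFunLike.congr_fun h1 (ContinuousLinearMap.adjoint R u)
  simp only [ContinuousLinearMap.comp_apply, one_apply_eq_self] at h2 ⊢
  rw [← ContinuousLinearMap.adjoint_inner_right, map_sub, h2, sub_self, inner_zero_right]

section FlatFock
variable {n m : ℕ} {α : ℝ} (hα : 0 < α)

/-- The Fourier transform of an element of `H_m` is fiberwise orthogonal to the higher `q_{k,ξ}`. -/
theorem ae_inner_q_fourierT_eq_zero {g : Lp ℂ 2 ((lebesgueT n).prod (lebesgueT n))}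
    (hg : g ∈ flatFock n m hα) (k : Fin n → ℕ) (hk : m ≤ ∑ r, k r) :
    ∀ᵐ ξ ∂lebesgueT n, inner ℂ (q k ξ)
      (fourierT n _ (slice (lebesgueT n) (lebesgueT n) g) ξ) = 0 := by
  obtain ⟨C, hC, h⟩ := exists_fourierT_slice_flatten_monL2 hα k
  have h0 := ae_inner_eq_zero_of_modulations
    (v := fun ξ => (C * (Real.exp (-(1 / 4) * ‖ξ‖ ^ 2) : ℂ)) • q k ξ)
    (fun a => fourierT n _ (slice (lebesgueT n) (lebesgueT n)
        (translation a (flatten n hα (monL2 hα k)))))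
    (fun a => (h a).trans (.of_forall fun ξ => by
      simp only [smul_smul]
      congr 1
      ring)) (fourierT n _ (slice (lebesgueT n) (lebesgueT n) g)) fun a => by
      rw [inner_fourierT_slice]
      -- The translation is moved onto `g`, which stays in `H_m`; there orthogonality to `U z̄ᵏ`
      -- comes from the Fock space through the isometry `U`.
      rw [inner_translation_left]
      obtain ⟨f, hf, hfg⟩ := translation_mem_flatFock hα (-a) g hg
      rw [← hfg]
      exact ((flatten n hα).inner_map_map _ _).trans (inner_monL2_eq_zero hα hk hf)
  filter_upwards [h0] with ξ hξ
  rw [inner_smul_left] at hξ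
  refine (mul_eq_zero.1 hξ).resolve_left ?_
  rw [← ne_eq, map_ne_zero]
  exact mul_ne_zero hC (Complex.ofReal_ne_zero.2 (Real.exp_pos _).ne')

/-- Slicing and `F ⊗ I` are isometric. There are only countably many `k`, so in almost every fiber
all coefficients with `|k| ≥ m` vanish at once, and the `d` retained coefficients carry the full
norm. -/
theorem norm_RH (g : flatFock n m hα) : ‖RH n m hα g‖ = ‖g‖ := by
  set G := fourierT n _ (slice (lebesgueT n) (lebesgueT n)
    (g : Lp ℂ 2 ((lebesgueT n).prod (lebesgueT n)))) with hG
  have h1 : ‖G‖ = ‖g‖ := ((fourierT n _).norm_map _).trans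
    ((slice (lebesgueT n) (lebesgueT n)).norm_map _)
  have h2 : ∀ᵐ ξ ∂lebesgueT n, ∀ k : Fin n → ℕ, m ≤ ∑ r, k r → inner ℂ (q k ξ) (G ξ) = 0 := by
    refine ae_all_iff.2 fun k => ?_
    by_cases hk : m ≤ ∑ r, k r
    · filter_upwards [ae_inner_q_fourierT_eq_zero hα g.2 k hk] with ξ hξ _ using hξ
    · exact .of_forall fun ξ h => absurd h hk
  rw [← h1]
  change ‖fiberCoeffs n m G‖ = ‖G‖
  rw [Lp.norm_def, Lp.norm_def]
  congr 1
  refine eLpNorm_congr_norm_ae ?_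
  filter_upwards [coeFn_fiberCoeffs n m G, h2] with ξ h3 h4
  rw [h3, norm_coeffs_eq ξ _ h4]

/-- The translate by `a` of `U z̄ᵏ`, `k = φ(j)`, as an element of `H_m`. -/
def flatMonTranslate (a : RealSpace n) (j : Fin (dim n m)) : flatFock n m hα :=
  rhoH n m hα a (flattenFock n m hα ⟨monL2 hα (enum n m j), monL2_mem_fock hα (sum_enum_lt j)⟩)

theorem rhoH_flatMonTranslate (a b : RealSpace n) (j : Fin (dim n m)) :
    rhoH n m hα a (flatMonTranslate hα b j) = flatMonTranslate hα (a + b) j :=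
  Subtype.ext (translation_translation a b _)

/-- By orthonormality the coefficient vector of `q_{φ(j),ξ}` is `e_j`, so only the Gaussian and the
character remain. -/
theorem exists_RH_flatMonTranslate (j : Fin (dim n m)) : ∃ C : ℂ, C ≠ 0 ∧ ∀ a : RealSpace n,
    RH n m hα (flatMonTranslate hα a j) =ᵐ[lebesgueT n] fun ξ => expChar a ξ •
      ((C * (Real.exp (-(1 / 4) * ‖ξ‖ ^ 2) : ℂ)) • EuclideanSpace.single j (1 : ℂ)) := by
  obtain ⟨C, hC, h⟩ := exists_fourierT_slice_flatten_monL2 hα (enum n m j)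
  refine ⟨C, hC, fun a => ?_⟩
  refine (coeFn_fiberCoeffs n m _).trans ?_
  filter_upwards [h a] with ξ hξ
  refine (congrArg (coeffs n m ξ) hξ).trans ?_
  rw [map_smul, coeffs_q_enum, smul_smul]
  congr 1
  ring

/-- Density of the range: orthogonality to all modulations of `e^{-|ξ|²/4} e_j` kills the `j`-th
component almost everywhere, as the Gaussian has no zeros. -/
theorem eq_zero_of_inner_RH {u : L2d n m}
    (hu : ∀ a j, inner ℂ (RH n m hα (flatMonTranslate hα a j)) u = 0) : u = 0 := by
  rw [Lp.eq_zero_iff_ae_eq_zero]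
  have h : ∀ᵐ ξ ∂lebesgueT n, ∀ j, u ξ j = 0 := ae_all_iff.2 fun j => by
    obtain ⟨C, hC, h⟩ := exists_RH_flatMonTranslate hα j
    filter_upwards [ae_inner_eq_zero_of_modulations _ h u fun a => hu a j] with ξ hξ
    rw [inner_smul_left, EuclideanSpace.inner_single_left, map_one, one_mul] at hξ
    refine (mul_eq_zero.1 hξ).resolve_left ?_
    rw [← ne_eq, map_ne_zero]
    exact mul_ne_zero hC (Complex.ofReal_ne_zero.2 (Real.exp_pos _).ne')
  filter_upwards [h] with ξ hξ
  ext j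
  exact hξ j

theorem inner_mulOp_expSymbol (a : RealSpace n) (f g : L2d n m) :
    inner ℂ (mulOp (expSymbol a) f) (mulOp (expSymbol a) g) = (inner ℂ f g : ℂ) := by
  rw [L2.inner_def, L2.inner_def]
  refine integral_congr_ae ?_
  filter_upwards [coeFn_mulOp_expSymbol a f, coeFn_mulOp_expSymbol a g] with ξ hf hg
  rw [hf, hg, inner_smul_left, inner_smul_right, ← mul_assoc, ← Complex.normSq_eq_conj_mul_self,
    Complex.normSq_eq_norm_sq, norm_expChar]
  simp

theorem mulOp_expSymbol_RH_flatMonTranslate (a b : RealSpace n) (j : Fin (dim n m)) :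
    mulOp (expSymbol a) (RH n m hα (flatMonTranslate hα b j)) =
      RH n m hα (flatMonTranslate hα (a + b) j) := by
  obtain ⟨C, hC, h⟩ := exists_RH_flatMonTranslate hα j
  refine Lp.ext ?_
  filter_upwards [coeFn_mulOp_expSymbol a (RH n m hα (flatMonTranslate hα b j)), h b, h (a + b)]
    with ξ h1 h2 h3
  rw [h1, h2, h3, smul_smul]
  congr 1
  rw [expChar, expChar, expChar, ← Complex.exp_add, inner_add_left]
  congr 1
  push_cast
  ring

theorem inner_RH (f g : flatFock n m hα) :
    inner ℂ (RH n m hα f) (RH n m hα g) = (inner ℂ f g : ℂ) :=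
  LinearIsometry.inner_map_map ⟨(RH n m hα).toLinearMap, norm_RH hα⟩ f g

/-- The relation is tested on the total family of images of translated monomials, where it is known
explicitly, and extended to all of `H_m` by the isometry of `RH`; the transform of a general
translate is never computed. -/
theorem RH_rhoH (b : RealSpace n) (g : flatFock n m hα) :
    RH n m hα (rhoH n m hα b g) = mulOp (expSymbol b) (RH n m hα g) := by
  rw [← sub_eq_zero]
  refine eq_zero_of_inner_RH hα fun a j => ?_
  -- With `a = b + c`, the translation by `b` on one side and the character of `b` on the other
  -- occur in both arguments of an inner product and cancel.
  obtain ⟨c, rfl⟩ : ∃ c, a = b + c := ⟨a - b, by abel⟩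
  rw [inner_sub_right, inner_RH, sub_eq_zero, ← mulOp_expSymbol_RH_flatMonTranslate,
    inner_mulOp_expSymbol, inner_RH, ← rhoH_flatMonTranslate]
  exact (translation b).inner_map_map _ _

theorem completeSpace_flatFock (n m : ℕ) {α : ℝ} (hα : 0 < α) :
    CompleteSpace (flatFock n m hα) := by
  have := completeSpace_fock n m hα
  exact (((flatten n hα).isComplete_map_iff).2
    (completeSpace_coe_iff_isComplete.1 this)).completeSpace_coe

/-- `U` evaluates at `(x + iy)/√α`, so a shift by `a` in the Fock space is a shift by `√α a` in `x`.
This is the source of the scale `√α` in the characters for the Fock space. -/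
theorem flattenFock_rhoF (a : RealSpace n) (f : fock n m α) :
    flattenFock n m hα (rhoF n m α a f) = rhoH n m hα (√α • a) (flattenFock n m hα f) := by
  refine Subtype.ext ?_
  have h := translation_flatten hα (√α • a) (f : Lp ℂ 2 (gaussian n α))
  rw [smul_smul, inv_mul_cancel₀ (Real.sqrt_pos.2 hα).ne', one_smul] at h
  exact h.symm

theorem norm_RF (f : fock n m α) : ‖RF n m hα f‖ = ‖f‖ :=
  (norm_RH hα _).trans ((flatten n hα).norm_map _)

theorem eq_zero_of_inner_RF {u : L2d n m} (hu : ∀ f, inner ℂ (RF n m hα f) u = 0) : u = 0 := by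
  refine eq_zero_of_inner_RH hα fun a j => ?_
  obtain ⟨f, hf, hfg⟩ := (flatMonTranslate (m := m) hα a j).2
  have e : flattenFock n m hα ⟨f, hf⟩ = flatMonTranslate hα a j := Subtype.ext hfg
  rw [← e]
  exact hu ⟨f, hf⟩

theorem RH_comp_rhoH (a : RealSpace n) :
    RH n m hα ∘L rhoH n m hα a = mulOp (expSymbol ((1 : ℝ) • a)) ∘L RH n m hα := by
  rw [one_smul]
  exact ContinuousLinearMap.ext fun g => RH_rhoH hα a g

theorem RF_comp_rhoF (a : RealSpace n) :
    RF n m hα ∘L rhoF n m α a = mulOp (expSymbol (√α • a)) ∘L RF n m hα :=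
  ContinuousLinearMap.ext fun f => (congrArg (RH n m hα) (flattenFock_rhoF hα a f)).trans
    (RH_rhoH hα (√α • a) (flattenFock n m hα f))

theorem RH_unitary [CompleteSpace (flatFock n m hα)] :
    ContinuousLinearMap.adjoint (RH n m hα) ∘L RH n m hα = 1 ∧
      RH n m hα ∘L ContinuousLinearMap.adjoint (RH n m hα) = 1 :=
  adjoint_comp_self_and_comp_adjoint (RH n m hα) (norm_RH hα) fun _ hu =>
    eq_zero_of_inner_RH hα fun a j => hu (flatMonTranslate hα a j)

theorem RF_unitary [CompleteSpace (fock n m α)] :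
    ContinuousLinearMap.adjoint (RF n m hα) ∘L RF n m hα = 1 ∧
      RF n m hα ∘L ContinuousLinearMap.adjoint (RF n m hα) = 1 :=
  adjoint_comp_self_and_comp_adjoint (RF n m hα) (norm_RF hα) fun _ hu =>
    eq_zero_of_inner_RF hα hu

end FlatFock

end
end PolyFock


/-! ### The isomorphisms for the flattened space and the Fock space -/

theorem mainTheorem1 (n m : ℕ) (hn : 1 ≤ n) (hm : 1 ≤ m) (α : ℝ) (hα : 0 < α) :
    PolyFock.dim n m = (n + m - 1).choose n ∧
    (∃ _ : CompleteSpace (PolyFock.flatFock n m hα),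
      ∃ A : VonNeumannAlgebra (PolyFock.flatFock n m hα),
        (A : Set (PolyFock.flatFock n m hα →L[ℂ] PolyFock.flatFock n m hα)) =
            Set.centralizer (Set.range (PolyFock.rhoH n m hα)) ∧
          ∃ Φ : PolyFock.Symbols n m ≃⋆ₐ[ℂ] A.toStarSubalgebra,
            Isometry Φ ∧
              ∀ σ : PolyFock.Symbols n m,
                (Φ σ : PolyFock.flatFock n m hα →L[ℂ] PolyFock.flatFock n m hα) =
                  PolyFock.Lam (PolyFock.RH n m hα) σ) ∧
    (∃ _ : CompleteSpace (PolyFock.fock n m α),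
      ∃ A : VonNeumannAlgebra (PolyFock.fock n m α),
        (A : Set (PolyFock.fock n m α →L[ℂ] PolyFock.fock n m α)) =
            Set.centralizer (Set.range (PolyFock.rhoF n m α)) ∧
          ∃ Φ : PolyFock.Symbols n m ≃⋆ₐ[ℂ] A.toStarSubalgebra,
            Isometry Φ ∧
              ∀ σ : PolyFock.Symbols n m,
                (Φ σ : PolyFock.fock n m α →L[ℂ] PolyFock.fock n m α) =
                  PolyFock.Lam (PolyFock.RF n m hα) σ) := by
  have hH := PolyFock.completeSpace_flatFock n m hα
  have hF := PolyFock.completeSpace_fock n m hα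
  refine ⟨PolyFock.dim_eq_choose n hm, ⟨hH, ?_⟩, ⟨hF, ?_⟩⟩
  · have h := PolyFock.RH_unitary (n := n) (m := m) hα
    exact PolyFock.exists_vonNeumann_starAlgEquiv (PolyFock.RH n m hα) h.1 h.2
      (PolyFock.rhoH n m hα) one_ne_zero (PolyFock.RH_comp_rhoH hα)
  · have h := PolyFock.RF_unitary (n := n) (m := m) hα
    exact PolyFock.exists_vonNeumann_starAlgEquiv (PolyFock.RF n m hα) h.1 h.2
      (PolyFock.rhoF n m α) (Real.sqrt_pos.2 hα).ne' (PolyFock.RF_comp_rhoF hα)
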